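/- For $\operatorname{Im}\tau>0$ let $\wp(\tau,z)=\frac1{z^2}+\sum_{0\ne\omega\in L_\tau}\left(\frac1{(z-\omega)^2}-\frac1{\omega^2}\right)$, $L_\tau=\mathbb Z+\mathbb Z\tau$. Subscripts $\tau,z$ denote partial derivatives. For a function $f(\tau,z)$ put $D=2ff_{zz}-3f_z^2$ and $$\phi=16f_{zz}^3-72f^2f_{zz}^2-216ff_z^2f_{zz}+54f_z^4+864f^3f_z^2,$$ and consider, where $D\neq0$, the system $$f_{\tau\tau}=\frac{\frac1{16}\phi+3\pi^2(2ff_{\tau z}^2-6f_\tau f_zf_{\tau z}+3f_\tau^2f_{zz})}{3\pi^2D},$$ $$f_{\tau zz}=\frac{\frac i4\phi+\pi\bigl(36ff_z(2ff_{\tau z}-3f_\tau f_z)-12f_{zz}(f_zf_{\tau z}-f_\tau f_{zz})\bigr)}{3\pi D},\qquad f_{zzz}=12ff_z .\tag{S}$$ For $k\ge1$ let $G_{k,0}$ be the group of transformations $\tilde\tau=\frac{a\tau+b}{c\tau+d}$, $\tilde z=\frac{z+\lambda\tau+\mu}{c\tau+d}$, $\tilde f=(c\tau+d)^kf$ with $\begin{pmatrix}a&b\\c&d\end{pmatrix}\in\mathrm{SL}(2,\mathbb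 R)$, $\lambda,\mu\in\mathbb R$, and for $f\ne0$, $D\ne 0$ (with $k=2$) let $$\mathscr I_2=\frac{Df_{\tau\tau}-2ff_{\tau z}^2+3f_\tau(2f_zf_{\tau z}-f_\tau f_{zz})}{f^3D},$$ $$\mathscr J_2=\frac{Df_{\tau zz}-(2ff_{\tau z}-3f_\tau f_z)f_{zzz}+4f_{zz}(f_zf_{\tau z}-f_\tau f_{zz})}{f^3D},$$ $$\mathscr L_2=\frac{f_z}{f^{3/2}},\quad \mathscr M_2=\frac{f_{zz}}{f^2},\quad \mathscr N_2=\frac{f_{zzz}}{f^{5/2}},$$ for any choice of the square root $f^{1/2}$ (transformed by $\tilde f^{1/2}=(c\tau+d)f^{1/2}$). Then: 1. $\wp$ is a weak (meromorphic) Jacobi form of weight $2$ and index $0$, that is: it is meromorphic on $\mathbb H\times\mathbb C$, $\wp\!\left(\frac{a\tau+b}{c\tau+d},\frac{z+\lambda\tau+\mu}{c\tau+d}\right)=(c\tau+d)^2\wp(\tau,z)$ for $\begin{pmatrix}a&b\\c&d\end{pmatrix}\in\mathrm{SL}(2,\mathbb Z)$ and $\lambda,\mu\in\mathbb Z$, and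 on a nonempty open set it has a Fourier expansion $\sum c(n,r)e^{2\pi i(n\tau+rz)}$ with $n$ bounded below. It is holomorphic in $(\tau,z)$ for $z\notin L_\tau$. 2. The system (S) is involutive (as a third-order system, including the first derivatives of its first equation: regular, with involutive symbol, and formally integrable) and $G_{2,0}$-invariant. 3. $\mathscr I_2,\mathscr J_2,\mathscr L_2,\mathscr M_2,\mathscr N_2$ are differential invariants of $G_{2,0}$, and where $f\ne0$ and $D\neq0$ the system (S) is equivalent to $$\mathscr N_2=12\mathscr L_2,\qquad \mathscr J_2=4\pi i\,\mathscr I_2,$$ $$24\pi^2(2\mathscr M_2-3\mathscr L_2^2)\mathscr I_2=8\mathscr M_2^3-36\mathscr M_2^2-108\mathscr L_2^2\mathscr M_2+27\mathscr L_2^2(\mathscr L_2^2+16).$$ 4. $f=\wp$ satisfies (S), multiplied by its denominators, at all $(\tau,z)$ with $z\notin L_\tau$, hence (S) itself where $D\ne0$, and its invariant form where also $\wp\ne0$. In particular $\wp_{zzz}=12\wp\wp_z$. Moreover $\wp_z^2=4\wp^3-g_2\wp-g_3$ with $g_2=\frac43\pi^4E_4(\tau)$, $g_3=\frac8{27}\pi^6E_6(\tau)$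 ($E_4,E_6$ the normalised Eisenstein series); for $f=\wp$ one has $\phi=-2(g_2^3-27g_3^2)=-2(2\pi)^{12}\Delta(\tau)$, where $\Delta=q\prod_{n\ge1}(1-q^n)^{24}$, $q=e^{2\pi i\tau}$; and the first equation of (S) takes the Monge--Ampère form $$2\wp(\wp_{zz}\wp_{\tau\tau}-\wp_{\tau z}^2)=3\wp_z^2\wp_{\tau\tau}-6\wp_\tau\wp_z\wp_{\tau z}+3\wp_\tau^2\wp_{zz}-\frac{(2\pi)^{10}}6\Delta(\tau).$$ -/

import Mathlib

open scoped Topology MatrixGroups UpperHalfPlane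

noncomputable section

/-! ### Jets and differential polynomials in two independent variables `τ, z` -/

/-- Jets of a function `f(τ,z)`: the value at `(i, j)` stands for `∂_τ^i ∂_z^j f`. -/
abbrev Jet2 : Type := ℕ × ℕ → ℂ

/-- The jet of `f` at the point `x = (τ, z)`. -/
def jetAt (f : ℂ × ℂ → ℂ) (x : ℂ × ℂ) : Jet2 := fun p =>
  iteratedDeriv p.1 (fun t => iteratedDeriv p.2 (fun w => f (t, w)) x.2) x.1

/-- Differential polynomials with constant coefficients; the variable `X (i, j)` is the jet
coordinate `∂_τ^i ∂_z^j f`. -/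
abbrev DiffPoly : Type := MvPolynomial (ℕ × ℕ) ℂ

/-- The total derivative with respect to `τ`. -/
def totalDτ : Derivation ℂ DiffPoly DiffPoly :=
  MvPolynomial.mkDerivation ℂ fun p : ℕ × ℕ => (MvPolynomial.X (p.1 + 1, p.2) : DiffPoly)

/-- The total derivative with respect to `z`. -/
def totalDz : Derivation ℂ DiffPoly DiffPoly :=
  MvPolynomial.mkDerivation ℂ fun p : ℕ × ℕ => (MvPolynomial.X (p.1, p.2 + 1) : DiffPoly)

/-- A system of finitely many partial differential equations `eq i = 0` of orders `ord i`, for one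
function of `(τ, z)`, considered where the differential polynomial `nondeg` does not vanish. -/
structure PDESystem where
  num : ℕ
  eq : Fin num → DiffPoly
  ord : Fin num → ℕ
  nondeg : DiffPoly

namespace PDESystem

/-- The jet `u` satisfies the equations of the system. -/
def HoldsAt (S : PDESystem) (u : Jet2) : Prop :=
  MvPolynomial.eval u S.nondeg ≠ 0 ∧ ∀ i, MvPolynomial.eval u (S.eq i) = 0

/-- The differential consequence `D_τ^a D_z^b (eq i)`, of order `ord i + a + b`,
indexed by `(i, a, b)`. -/
def prolonged (S : PDESystem) (q : Fin S.num × ℕ × ℕ) : DiffPoly :=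
  totalDτ^[q.2.1] (totalDz^[q.2.2] (S.eq q.1))

/-- The order of `S.prolonged q`. -/
def prolongedOrd (S : PDESystem) (q : Fin S.num × ℕ × ℕ) : ℕ := S.ord q.1 + q.2.1 + q.2.2

/-- The system prolonged to order `r`, as a locus in the space of `r`-jets: all equations and
differential consequences of order at most `r` hold. (Only the coordinates `u (i, j)` with
`i + j ≤ r` matter.) -/
def locus (S : PDESystem) (r : ℕ) : Set Jet2 :=
  {u | MvPolynomial.eval u S.nondeg ≠ 0 ∧
    ∀ q, S.prolongedOrd q ≤ r → MvPolynomial.eval u (S.prolonged q) = 0}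

/-- The symbol at order `r` over the jet `u`: the kernel of the principal parts of the equations
of order exactly `r`. The component `v n` belongs to the derivative `∂_τ^n ∂_z^(r-n)`. -/
def symbol (S : PDESystem) (r : ℕ) (u : Jet2) : Submodule ℂ (Fin (r + 1) → ℂ) where
  carrier := {v | ∀ q, S.prolongedOrd q = r →
    ∑ n : Fin (r + 1), MvPolynomial.eval u
      (MvPolynomial.pderiv ((n : ℕ), r - (n : ℕ)) (S.prolonged q)) * v n = 0}
  add_mem' := by
    intro v w hv hw q hq
    simp only [Pi.add_apply, mul_add, Finset.sum_add_distrib, hv q hq, hw q hq, add_zero]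
  zero_mem' := by
    intro q _
    simp
  smul_mem' := by
    intro c v hv q hq
    have h := hv q hq
    simp only [Pi.smul_apply, smul_eq_mul]
    calc _ = c * ∑ n : Fin (r + 1), MvPolynomial.eval u
          (MvPolynomial.pderiv ((n : ℕ), r - (n : ℕ)) (S.prolonged q)) * v n := by
          rw [Finset.mul_sum]
          exact Finset.sum_congr rfl fun n _ => by ring
      _ = 0 := by rw [h, mul_zero]

/-- Contraction of a homogeneous symbol element of degree `r + 1` with the tangent vector
`α ∂_τ + β ∂_z`. -/
def contract (r : ℕ) (α β : ℂ) : (Fin (r + 2) → ℂ) →ₗ[ℂ] (Fin (r + 1) → ℂ) where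
  toFun v n := α * v n.succ + β * v n.castSucc
  map_add' v w := by
    funext n
    simp only [Pi.add_apply]
    ring
  map_smul' c v := by
    funext n
    simp only [Pi.smul_apply, smul_eq_mul, RingHom.id_apply]
    ring

/-- Cartan's test for the symbol at order `r + 1` over `u`: for some vector `α ∂_τ + β ∂_z ≠ 0`
(the first vector of a quasi-regular basis), with `g` the symbol at order `r + 1` and `g'` that
at order `r + 2`, one has `dim g' = dim g + dim {v ∈ g | contraction of v vanishes}`. -/
def CartanTest (S : PDESystem) (r : ℕ) (u : Jet2) : Prop :=
  ∃ α β : ℂ, (α ≠ 0 ∨ β ≠ 0) ∧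
    Module.finrank ℂ (S.symbol (r + 2) u) =
      Module.finrank ℂ (S.symbol (r + 1) u) +
        Module.finrank ℂ
          (S.symbol (r + 1) u ⊓ LinearMap.ker (contract r α β) : Submodule ℂ (Fin (r + 2) → ℂ))

/-- The system is involutive as a system of order `r + 1`: its locus in the space of
`(r + 1)`-jets is nonempty and cut out regularly (the differentials of the equations are linearly
independent along it), its symbol has constant dimension and is involutive, and it is formally
integrable: at every order from `r + 1` on, each jet of the prolonged locus extends to a jet of
the locus of the next order. -/
structure IsInvolutive (S : PDESystem) (r : ℕ) : Prop where
  nonempty : (S.locus (r + 1)).Nonempty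
  regular : ∀ u ∈ S.locus (r + 1), LinearIndependent ℂ
    fun q : {q : Fin S.num × ℕ × ℕ // S.prolongedOrd q ≤ r + 1} =>
      fun p : ℕ × ℕ => MvPolynomial.eval u (MvPolynomial.pderiv p (S.prolonged q.1))
  symbol_dim : ∃ n : ℕ, ∀ u ∈ S.locus (r + 1), Module.finrank ℂ (S.symbol (r + 1) u) = n
  symbol_involutive : ∀ u ∈ S.locus (r + 1), S.CartanTest r u
  integrable : ∀ t, r + 1 ≤ t → ∀ u ∈ S.locus t, ∃ v ∈ S.locus (t + 1),
    ∀ i j, i + j ≤ t → v (i, j) = u (i, j)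

end PDESystem

/-! ### The Jacobi group -/

/-- The map `(τ, z) ↦ ((aτ+b)/(cτ+d), (z+lτ+m)/(cτ+d))`. -/
def jacobiMap (a b c d l m : ℂ) (x : ℂ × ℂ) : ℂ × ℂ :=
  ((a * x.1 + b) / (c * x.1 + d), (x.2 + l * x.1 + m) / (c * x.1 + d))

/-- Near `x`, the element of the group `G_{k,0}` given by `g ∈ SL(2,ℝ)` and `l, m ∈ ℝ`
(acting by `τ̃ = (aτ+b)/(cτ+d)`, `z̃ = (z+lτ+m)/(cτ+d)`, `f̃ = (cτ+d)^k f`) is defined and carries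
the holomorphic function `f` to the holomorphic function `F`. -/
structure IsJacobiTransform (k : ℕ) (g : SL(2, ℝ)) (l m : ℝ) (f F : ℂ × ℂ → ℂ) (x : ℂ × ℂ) :
    Prop where
  defined : (g 1 0 : ℂ) * x.1 + (g 1 1 : ℂ) ≠ 0
  analytic_left : AnalyticAt ℂ f x
  analytic_right : AnalyticAt ℂ F (jacobiMap (g 0 0) (g 0 1) (g 1 0) (g 1 1) l m x)
  transform : ∀ᶠ y in 𝓝 x, F (jacobiMap (g 0 0) (g 0 1) (g 1 0) (g 1 1) l m y) =
    ((g 1 0 : ℂ) * y.1 + (g 1 1 : ℂ)) ^ k * f y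

/-- The system is `G_{k,0}`-invariant: a transform `F` of `f` satisfies it at the image point
exactly if `f` satisfies it at the original point. -/
def PDESystem.IsJacobiInvariant (S : PDESystem) (k : ℕ) : Prop :=
  ∀ (g : SL(2, ℝ)) (l m : ℝ) (f F : ℂ × ℂ → ℂ) (x : ℂ × ℂ), IsJacobiTransform k g l m f F x →
    (S.HoldsAt (jetAt F (jacobiMap (g 0 0) (g 0 1) (g 1 0) (g 1 1) l m x)) ↔
      S.HoldsAt (jetAt f x))

/-- A weak (meromorphic) Jacobi form of weight `k` and index `m`: a meromorphic function on
`ℍ × ℂ` (locally a quotient of holomorphic functions; values at the poles are irrelevant) with the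
Jacobi transformation property and with a Fourier expansion `∑ c(n,r) q^n ζ^r`, where `n` is bounded
below, valid on some nonempty open set. -/
structure IsWeakJacobiForm (k m : ℤ) (f : ℂ × ℂ → ℂ) : Prop where
  meromorphic : ∀ x : ℂ × ℂ, 0 < x.1.im → ∃ g h : ℂ × ℂ → ℂ, AnalyticAt ℂ g x ∧ AnalyticAt ℂ h x ∧
    (¬ ∀ᶠ y in 𝓝 x, h y = 0) ∧ ∀ᶠ y in 𝓝 x, h y ≠ 0 → f y = g y / h y
  transform : ∀ (g : SL(2, ℤ)) (l μ : ℤ) (x : ℂ × ℂ), 0 < x.1.im → AnalyticAt ℂ f x →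
    AnalyticAt ℂ f (jacobiMap (g 0 0) (g 0 1) (g 1 0) (g 1 1) l μ x) →
    f (jacobiMap (g 0 0) (g 0 1) (g 1 0) (g 1 1) l μ x) =
      ((g 1 0 : ℂ) * x.1 + (g 1 1 : ℂ)) ^ k *
        Complex.exp (2 * Real.pi * Complex.I * m *
          ((g 1 0 : ℂ) * (x.2 + l * x.1 + μ) ^ 2 / ((g 1 0 : ℂ) * x.1 + (g 1 1 : ℂ))
            - (l : ℂ) ^ 2 * x.1 - 2 * l * x.2 - l * μ)) * f x
  fourier : ∃ (n₀ : ℤ) (c : ℤ × ℤ → ℂ) (U : Set (ℂ × ℂ)), (∀ n r, n < n₀ → c (n, r) = 0) ∧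
    IsOpen U ∧ U.Nonempty ∧ (∀ x ∈ U, 0 < x.1.im) ∧ ∀ x ∈ U,
      HasSum (fun p : ℤ × ℤ => c p * Complex.exp (2 * Real.pi * Complex.I * x.1) ^ p.1 *
        Complex.exp (2 * Real.pi * Complex.I * x.2) ^ p.2) (f x)

/-! ### Differential invariants of `G_{k,0}`

The fractional powers of `f` are taken through a `k`-th root `s` of `f`, that is `s ^ k = f`,
`f ^ (1 + j/k) = f * s ^ j`; every choice of the root is allowed. -/

/-- `k f f_zz - (k+1) f_z²`. -/
def scrD (k : ℕ) (u : Jet2) : ℂ := k * u (0, 0) * u (0, 2) - (k + 1) * u (0, 1) ^ 2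

/-- `ℐ_k`. -/
def scrI (k : ℕ) (s : ℂ) (u : Jet2) : ℂ :=
  (scrD k u * u (2, 0) - k * u (0, 0) * u (1, 1) ^ 2
    + (k + 1) * u (1, 0) * (2 * u (0, 1) * u (1, 1) - u (1, 0) * u (0, 2)))
    / (u (0, 0) * s ^ 4 * scrD k u)

/-- `𝒥_k`. -/
def scrJ (k : ℕ) (s : ℂ) (u : Jet2) : ℂ :=
  (scrD k u * u (1, 2) - (k * u (0, 0) * u (1, 1) - (k + 1) * u (1, 0) * u (0, 1)) * u (0, 3)
    + (k + 2) * u (0, 2) * (u (0, 1) * u (1, 1) - u (1, 0) * u (0, 2)))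
    / (u (0, 0) * s ^ 4 * scrD k u)

/-- `ℒ_k`. -/
def scrL (s : ℂ) (u : Jet2) : ℂ := u (0, 1) / (u (0, 0) * s)

/-- `ℳ_k`. -/
def scrM (s : ℂ) (u : Jet2) : ℂ := u (0, 2) / (u (0, 0) * s ^ 2)

/-- `𝒩_k`. -/
def scrN (s : ℂ) (u : Jet2) : ℂ := u (0, 3) / (u (0, 0) * s ^ 3)

/-- `Φ` (a function of a `k`-th root of `f` and of the jet of `f`) is a differential invariant of
the group `G_{k,0}`. -/
def IsJacobiDiffInvariant (k : ℕ) (Φ : ℂ → Jet2 → ℂ) : Prop :=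
  ∀ (g : SL(2, ℝ)) (l m : ℝ) (f F : ℂ × ℂ → ℂ) (x : ℂ × ℂ), IsJacobiTransform k g l m f F x →
    f x ≠ 0 → scrD k (jetAt f x) ≠ 0 → ∀ s : ℂ, s ^ k = f x →
      Φ (((g 1 0 : ℂ) * x.1 + (g 1 1 : ℂ)) * s)
        (jetAt F (jacobiMap (g 0 0) (g 0 1) (g 1 0) (g 1 1) l m x)) = Φ s (jetAt f x)

/-! ### The Weierstrass function and its system -/

/-- The lattice `ℤ + ℤτ`, with its basis `1, τ`. -/
def tauPair (τ : ℍ) : PeriodPair where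
  ω₁ := 1
  ω₂ := τ
  indep := by
    rw [LinearIndependent.pair_iff]
    intro s t h
    have him := congrArg Complex.im h
    have hre := congrArg Complex.re h
    simp only [Complex.add_im, Complex.smul_im, Complex.one_im, smul_eq_mul, mul_zero, zero_add,
      Complex.zero_im, UpperHalfPlane.coe_im] at him
    have ht : t = 0 := (mul_eq_zero.mp him).resolve_right τ.im_ne_zero
    subst ht
    simpa using hre

/-- The Weierstrass function `℘(τ, z)` of the lattice `ℤ + ℤτ`, for `Im τ > 0`
(and `0` for other `τ`). -/
def wpFun (x : ℂ × ℂ) : ℂ :=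
  if h : 0 < x.1.im then (tauPair ⟨x.1, h⟩).weierstrassP x.2 else 0

/-- `φ = 16 f_zz³ - 72 f² f_zz² - 216 f f_z² f_zz + 54 f_z⁴ + 864 f³ f_z²`. -/
def wpPhi (u : Jet2) : ℂ :=
  16 * u (0, 2) ^ 3 - 72 * u (0, 0) ^ 2 * u (0, 2) ^ 2 - 216 * u (0, 0) * u (0, 1) ^ 2 * u (0, 2)
    + 54 * u (0, 1) ^ 4 + 864 * u (0, 0) ^ 3 * u (0, 1) ^ 2

/-- `φ` as a differential polynomial. -/
def wpPhiPoly : DiffPoly :=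
  let X : ℕ × ℕ → DiffPoly := MvPolynomial.X
  16 * X (0, 2) ^ 3 - 72 * X (0, 0) ^ 2 * X (0, 2) ^ 2 - 216 * X (0, 0) * X (0, 1) ^ 2 * X (0, 2)
    + 54 * X (0, 1) ^ 4 + 864 * X (0, 0) ^ 3 * X (0, 1) ^ 2

/-- `2 f f_zz - 3 f_z²` as a differential polynomial. -/
def wpDPoly : DiffPoly :=
  let X : ℕ × ℕ → DiffPoly := MvPolynomial.X
  2 * X (0, 0) * X (0, 2) - 3 * X (0, 1) ^ 2

/-- The third-order system for the Weierstrass function, with denominators cleared, considered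
where `2 f f_zz - 3 f_z² ≠ 0`. -/
def wpSystem : PDESystem :=
  let X : ℕ × ℕ → DiffPoly := MvPolynomial.X
  let C : ℂ → DiffPoly := MvPolynomial.C
  { num := 3
    eq := ![
      C (3 * Real.pi ^ 2) * wpDPoly * X (2, 0) - (C (1 / 16) * wpPhiPoly
        + C (3 * Real.pi ^ 2) * (2 * X (0, 0) * X (1, 1) ^ 2
          - 6 * X (1, 0) * X (0, 1) * X (1, 1) + 3 * X (1, 0) ^ 2 * X (0, 2))),
      C (3 * Real.pi) * wpDPoly * X (1, 2) - (C (Complex.I / 4) * wpPhiPoly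
        + C Real.pi * (36 * X (0, 0) * X (0, 1) * (2 * X (0, 0) * X (1, 1)
            - 3 * X (1, 0) * X (0, 1))
          - 12 * X (0, 2) * (X (0, 1) * X (1, 1) - X (1, 0) * X (0, 2)))),
      X (0, 3) - 12 * X (0, 0) * X (0, 1)]
    ord := ![2, 3, 3]
    nondeg := wpDPoly }

/-- The system solved for `f_ττ`, `f_τzz` and `f_zzz`. -/
def WpSolvedForm (u : Jet2) : Prop :=
  u (2, 0) = (1 / 16 * wpPhi u + 3 * Real.pi ^ 2 * (2 * u (0, 0) * u (1, 1) ^ 2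
      - 6 * u (1, 0) * u (0, 1) * u (1, 1) + 3 * u (1, 0) ^ 2 * u (0, 2)))
      / (3 * Real.pi ^ 2 * (2 * u (0, 0) * u (0, 2) - 3 * u (0, 1) ^ 2)) ∧
  u (1, 2) = (Complex.I / 4 * wpPhi u + Real.pi * (36 * u (0, 0) * u (0, 1)
        * (2 * u (0, 0) * u (1, 1) - 3 * u (1, 0) * u (0, 1))
      - 12 * u (0, 2) * (u (0, 1) * u (1, 1) - u (1, 0) * u (0, 2))))
      / (3 * Real.pi * (2 * u (0, 0) * u (0, 2) - 3 * u (0, 1) ^ 2)) ∧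
  u (0, 3) = 12 * u (0, 0) * u (0, 1)

/-- The invariant form of the system, in terms of a square root `s` of `f`. -/
def WpInvariantForm (s : ℂ) (u : Jet2) : Prop :=
  scrN s u = 12 * scrL s u ∧
  scrJ 2 s u = 4 * Real.pi * Complex.I * scrI 2 s u ∧
  24 * Real.pi ^ 2 * (2 * scrM s u - 3 * scrL s u ^ 2) * scrI 2 s u =
    8 * scrM s u ^ 3 - 36 * scrM s u ^ 2 - 108 * scrL s u ^ 2 * scrM s u
      + 27 * scrL s u ^ 2 * (scrL s u ^ 2 + 16)

end

/-! Involutivity. The three equations have leading derivatives `f_ττ`, `f_τzz`, `f_zzz`, with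
leading coefficients that are nonzero constants or nonzero multiples of `D`. Differentiation keeps
the leading coefficient, so every derivative of order at least three is determined by those ranked
below it. The symbol is therefore zero from order three on (`wpSystem_symbol_eq_bot`), and only `f,
f_τ, f_z, f_τz, f_zz` remain free. Formal integrability amounts to the commutation of two
derivations on the ring of polynomials in these five variables and `1/D`. By Leibniz this is a pair
of polynomial identities (`WpRing.commutator_fzz`, `WpRing.commutator_ftz`). A point of that ring
then gives a jet satisfying all prolongations, with arbitrary free derivatives.

Invariance. Write `J = 1/(cτ+d)` and let `ρ` be the coefficient of the `z`-direction in the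
`τ`-derivative of the transformation. The jets of `f` and of its transform are related by
`IsJacobiTransform.jets`, a formula in `J`, `c`, `ρ`. The equations are combined so that `c` drops
out and `ρ` only adds a multiple of the third equation to the second. The five invariants are
quotients in which the powers of `J` also cancel.

The Weierstrass function. The dependence on `τ` is controlled through a Lambert series `Z =
jacobiZeta`, which has period `1` and satisfies `Z(z+τ) = Z(z) - 2πi`. It is jointly holomorphic off
the lattice. By Liouville's theorem on each torus, `Z_z = -(℘ + e)` with `e = wpConst` depending
only on `τ` (`partialz_jacobiZeta`); this makes `℘` jointly holomorphic. A second application of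
Liouville's theorem gives the heat equation `4πi Z_τ = -℘_z - 2Z(℘ + e)` (`jacobiZeta_heat`), the
logarithmic derivative of the heat equation of the theta function. Differentiating it in `z`
expresses `℘_τ` by `℘, ℘_z, Z, e, g₂`. Compatibility with `℘_zz = 6℘² - g₂/2` yields Ramanujan's
formulas for `e'` and `g₂'` (`deriv_wpConst`, `deriv_wpG₂`), and these give `℘_ττ`. The jet of `℘`
is then polynomial, up to powers of `4πi`, in `℘, ℘_z, Z, e, g₂, g₃`, and the system becomes a
polynomial identity modulo `℘_z² = 4℘³ - g₂℘ - g₃`.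

The same Lambert series gives the remaining Jacobi form properties: its regular part at `z = 0`
describes the poles, and its expansion for `0 < Im z < Im τ` is the Fourier series. The
transformation law is the homogeneity of `℘` under scaling of the lattice. -/

open scoped Topology MatrixGroups UpperHalfPlane

noncomputable section

/-! ### Leading derivatives -/

open MvPolynomial in
/-- A derivation sends polynomials supported on `s` to polynomials supported on `t` if it does so
for the variables. -/
theorem MvPolynomial.derivation_mem_supported {σ R : Type*} [CommRing R] {s t : Set σ}
    (hst : s ⊆ t) (d : Derivation R (MvPolynomial σ R) (MvPolynomial σ R))
    (hd : ∀ i ∈ s, d (X i) ∈ supported R t) {P : MvPolynomial σ R} (hP : P ∈ supported R s) :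
    d P ∈ supported R t := by
  have hle := supported_mono (R := R) hst
  rw [supported_eq_adjoin_X] at hP
  induction hP using Algebra.adjoin_induction with
  | mem x hx =>
    obtain ⟨i, hi, rfl⟩ := hx
    exact hd i hi
  | algebraMap r => simp
  | add x y _ _ hx hy => rw [map_add]; exact add_mem hx hy
  | mul x y hx' hy' hx hy =>
    rw [Derivation.leibniz, smul_eq_mul, smul_eq_mul]
    exact add_mem (mul_mem (hle hx') hy) (mul_mem (hle hy') hx)

/-- The derivatives ranked below `∂_τ^i ∂_z^j`, `p = (i, j)`: those of lower order, and those of the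
same order with fewer `τ`-derivatives. -/
def lowerJets (p : ℕ × ℕ) : Set (ℕ × ℕ) :=
  {q | q.1 + q.2 < p.1 + p.2 ∨ q.1 + q.2 = p.1 + p.2 ∧ q.1 < p.1}

theorem not_mem_lowerJets_self (p : ℕ × ℕ) : p ∉ lowerJets p := by
  simp [lowerJets]

/-- `P` is linear in the derivative of index `p`, with coefficient `L`, and all other derivatives
occurring in it are ranked below `p`. -/
def HasLead (P L : DiffPoly) (p : ℕ × ℕ) : Prop :=
  L ∈ MvPolynomial.supported ℂ (lowerJets p) ∧
    P - L * MvPolynomial.X p ∈ MvPolynomial.supported ℂ (lowerJets p)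

namespace HasLead

variable {P L : DiffPoly} {p : ℕ × ℕ}

/-- A total derivative shifts all jet coordinates by the same step and so respects the ranking. In
the Leibniz expansion of `d (L * X p + rest)` only `L * d (X p)` reaches `p + s`. The leading
coefficient stays `L`, so one nonvanishing condition serves prolongations of every order. -/
theorem of_derivation (h : HasLead P L p) (d : Derivation ℂ DiffPoly DiffPoly) (s : ℕ × ℕ)
    (hs : s.1 + s.2 = 1)
    (hd : ∀ q, d (MvPolynomial.X q) = MvPolynomial.X (q + s)) : HasLead (d P) L (p + s) := by
  have hsub : lowerJets p ⊆ lowerJets (p + s) := by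
    intro q hq
    simp only [lowerJets, Set.mem_ofPred_eq, Prod.fst_add, Prod.snd_add] at hq ⊢
    omega
  have hd' : ∀ q ∈ lowerJets p,
      d (MvPolynomial.X q) ∈ MvPolynomial.supported ℂ (lowerJets (p + s)) := by
    intro q hq
    rw [hd, MvPolynomial.X_mem_supported]
    simp only [lowerJets, Set.mem_ofPred_eq, Prod.fst_add, Prod.snd_add] at hq ⊢
    omega
  refine ⟨MvPolynomial.supported_mono hsub h.1, ?_⟩
  have hX : MvPolynomial.X p ∈ MvPolynomial.supported ℂ (lowerJets (p + s)) := by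
    rw [MvPolynomial.X_mem_supported]
    simp only [lowerJets, Set.mem_ofPred_eq, Prod.fst_add, Prod.snd_add]
    omega
  have key := add_mem (MvPolynomial.derivation_mem_supported hsub d hd' h.2)
    (mul_mem hX (MvPolynomial.derivation_mem_supported hsub d hd' h.1))
  convert key using 1
  rw [map_sub, Derivation.leibniz, hd, smul_eq_mul, smul_eq_mul]
  ring

theorem dτ (h : HasLead P L p) : HasLead (totalDτ P) L (p + (1, 0)) :=
  h.of_derivation _ _ rfl fun q => by simp [totalDτ, MvPolynomial.mkDerivation_X, Prod.ext_iff]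

theorem dz (h : HasLead P L p) : HasLead (totalDz P) L (p + (0, 1)) :=
  h.of_derivation _ _ rfl fun q => by simp [totalDz, MvPolynomial.mkDerivation_X, Prod.ext_iff]

theorem dτ_iterate (h : HasLead P L p) (a : ℕ) : HasLead (totalDτ^[a] P) L (p + (a, 0)) := by
  induction a with
  | zero => exact h
  | succ a ih =>
    rw [Function.iterate_succ_apply']
    have := ih.dτ
    rwa [add_assoc] at this

theorem dz_iterate (h : HasLead P L p) (b : ℕ) : HasLead (totalDz^[b] P) L (p + (0, b)) := by
  induction b with
  | zero => exact h
  | succ b ih =>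
    rw [Function.iterate_succ_apply']
    have := ih.dz
    rwa [add_assoc] at this

theorem prolonged {S : PDESystem} {i : Fin S.num} (h : HasLead (S.eq i) L p) (a b : ℕ) :
    HasLead (S.prolonged (i, a, b)) L (p.1 + a, p.2 + b) := by
  have := (h.dz_iterate b).dτ_iterate a
  rwa [show p + (0, b) + (a, 0) = (p.1 + a, p.2 + b) by ext <;> simp] at this

theorem pderiv_self (h : HasLead P L p) : MvPolynomial.pderiv p P = L := by
  have h0 : ∀ Q ∈ MvPolynomial.supported ℂ (lowerJets p), MvPolynomial.pderiv p Q = 0 :=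
    fun Q hQ => MvPolynomial.pderiv_eq_zero_of_notMem_vars fun hp =>
      not_mem_lowerJets_self p (MvPolynomial.mem_supported.1 hQ hp)
  have h1 := h0 _ h.2
  rw [map_sub, Derivation.leibniz, h0 _ h.1, MvPolynomial.pderiv_X_self, sub_eq_zero] at h1
  simpa using h1

theorem pderiv_eq_zero (h : HasLead P L p) {q : ℕ × ℕ} (hq : q ∉ lowerJets p) (hqp : q ≠ p) :
    MvPolynomial.pderiv q P = 0 := by
  have h0 : ∀ Q ∈ MvPolynomial.supported ℂ (lowerJets p), MvPolynomial.pderiv q Q = 0 :=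
    fun Q hQ => MvPolynomial.pderiv_eq_zero_of_notMem_vars fun hp =>
      hq (MvPolynomial.mem_supported.1 hQ hp)
  have h1 := h0 _ h.2
  rw [map_sub, Derivation.leibniz, h0 _ h.1, MvPolynomial.pderiv_X_of_ne hqp.symm, sub_eq_zero] at h1
  simpa using h1

theorem eval_congr_of_mem_supported {s : Set (ℕ × ℕ)} (hP : P ∈ MvPolynomial.supported ℂ s)
    {u v : Jet2} (h : ∀ q ∈ s, u q = v q) : MvPolynomial.eval u P = MvPolynomial.eval v P :=
  MvPolynomial.eval₂Hom_congr' rfl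
    (fun q hq _ => h q (MvPolynomial.mem_supported.1 hP hq)) rfl

/-- An equation with leading derivative `p` determines it from the derivatives ranked below. -/
theorem apply_eq (h : HasLead P L p) {u v : Jet2} (huv : ∀ q ∈ lowerJets p, u q = v q)
    (hL : MvPolynomial.eval u L ≠ 0) (hu : MvPolynomial.eval u P = 0)
    (hv : MvPolynomial.eval v P = 0) : u p = v p := by
  have h1 := eval_congr_of_mem_supported h.2 huv
  have h2 := eval_congr_of_mem_supported h.1 huv
  simp only [map_sub, map_mul, MvPolynomial.eval_X, hu, hv, ← h2, zero_sub, neg_inj] at h1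
  exact mul_left_cancel₀ hL h1

end HasLead

/-! ### Leading derivatives, symbol and regularity of the Weierstrass system -/

/-- The leading derivatives of the three equations of `wpSystem`. -/
def wpLead : Fin 3 → ℕ × ℕ := ![(2, 0), (1, 2), (0, 3)]

/-- The leading coefficients of the three equations of `wpSystem`. -/
def wpLeadCoeff : Fin 3 → DiffPoly :=
  let C : ℂ → DiffPoly := MvPolynomial.C
  ![C (3 * Real.pi ^ 2) * wpDPoly, C (3 * Real.pi) * wpDPoly, 1]

/-- The right-hand sides of the three equations of `wpSystem`. -/
def wpRest : Fin 3 → DiffPoly :=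
  let X : ℕ × ℕ → DiffPoly := MvPolynomial.X
  let C : ℂ → DiffPoly := MvPolynomial.C
  ![C (1 / 16) * wpPhiPoly + C (3 * Real.pi ^ 2) * (2 * X (0, 0) * X (1, 1) ^ 2
      - 6 * X (1, 0) * X (0, 1) * X (1, 1) + 3 * X (1, 0) ^ 2 * X (0, 2)),
    C (Complex.I / 4) * wpPhiPoly + C Real.pi * (36 * X (0, 0) * X (0, 1) * (2 * X (0, 0) * X (1, 1)
            - 3 * X (1, 0) * X (0, 1))
          - 12 * X (0, 2) * (X (0, 1) * X (1, 1) - X (1, 0) * X (0, 2))),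
    12 * X (0, 0) * X (0, 1)]

theorem wpSystem_eq (i : Fin 3) :
    wpSystem.eq i = wpLeadCoeff i * MvPolynomial.X (wpLead i) - wpRest i := by
  fin_cases i
  · rfl
  · rfl
  · simp [wpSystem, wpLeadCoeff, wpLead, wpRest]

/-- The only delicate occurrences are `f_τz` and `f_zz` in the first equation: they have the order
of `f_ττ` and rank below it because they contain fewer `τ`-derivatives. -/
theorem wpSystem_hasLead (i : Fin 3) : HasLead (wpSystem.eq i) (wpLeadCoeff i) (wpLead i) := by
  have hC : ∀ (c : ℂ) (s : Set (ℕ × ℕ)), (MvPolynomial.C c : DiffPoly) ∈ MvPolynomial.supported ℂ s :=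
    fun c s => (MvPolynomial.supported ℂ s).algebraMap_mem c
  have hn : ∀ (n : ℕ) [n.AtLeastTwo] (s : Set (ℕ × ℕ)),
      (OfNat.ofNat n : DiffPoly) ∈ MvPolynomial.supported ℂ s := fun n _ s =>
    hC (OfNat.ofNat n) s
  have hX : ∀ (q : ℕ × ℕ) (s : Set (ℕ × ℕ)), q ∈ s →
      (MvPolynomial.X q : DiffPoly) ∈ MvPolynomial.supported ℂ s :=
    fun q s h => MvPolynomial.X_mem_supported.2 h
  rw [HasLead, wpSystem_eq, sub_sub_cancel_left, neg_mem_iff]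
  fin_cases i <;> simp only [wpLeadCoeff, wpLead, wpRest, wpDPoly, wpPhiPoly, Fin.zero_eta,
    Fin.mk_one, Fin.reduceFinMk, Matrix.cons_val] <;> refine ⟨?_, ?_⟩ <;>
    repeat'
      first
      | with_reducible exact one_mem _
      | with_reducible exact hC _ _
      | with_reducible exact hn _ _
      | with_reducible refine hX _ _ ?_
      | with_reducible refine add_mem ?_ ?_
      | with_reducible refine sub_mem ?_ ?_
      | with_reducible refine mul_mem ?_ ?_
      | with_reducible refine pow_mem ?_ _
  all_goals simp [lowerJets]

theorem wpLeadCoeff_ne_zero {u : Jet2} (hu : MvPolynomial.eval u wpDPoly ≠ 0) (i : Fin 3) :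
    MvPolynomial.eval u (wpLeadCoeff i) ≠ 0 := by
  fin_cases i <;> simp [wpLeadCoeff, hu, Real.pi_ne_zero]

/-- The leading derivative of a prolonged equation. -/
def wpProlongedLead (q : Fin 3 × ℕ × ℕ) : ℕ × ℕ := ((wpLead q.1).1 + q.2.1, (wpLead q.1).2 + q.2.2)

theorem wpSystem_prolonged_hasLead (q : Fin 3 × ℕ × ℕ) :
    HasLead (wpSystem.prolonged q) (wpLeadCoeff q.1) (wpProlongedLead q) :=
  (wpSystem_hasLead q.1).prolonged q.2.1 q.2.2

theorem wpProlongedLead_order (q : Fin 3 × ℕ × ℕ) :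
    (wpProlongedLead q).1 + (wpProlongedLead q).2 = wpSystem.prolongedOrd q := by
  obtain ⟨i, a, b⟩ := q
  fin_cases i <;> simp [wpProlongedLead, wpLead, PDESystem.prolongedOrd, wpSystem] <;> omega

/-- From order three on, every derivative is a leading derivative. -/
theorem exists_wpProlongedLead {p : ℕ × ℕ} (hp : 3 ≤ p.1 + p.2 ∨ p = (2, 0)) :
    ∃ q, wpProlongedLead q = p := by
  obtain ⟨i, j⟩ := p
  rcases i with _ | _ | i
  · refine ⟨(2, 0, j - 3), ?_⟩
    simp [wpProlongedLead, wpLead] at hp ⊢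
    omega
  · refine ⟨(1, 0, j - 2), ?_⟩
    simp [wpProlongedLead, wpLead] at hp ⊢
    omega
  · refine ⟨(0, i, j), ?_⟩
    simp [wpProlongedLead, wpLead]
    omega

/-- For each `n` some equation of order `r` leads with `∂_τ^n ∂_z^(r-n)` and contains no derivative
of order `r` with more `τ`'s. These equations form a triangular linear system with nonzero pivots,
so the system is of finite type and Cartan's test reads `0 = 0 + 0`. -/
theorem wpSystem_symbol_eq_bot {r : ℕ} (hr : 3 ≤ r) {u : Jet2}
    (hu : MvPolynomial.eval u wpDPoly ≠ 0) : wpSystem.symbol r u = ⊥ := by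
  rw [eq_bot_iff]
  intro v hv
  have key : ∀ (n : ℕ) (hn : n < r + 1), v ⟨n, hn⟩ = 0 := by
    intro n
    induction n using Nat.strong_induction_on with
    | _ n ih =>
      intro hn
      obtain ⟨q, hq⟩ := exists_wpProlongedLead (p := (n, r - n)) (Or.inl (by simp; omega))
      have hl := wpSystem_prolonged_hasLead q
      rw [hq] at hl
      have ho := wpProlongedLead_order q
      rw [hq] at ho
      have h := hv q (by rw [← ho]; simp; omega)
      rw [Finset.sum_eq_single ⟨n, hn⟩] at h
      · rw [hl.pderiv_self] at h
        exact (mul_eq_zero.1 h).resolve_left (wpLeadCoeff_ne_zero hu q.1)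
      · rintro ⟨m, hm⟩ - hmn
        have hmn' : m ≠ n := fun h => hmn (Fin.ext h)
        rcases lt_or_gt_of_ne hmn' with h' | h'
        · rw [ih m h' hm, mul_zero]
        · rw [hl.pderiv_eq_zero, map_zero, zero_mul]
          · simp only [lowerJets, Set.mem_ofPred_eq]; omega
          · simp [hmn']
      · simp
  rw [Submodule.mem_bot]
  funext n
  exact key n n.2

/-- The bound three is sharp. At order four `∂_τ ∂_z³` and `∂_τ² ∂_z²` each lead two different
prolongations, and the agreement of these is the integrability condition. -/
theorem wpProlongedLead_injOn :
    Set.InjOn wpProlongedLead {q | wpSystem.prolongedOrd q ≤ 3} := by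
  rintro ⟨i, a, b⟩ h ⟨i', a', b'⟩ h' heq
  simp only [Set.mem_ofPred_eq, ← wpProlongedLead_order] at h h'
  fin_cases i <;> fin_cases i' <;> simp [wpProlongedLead, wpLead] at heq h h' ⊢ <;> omega

theorem wpSystem_regular {u : Jet2} (hu : MvPolynomial.eval u wpDPoly ≠ 0) :
    LinearIndependent ℂ
    fun q : {q : Fin wpSystem.num × ℕ × ℕ // wpSystem.prolongedOrd q ≤ 2 + 1} =>
      fun p : ℕ × ℕ => MvPolynomial.eval u (MvPolynomial.pderiv p (wpSystem.prolonged q.1)) := by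
  rw [linearIndependent_iff']
  intro s g hg
  by_contra! hne
  obtain ⟨q₀, hq₀⟩ := hne
  -- For orders at most three the number of `τ`'s is below `4`, so this integer reproduces the
  -- ranking. In a linear relation, the equation of highest rank with nonzero coefficient is the
  -- only one involving its leading derivative.
  let rank : ℕ × ℕ → ℕ := fun p => 4 * (p.1 + p.2) + p.1
  obtain ⟨q, hq, hmax⟩ := (s.filter fun q => g q ≠ 0).exists_max_image
    (fun q => rank (wpProlongedLead q.1)) ⟨q₀, by simpa using hq₀⟩
  rw [Finset.mem_filter] at hq
  have h := congrFun hg (wpProlongedLead q.1)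
  rw [Finset.sum_apply, Finset.sum_eq_single q] at h
  · simp only [Pi.smul_apply, smul_eq_mul, Pi.zero_apply] at h
    rw [(wpSystem_prolonged_hasLead q.1).pderiv_self] at h
    exact (mul_ne_zero hq.2 (wpLeadCoeff_ne_zero hu q.1.1)) h
  · intro q' hq' hne
    by_cases hg' : g q' = 0
    · simp [hg']
    have hr := hmax q' (by simp [hq', hg'])
    have hne' : wpProlongedLead q.1 ≠ wpProlongedLead q'.1 := fun h =>
      hne (Subtype.ext (wpProlongedLead_injOn q'.2 q.2 h.symm))
    have h3 := (wpProlongedLead_order q.1).trans_le q.2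
    have h3' := (wpProlongedLead_order q'.1).trans_le q'.2
    rw [Pi.smul_apply, (wpSystem_prolonged_hasLead q'.1).pderiv_eq_zero _ hne', map_zero, smul_zero]
    simp only [lowerJets, Set.mem_ofPred_eq]
    simp only [rank] at hr
    omega
  · exact fun h' => absurd hq.1 h'

/-- Two jets in the loci of `wpSystem` that agree in the five derivatives which are not leading
derivatives agree. -/
theorem wpSystem_locus_unique {t : ℕ} {u v : Jet2} (hu : u ∈ wpSystem.locus t)
    (hv : v ∈ wpSystem.locus t)
    (h : ∀ p ∈ ({(0, 0), (1, 0), (0, 1), (1, 1), (0, 2)} : Set (ℕ × ℕ)), u p = v p) :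
    ∀ p : ℕ × ℕ, p.1 + p.2 ≤ t → u p = v p := by
  have key : ∀ n, n ≤ t → ∀ p : ℕ × ℕ, p.1 + p.2 = n → u p = v p := by
    intro n
    induction n using Nat.strong_induction_on with
    | _ n ihn =>
      intro hn
      -- Induction along the ranking: the outer induction runs over the order, the inner one over
      -- the number of `τ`-derivatives.
      suffices ∀ i p, p.1 = i → p.1 + p.2 = n → u p = v p from fun p hp => this p.1 p rfl hp
      intro i
      induction i using Nat.strong_induction_on with
      | _ i ihi =>
        intro p hpi hpn
        by_cases hp : 3 ≤ p.1 + p.2 ∨ p = (2, 0)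
        · obtain ⟨q, rfl⟩ := exists_wpProlongedLead hp
          have hq : wpSystem.prolongedOrd q ≤ t := by rw [← wpProlongedLead_order, hpn]; exact hn
          refine (wpSystem_prolonged_hasLead q).apply_eq ?_ (wpLeadCoeff_ne_zero hu.1 q.1)
            (hu.2 q hq) (hv.2 q hq)
          rintro p' (hp' | ⟨hp', hp''⟩)
          · exact ihn _ (hpn ▸ hp') (by omega) p' rfl
          · exact ihi _ (hpi ▸ hp'') p' rfl (by omega)
        · apply h
          obtain ⟨i, j⟩ := p
          simp only [not_or, not_le, Prod.mk.injEq] at hp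
          simp only [Set.mem_insert_iff, Set.mem_singleton_iff, Prod.mk.injEq]
          simp only at hpi hpn
          omega
  exact fun p hp => key _ hp p rfl

/-! ### Formal integrability -/

/-- For commuting derivations `d₁`, `d₂` and an element `y`, the substitution
`∂_τ^i ∂_z^j f ↦ d₁^i d₂^j y` intertwines the total derivatives with `d₁`, `d₂`. -/
def jetHom {B : Type*} [CommRing B] [Algebra ℂ B] (d₁ d₂ : Derivation ℂ B B) (y : B) :
    DiffPoly →ₐ[ℂ] B :=
  MvPolynomial.aeval fun p : ℕ × ℕ => d₁^[p.1] (d₂^[p.2] y)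

theorem eval_map_jet {B : Type*} [CommRing B] [Algebra ℂ B] (ev : B →ₐ[ℂ] ℂ) (w : ℕ × ℕ → B)
    (P : DiffPoly) :
    MvPolynomial.eval (fun p => ev (w p)) P = ev (MvPolynomial.aeval w P) := by
  induction P using MvPolynomial.induction_on with
  | C a => simp
  | add p q hp hq => simp only [map_add, hp, hq]
  | mul_X p n hp => simp only [map_mul, hp, MvPolynomial.eval_X, MvPolynomial.aeval_X]

section JetHom

variable {B : Type*} [CommRing B] [Algebra ℂ B] (d₁ d₂ : Derivation ℂ B B) (y : B)

theorem jetHom_X (p : ℕ × ℕ) : jetHom d₁ d₂ y (MvPolynomial.X p) = d₁^[p.1] (d₂^[p.2] y) :=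
  MvPolynomial.aeval_X _ _

theorem jetHom_derivation (d : Derivation ℂ DiffPoly DiffPoly) (δ : Derivation ℂ B B)
    (h : ∀ p, jetHom d₁ d₂ y (d (MvPolynomial.X p)) = δ (jetHom d₁ d₂ y (MvPolynomial.X p)))
    (P : DiffPoly) : jetHom d₁ d₂ y (d P) = δ (jetHom d₁ d₂ y P) := by
  induction P using MvPolynomial.induction_on with
  | C a =>
    rw [MvPolynomial.derivation_C, map_zero, ← MvPolynomial.algebraMap_eq, AlgHom.commutes,
      Derivation.map_algebraMap]
  | add p q hp hq => simp only [map_add, hp, hq]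
  | mul_X p n hp =>
    simp only [Derivation.leibniz, map_add, map_mul, smul_eq_mul, hp, h]

theorem jetHom_totalDτ (P : DiffPoly) :
    jetHom d₁ d₂ y (totalDτ P) = d₁ (jetHom d₁ d₂ y P) := by
  refine jetHom_derivation d₁ d₂ y _ _ (fun p => ?_) P
  rw [totalDτ, MvPolynomial.mkDerivation_X, jetHom_X, jetHom_X, Function.iterate_succ_apply']

/-- Commutation enters because `∂_τ^i ∂_z^j f` is sent to `d₁^i d₂^j y`: a further `d₂` has to be
moved past `d₁^i`. -/
theorem jetHom_totalDz (hc : ∀ b, d₁ (d₂ b) = d₂ (d₁ b)) (P : DiffPoly) :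
    jetHom d₁ d₂ y (totalDz P) = d₂ (jetHom d₁ d₂ y P) := by
  refine jetHom_derivation d₁ d₂ y _ _ (fun p => ?_) P
  rw [totalDz, MvPolynomial.mkDerivation_X, jetHom_X, jetHom_X, Function.iterate_succ_apply']
  exact Function.Commute.iterate_left (f := d₁) (g := d₂) hc p.1 _

theorem jetHom_prolonged (hc : ∀ b, d₁ (d₂ b) = d₂ (d₁ b)) (S : PDESystem)
    (hS : ∀ i, jetHom d₁ d₂ y (S.eq i) = 0) (q : Fin S.num × ℕ × ℕ) :
    jetHom d₁ d₂ y (S.prolonged q) = 0 := by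
  have iter : ∀ (D : DiffPoly → DiffPoly) (δ : Derivation ℂ B B),
      (∀ P, jetHom d₁ d₂ y (D P) = δ (jetHom d₁ d₂ y P)) → ∀ (n : ℕ) (P : DiffPoly),
      jetHom d₁ d₂ y P = 0 → jetHom d₁ d₂ y (D^[n] P) = 0 := by
    intro D δ h n P hP
    induction n with
    | zero => exact hP
    | succ n ih => rw [Function.iterate_succ_apply', h, ih, map_zero]
  exact iter _ _ (jetHom_totalDτ d₁ d₂ y) _ _ (iter _ _ (jetHom_totalDz d₁ d₂ y hc) _ _ (hS q.1))

/-- A point of `B` gives a jet in all loci of the system. -/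
theorem mem_locus_of_jetHom (hc : ∀ b, d₁ (d₂ b) = d₂ (d₁ b)) (S : PDESystem)
    (hS : ∀ i, jetHom d₁ d₂ y (S.eq i) = 0) (ev : B →ₐ[ℂ] ℂ)
    (hev : ev (jetHom d₁ d₂ y S.nondeg) ≠ 0) (r : ℕ) :
    (fun p : ℕ × ℕ => ev (d₁^[p.1] (d₂^[p.2] y))) ∈ S.locus r := by
  have h := eval_map_jet ev fun p : ℕ × ℕ => d₁^[p.1] (d₂^[p.2] y)
  refine ⟨by rw [h]; exact hev, fun q _ => ?_⟩
  rw [h]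
  exact (congrArg ev (jetHom_prolonged d₁ d₂ y hc S hS q)).trans (map_zero ev)

end JetHom

/-! ### The ring of free derivatives and its two commuting derivations -/

/-- Polynomials in the five free derivatives `f, f_τ, f_z, f_τz, f_zz` of `wpSystem` and in
`e = 1 / (2 f f_zz - 3 f_z²)`. -/
abbrev WpRing : Type := MvPolynomial (Fin 6) ℂ

namespace WpRing

open MvPolynomial

/-- The polynomial `2 f f_zz - 3 f_z²`. -/
def den : WpRing := 2 * X 0 * X 4 - 3 * X 2 ^ 2

/-- The polynomial `φ`. -/
def phi : WpRing :=
  16 * X 4 ^ 3 - 72 * X 0 ^ 2 * X 4 ^ 2 - 216 * X 0 * X 2 ^ 2 * X 4 + 54 * X 2 ^ 4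
    + 864 * X 0 ^ 3 * X 2 ^ 2

/-- The value of `f_ττ`; the system has `b = i / (12 π)`. -/
def fττ (b : ℂ) : WpRing :=
  X 5 * (-3 * C b ^ 2 * phi + (2 * X 0 * X 3 ^ 2 - 6 * X 1 * X 2 * X 3 + 3 * X 1 ^ 2 * X 4))

/-- The value of `f_τzz`. -/
def fτzz (b : ℂ) : WpRing :=
  X 5 * (C b * phi + 12 * X 0 * X 2 * (2 * X 0 * X 3 - 3 * X 1 * X 2)
    - 4 * X 4 * (X 2 * X 3 - X 1 * X 4))

/-- The derivation by `z`. -/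
def dz (b : ℂ) : Derivation ℂ WpRing WpRing :=
  mkDerivation ℂ ![X 2, X 3, X 4, fτzz b, 12 * X 0 * X 2,
    -X 5 ^ 2 * (24 * X 0 ^ 2 * X 2 - 4 * X 2 * X 4)]

/-- The derivation by `τ`. -/
def dτ (b : ℂ) : Derivation ℂ WpRing WpRing :=
  mkDerivation ℂ ![X 1, fττ b, X 3, dz b (fττ b), fτzz b,
    -X 5 ^ 2 * (2 * X 1 * X 4 + 2 * X 0 * fτzz b - 6 * X 2 * X 3)]

theorem derivation_ofNat (d : Derivation ℂ WpRing WpRing) (n : ℕ) [n.AtLeastTwo] :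
    d ofNat(n) = 0 :=
  d.map_natCast n

theorem dz_X (b : ℂ) (i : Fin 6) : dz b (X i) = ![X 2, X 3, X 4, fτzz b, 12 * X 0 * X 2,
    -X 5 ^ 2 * (24 * X 0 ^ 2 * X 2 - 4 * X 2 * X 4)] i :=
  mkDerivation_X _ _ _

theorem dτ_X (b : ℂ) (i : Fin 6) : dτ b (X i) = ![X 1, fττ b, X 3, dz b (fττ b), fτzz b,
    -X 5 ^ 2 * (2 * X 1 * X 4 + 2 * X 0 * fτzz b - 6 * X 2 * X 3)] i :=
  mkDerivation_X _ _ _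

/-- The ideal generated by `e (2 f f_zz - 3 f_z²) - 1`. -/
def relIdeal : Ideal WpRing := Ideal.span {X 5 * den - 1}

theorem rel_mem : X 5 * den - 1 ∈ relIdeal := Ideal.subset_span rfl

theorem dz_rel (b : ℂ) : dz b (X 5 * den - 1) ∈ relIdeal := by
  refine Ideal.mem_span_singleton'.2 ⟨-X 5 * (24 * X 0 ^ 2 * X 2 - 4 * X 2 * X 4), ?_⟩
  simp only [den, map_sub, Derivation.leibniz, Derivation.leibniz_pow, smul_eq_mul,
    derivation_ofNat, dz_X, Matrix.cons_val, Derivation.map_one_eq_zero, nsmul_eq_mul]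
  push_cast
  ring

theorem dτ_rel (b : ℂ) : dτ b (X 5 * den - 1) ∈ relIdeal := by
  refine Ideal.mem_span_singleton'.2
    ⟨-X 5 * (2 * X 1 * X 4 + 2 * X 0 * fτzz b - 6 * X 2 * X 3), ?_⟩
  simp only [den, map_sub, Derivation.leibniz, Derivation.leibniz_pow, smul_eq_mul,
    derivation_ofNat, dτ_X, Matrix.cons_val, Derivation.map_one_eq_zero, nsmul_eq_mul]
  push_cast
  ring

theorem derivation_mem_relIdeal {d : Derivation ℂ WpRing WpRing}
    (hd : d (X 5 * den - 1) ∈ relIdeal) {P : WpRing} (hP : P ∈ relIdeal) : d P ∈ relIdeal := by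
  obtain ⟨a, rfl⟩ := Ideal.mem_span_singleton'.1 hP
  rw [Derivation.leibniz, smul_eq_mul, smul_eq_mul]
  exact add_mem (Ideal.mul_mem_left _ _ hd) (Ideal.mul_mem_right _ _ rel_mem)

/-- The integrability condition at `∂_τ ∂_z³ f`: the `τ`-derivative of the third equation against
the `z`-derivative of the second. The witness is the quotient of the commutator by `e D - 1`. -/
theorem commutator_fzz (b : ℂ) : dτ b (dz b (X 4)) - dz b (dτ b (X 4)) ∈ relIdeal := by
  refine Ideal.mem_span_singleton'.2 ⟨-12 * X 1 * X 2 - 12 * X 0 * X 3, ?_⟩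
  simp only [dz_X, dτ_X, Matrix.cons_val, fτzz, phi, den, map_sub, map_add, Derivation.leibniz,
    Derivation.leibniz_pow, smul_eq_mul, derivation_ofNat, derivation_C, nsmul_eq_mul]
  push_cast
  ring

/-- The integrability condition at `∂_τ² ∂_z² f`: the `τ`-derivative of the second equation against
the second `z`-derivative of the first. With the coefficients `-3 b²` and `b` of `φ` it holds for
every `b`, so neither `π` nor `i` has to be simplified here. -/
theorem commutator_ftz (b : ℂ) : dτ b (dz b (X 3)) - dz b (dτ b (X 3)) ∈ relIdeal := by
  obtain ⟨f, hf⟩ : ∃ f : WpRing, f = X 0 := ⟨_, rfl⟩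
  obtain ⟨ft, hft⟩ : ∃ f : WpRing, f = X 1 := ⟨_, rfl⟩
  obtain ⟨fz, hfz⟩ : ∃ f : WpRing, f = X 2 := ⟨_, rfl⟩
  obtain ⟨ftz, hftz⟩ : ∃ f : WpRing, f = X 3 := ⟨_, rfl⟩
  obtain ⟨fzz, hfzz⟩ : ∃ f : WpRing, f = X 4 := ⟨_, rfl⟩
  obtain ⟨e, he⟩ : ∃ f : WpRing, f = X 5 := ⟨_, rfl⟩
  -- The cofactor is the quotient of the commutator by the relation `e D - 1`.
  refine Ideal.mem_span_singleton'.2 ⟨- 768*fzz^5*e^2*C b^2 - 216*fz^3*ftz*e*C b - 2592*fz^4*fzz^2*e^2*C b^2 -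
      384*ft*fzz^4*e^2*C b + 216*ft*fz^2*fzz*e*C b - 1296*ft*fz^4*fzz*e^2*C b -
      48*ft^2*fzz^3*e^2 + 72*ft^2*fz^2*e + 432*f*fz*ftz*fzz*e*C b + 12096*f*fz^2*fzz^3*e^2*C
      b^2 + 5832*f*fz^6*e^2*C b^2 + 144*f*ft*fzz^2*e*C b + 96*f*ft*fz*ftz*e +
      5184*f*ft*fz^2*fzz^2*e^2*C b + 36*f*ft^2*fzz*e + 864*f*ft^2*fz^2*fzz*e^2 +
      6912*f^2*fzz^4*e^2*C b^2 - 24*f^2*ftz^2*e - 11664*f^2*fz^4*fzz*e^2*C b^2 +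
      1728*f^2*ft*fzz^3*e^2*C b - 2592*f^2*ft*fz^2*e*C b - 1728*f^3*fz*ftz*e*C b -
      95904*f^3*fz^2*fzz^2*e^2*C b^2 - 20736*f^3*ft*fz^2*fzz*e^2*C b - 2592*f^3*ft^2*fz^2*e^2
      - 15552*f^4*fzz^3*e^2*C b^2 + 93312*f^4*fz^4*e^2*C b^2 + 186624*f^5*fz^2*fzz*e^2*C b^2, ?_⟩
  have h1 : dz b (X 3) = fτzz b := dz_X b 3
  have h2 : dτ b (X 3) = dz b (fττ b) := dτ_X b 3
  rw [h1, h2]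
  simp only [dz_X, dτ_X, Matrix.cons_val, fτzz, fττ, phi, den, map_sub, map_add, map_neg,
    Derivation.leibniz,
    Derivation.leibniz_pow, smul_eq_mul, derivation_ofNat, derivation_C, nsmul_eq_mul,
    map_zero, Derivation.map_natCast]
  simp only [← hf, ← hft, ← hfz, ← hftz, ← hfzz, ← he]
  push_cast
  ring

/-- The commutator is itself a derivation, so the generators suffice. On `f, f_τ, f_z` it vanishes
by the choice of the derivations; on `f_τz, f_zz` it is the integrability condition. On `e` it
follows by applying the commutator to `e D - 1` and solving for its value on `e`, as `D` is
invertible modulo the ideal. -/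
theorem commutator_mem (b : ℂ) (P : WpRing) : ⁅dτ b, dz b⁆ P ∈ relIdeal := by
  have h3 : ⁅dτ b, dz b⁆ (X 3) ∈ relIdeal := by
    rw [Derivation.commutator_apply]; exact commutator_ftz b
  have h4 : ⁅dτ b, dz b⁆ (X 4) ∈ relIdeal := by
    rw [Derivation.commutator_apply]; exact commutator_fzz b
  have h0 : ⁅dτ b, dz b⁆ (X 0) ∈ relIdeal := by
    have : ⁅dτ b, dz b⁆ (X 0) = 0 := by
      simp only [Derivation.commutator_apply, dτ_X, dz_X, Matrix.cons_val, sub_self]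
    exact this ▸ zero_mem _
  have h1 : ⁅dτ b, dz b⁆ (X 1) ∈ relIdeal := by
    have : ⁅dτ b, dz b⁆ (X 1) = 0 := by
      simp only [Derivation.commutator_apply, dτ_X, dz_X, Matrix.cons_val, sub_self]
    exact this ▸ zero_mem _
  have h2 : ⁅dτ b, dz b⁆ (X 2) ∈ relIdeal := by
    have : ⁅dτ b, dz b⁆ (X 2) = 0 := by
      simp only [Derivation.commutator_apply, dτ_X, dz_X, Matrix.cons_val, sub_self]
    exact this ▸ zero_mem _
  generalize hE : ⁅dτ b, dz b⁆ = E at h0 h1 h2 h3 h4 ⊢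
  have hrel : E (X 5 * den - 1) ∈ relIdeal := by
    rw [← hE, Derivation.commutator_apply]
    exact sub_mem (derivation_mem_relIdeal (dτ_rel b) (dz_rel b))
      (derivation_mem_relIdeal (dz_rel b) (dτ_rel b))
  have hden : E den ∈ relIdeal := by
    have : E den = 2 * X 4 * E (X 0) + 2 * X 0 * E (X 4) - 6 * X 2 * E (X 2) := by
      simp only [den, map_sub, Derivation.leibniz, Derivation.leibniz_pow, smul_eq_mul,
        derivation_ofNat, nsmul_eq_mul]
      push_cast
      ring
    rw [this]
    exact sub_mem (add_mem (Ideal.mul_mem_left _ _ h0) (Ideal.mul_mem_left _ _ h4))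
      (Ideal.mul_mem_left _ _ h2)
  have h5 : E (X 5) ∈ relIdeal := by
    have h : E (X 5) = X 5 * E (X 5 * den - 1) - X 5 * X 5 * E den - E (X 5) * (X 5 * den - 1) := by
      rw [map_sub, Derivation.leibniz, Derivation.map_one_eq_zero, smul_eq_mul, smul_eq_mul]
      ring
    rw [h]
    exact sub_mem (sub_mem (Ideal.mul_mem_left _ _ hrel) (Ideal.mul_mem_left _ _ hden))
      (Ideal.mul_mem_left _ _ rel_mem)
  induction P using MvPolynomial.induction_on with
  | C a => rw [derivation_C]; exact zero_mem _
  | add p q hp hq => rw [map_add]; exact add_mem hp hq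
  | mul_X p n hp =>
    rw [Derivation.leibniz, smul_eq_mul, smul_eq_mul]
    refine add_mem (Ideal.mul_mem_left _ _ ?_) (Ideal.mul_mem_left _ _ hp)
    fin_cases n <;> assumption

/-- The derivation induced on the quotient by a derivation preserving `relIdeal`. -/
def quotDerivation (d : Derivation ℂ WpRing WpRing) (hd : d (X 5 * den - 1) ∈ relIdeal) :
    Derivation ℂ (WpRing ⧸ relIdeal) (WpRing ⧸ relIdeal) :=
  Derivation.liftOfSurjective (f := Ideal.Quotient.mkₐ ℂ relIdeal)
    (Ideal.Quotient.mkₐ_surjective ℂ relIdeal) (d := d) fun x hx => by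
      rw [Ideal.Quotient.mkₐ_eq_mk, Ideal.Quotient.eq_zero_iff_mem] at hx ⊢
      exact derivation_mem_relIdeal hd hx

theorem quotDerivation_mk (d : Derivation ℂ WpRing WpRing) (hd : d (X 5 * den - 1) ∈ relIdeal)
    (P : WpRing) :
    quotDerivation d hd (Ideal.Quotient.mk relIdeal P) = Ideal.Quotient.mk relIdeal (d P) :=
  Derivation.liftOfSurjective_apply (f := Ideal.Quotient.mkₐ ℂ relIdeal)
    (Ideal.Quotient.mkₐ_surjective ℂ relIdeal) (d := d) (fun x hx => by
      rw [Ideal.Quotient.mkₐ_eq_mk, Ideal.Quotient.eq_zero_iff_mem] at hx ⊢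
      exact derivation_mem_relIdeal hd hx) P

/-- The derivation by `τ` on the quotient. -/
def qτ (b : ℂ) := quotDerivation (dτ b) (dτ_rel b)

/-- The derivation by `z` on the quotient. -/
def qz (b : ℂ) := quotDerivation (dz b) (dz_rel b)

theorem qτ_qz_comm (b : ℂ) (x : WpRing ⧸ relIdeal) : qτ b (qz b x) = qz b (qτ b x) := by
  obtain ⟨P, rfl⟩ := Ideal.Quotient.mk_surjective x
  rw [qτ, qz, quotDerivation_mk, quotDerivation_mk, quotDerivation_mk, quotDerivation_mk,
    ← sub_eq_zero, ← map_sub, Ideal.Quotient.eq_zero_iff_mem, ← Derivation.commutator_apply]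
  exact commutator_mem b P

/-- The value `b = i/(12π)` reproduces both coefficients of `φ` in the system: `3π² · (-3b²) = 1/16`
and `3π · b = i/4`. The factor `D` is cancelled by the relation `e D = 1`. -/
theorem jetHom_wpSystem_eq (i : Fin 3) :
    jetHom (qτ (Complex.I / (12 * Real.pi))) (qz (Complex.I / (12 * Real.pi)))
      (Ideal.Quotient.mk relIdeal (X 0)) (wpSystem.eq i) = 0 := by
  set b : ℂ := Complex.I / (12 * Real.pi) with hb
  set m := Ideal.Quotient.mk relIdeal with hm
  have hpi : (Real.pi : ℂ) ≠ 0 := by exact_mod_cast Real.pi_ne_zero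
  have hτ : ∀ P, qτ b (m P) = m (dτ b P) := quotDerivation_mk _ _
  have hz : ∀ P, qz b (m P) = m (dz b P) := quotDerivation_mk _ _
  have hC : ∀ c : ℂ, jetHom (qτ b) (qz b) (m (X 0)) (C c) = m (C c) := fun c =>
    (jetHom (qτ b) (qz b) (m (X 0))).commutes c
  have h00 : jetHom (qτ b) (qz b) (m (X 0)) (X (0, 0)) = m (X 0) := by simp [jetHom_X]
  have h10 : jetHom (qτ b) (qz b) (m (X 0)) (X (1, 0)) = m (X 1) := by simp [jetHom_X, hτ, dτ_X]
  have h01 : jetHom (qτ b) (qz b) (m (X 0)) (X (0, 1)) = m (X 2) := by simp [jetHom_X, hz, dz_X]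
  have h11 : jetHom (qτ b) (qz b) (m (X 0)) (X (1, 1)) = m (X 3) := by
    simp [jetHom_X, hz, dz_X, hτ, dτ_X]
  have h02 : jetHom (qτ b) (qz b) (m (X 0)) (X (0, 2)) = m (X 4) := by
    simp [jetHom_X, hz, dz_X]
  have h20 : jetHom (qτ b) (qz b) (m (X 0)) (X (2, 0)) = m (fττ b) := by
    simp [jetHom_X, hτ, dτ_X]
  have h12 : jetHom (qτ b) (qz b) (m (X 0)) (X (1, 2)) = m (fτzz b) := by
    simp [jetHom_X, hz, dz_X, hτ, dτ_X]
  have h03 : jetHom (qτ b) (qz b) (m (X 0)) (X (0, 3)) = m (12 * X 0 * X 2) := by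
    rw [jetHom_X]
    change qz b (qz b (qz b _)) = _
    rw [hz, hz, hz, dz_X, Matrix.cons_val_zero, dz_X]
    exact congrArg m (dz_X b 4)
  have hrel : m (X 5) * m den = 1 := by
    rw [← map_mul, ← sub_eq_zero, ← map_one m, ← map_sub, Ideal.Quotient.eq_zero_iff_mem]
    exact rel_mem
  rw [wpSystem_eq, map_sub, map_mul, sub_eq_zero]
  fin_cases i
  · have hc : m (C (3 * (Real.pi : ℂ) ^ 2)) * (-3 * m (C b) ^ 2) = m (C (1 / 16)) := by
      rw [← map_pow, ← map_pow, show (-3 : WpRing ⧸ relIdeal) = m (C (-3)) by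
          rw [map_neg, map_neg, map_ofNat, map_ofNat], ← map_mul,
        ← map_mul, ← map_mul, ← map_mul, hb]
      congr 2
      field_simp
      rw [Complex.I_sq]
      norm_num
    simp only [wpLeadCoeff, wpLead, wpRest, wpDPoly, wpPhiPoly, Fin.zero_eta, Matrix.cons_val]
    generalize 3 * (Real.pi : ℂ) ^ 2 = κ at hc ⊢
    generalize (1 / 16 : ℂ) = γ at hc ⊢
    clear_value b
    simp only [map_sub, map_add, map_mul, map_pow, map_ofNat, hC, h00, h10, h01, h11, h02, h20] at hc ⊢
    simp only [den, fττ, phi, map_sub, map_add, map_mul, map_pow, map_ofNat, map_neg] at hrel ⊢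
    linear_combination (m (C κ) * (-3 * m (C b) ^ 2 * (16 * m (X 4) ^ 3
      - 72 * m (X 0) ^ 2 * m (X 4) ^ 2 - 216 * m (X 0) * m (X 2) ^ 2 * m (X 4) + 54 * m (X 2) ^ 4
      + 864 * m (X 0) ^ 3 * m (X 2) ^ 2) + (2 * m (X 0) * m (X 3) ^ 2
      - 6 * m (X 1) * m (X 2) * m (X 3) + 3 * m (X 1) ^ 2 * m (X 4)))) * hrel
      + (16 * m (X 4) ^ 3 - 72 * m (X 0) ^ 2 * m (X 4) ^ 2 - 216 * m (X 0) * m (X 2) ^ 2 * m (X 4)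
      + 54 * m (X 2) ^ 4 + 864 * m (X 0) ^ 3 * m (X 2) ^ 2) * hc
  · have hc : m (C (3 * (Real.pi : ℂ))) * m (C b) = m (C (Complex.I / 4)) := by
      rw [← map_mul, ← map_mul, hb]
      congr 2
      field_simp
      norm_num
    simp only [wpLeadCoeff, wpLead, wpRest, wpDPoly, wpPhiPoly, Fin.mk_one, Matrix.cons_val]
    have hc' : m (C (3 * (Real.pi : ℂ))) = 3 * m (C (Real.pi : ℂ)) := by
      rw [map_mul, map_mul, map_ofNat, map_ofNat]
    generalize 3 * (Real.pi : ℂ) = κ at hc hc' ⊢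
    generalize Complex.I / 4 = γ at hc ⊢
    clear_value b
    simp only [map_sub, map_add, map_mul, map_pow, map_ofNat, hC, h00, h10, h01, h11, h02, h12] at hc ⊢
    simp only [den, fτzz, phi, map_sub, map_add, map_mul, map_pow, map_ofNat] at hrel ⊢
    linear_combination (m (C κ) * (m (C b) * (16 * m (X 4) ^ 3
      - 72 * m (X 0) ^ 2 * m (X 4) ^ 2 - 216 * m (X 0) * m (X 2) ^ 2 * m (X 4) + 54 * m (X 2) ^ 4
      + 864 * m (X 0) ^ 3 * m (X 2) ^ 2) + 12 * m (X 0) * m (X 2) * (2 * m (X 0) * m (X 3)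
      - 3 * m (X 1) * m (X 2)) - 4 * m (X 4) * (m (X 2) * m (X 3) - m (X 1) * m (X 4)))) * hrel
      + (16 * m (X 4) ^ 3 - 72 * m (X 0) ^ 2 * m (X 4) ^ 2 - 216 * m (X 0) * m (X 2) ^ 2 * m (X 4)
      + 54 * m (X 2) ^ 4 + 864 * m (X 0) ^ 3 * m (X 2) ^ 2) * hc
      + (12 * m (X 0) * m (X 2) * (2 * m (X 0) * m (X 3)
      - 3 * m (X 1) * m (X 2)) - 4 * m (X 4) * (m (X 2) * m (X 3) - m (X 1) * m (X 4))) * hc'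
  · simp only [wpLeadCoeff, wpLead, wpRest, Fin.reduceFinMk, Matrix.cons_val,
      map_mul, map_ofNat, h00, h01, h03, map_one, one_mul]

end WpRing

/-- Every choice of the five free derivatives with nonvanishing `2 f f_zz - 3 f_z²` extends to a jet
in all loci of `wpSystem`. -/
theorem exists_mem_wpSystem_locus {c : Fin 5 → ℂ} (hc : 2 * c 0 * c 4 - 3 * c 2 ^ 2 ≠ 0) :
    ∃ v : Jet2, (∀ r, v ∈ wpSystem.locus r) ∧ v (0, 0) = c 0 ∧ v (1, 0) = c 1 ∧ v (0, 1) = c 2 ∧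
      v (1, 1) = c 3 ∧ v (0, 2) = c 4 := by
  open WpRing in
  set b : ℂ := Complex.I / (12 * Real.pi) with hb
  -- The point with the prescribed free derivatives and `e = 1/D`; evaluation there kills the
  -- relation and so descends to the quotient.
  let pt : Fin 6 → ℂ := ![c 0, c 1, c 2, c 3, c 4, (2 * c 0 * c 4 - 3 * c 2 ^ 2)⁻¹]
  have hpt : ∀ x ∈ relIdeal, MvPolynomial.aeval pt x = 0 := by
    intro x hx
    obtain ⟨a, rfl⟩ := Ideal.mem_span_singleton'.1 hx
    simp only [den, map_mul, map_sub, map_ofNat, map_pow, MvPolynomial.aeval_X, map_one, pt,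
      Matrix.cons_val]
    rw [inv_mul_cancel₀ hc, sub_self, mul_zero]
  let ev : (WpRing ⧸ relIdeal) →ₐ[ℂ] ℂ := Ideal.Quotient.liftₐ relIdeal (MvPolynomial.aeval pt) hpt
  have hev : ∀ P, ev (Ideal.Quotient.mk relIdeal P) = MvPolynomial.aeval pt P := fun P => rfl
  have hτ : ∀ P, qτ b (Ideal.Quotient.mk relIdeal P) = Ideal.Quotient.mk relIdeal (dτ b P) :=
    quotDerivation_mk _ _
  have hz : ∀ P, qz b (Ideal.Quotient.mk relIdeal P) = Ideal.Quotient.mk relIdeal (dz b P) :=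
    quotDerivation_mk _ _
  refine ⟨_, mem_locus_of_jetHom (qτ b) (qz b) (Ideal.Quotient.mk relIdeal (MvPolynomial.X 0))
    (qτ_qz_comm b) wpSystem jetHom_wpSystem_eq ev ?_, ?_, ?_, ?_, ?_, ?_⟩
  · have : jetHom (qτ b) (qz b) (Ideal.Quotient.mk relIdeal (MvPolynomial.X 0)) wpSystem.nondeg =
        Ideal.Quotient.mk relIdeal (2 * MvPolynomial.X 0 * MvPolynomial.X 4
          - 3 * MvPolynomial.X 2 ^ 2) := by
      simp only [wpSystem, wpDPoly, map_sub, map_mul, map_pow, map_ofNat, jetHom_X,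
        Function.iterate_zero, id, Function.iterate_succ, Function.comp_apply, hz, dz_X,
        Matrix.cons_val]
    rw [this, hev]
    simpa [pt] using hc
  · simp [hev, pt]
  · simp [hev, pt, hτ, dτ_X]
  · simp [hev, pt, hz, dz_X]
  · simp [hev, pt, hz, dz_X, hτ, dτ_X]
  · simp [hev, pt, hz, dz_X]

theorem wpSystem_isInvolutive : wpSystem.IsInvolutive 2 where
  nonempty := by
    obtain ⟨v, hv, -⟩ := exists_mem_wpSystem_locus (c := ![1, 0, 0, 0, 1]) (by simp)
    exact ⟨v, hv _⟩
  regular u hu := wpSystem_regular hu.1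
  symbol_dim := ⟨0, fun u hu => by
    rw [wpSystem_symbol_eq_bot (by norm_num) hu.1]
    exact finrank_bot ℂ _⟩
  symbol_involutive u hu := by
    refine ⟨1, 0, Or.inl one_ne_zero, ?_⟩
    rw [wpSystem_symbol_eq_bot (by norm_num) hu.1, wpSystem_symbol_eq_bot (by norm_num) hu.1,
      bot_inf_eq, finrank_bot, finrank_bot]
  integrable t _ u hu := by
    have hne : 2 * u (0, 0) * u (0, 2) - 3 * u (0, 1) ^ 2 ≠ 0 := by
      simpa [wpSystem, wpDPoly] using hu.1
    -- The jet with the same free derivatives as `u` solves all prolongations. Up to order `t` it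
    -- coincides with `u`, since both lie in the locus of order `t`.
    obtain ⟨v, hv, h00, h10, h01, h11, h02⟩ := exists_mem_wpSystem_locus
      (c := ![u (0, 0), u (1, 0), u (0, 1), u (1, 1), u (0, 2)]) (by simpa using hne)
    refine ⟨v, hv _, fun i j hij => wpSystem_locus_unique (hv t) hu ?_ (i, j) hij⟩
    rintro p (rfl | rfl | rfl | rfl | rfl)
    · exact h00
    · exact h10
    · exact h01
    · exact h11
    · exact h02

/-! ### Solved and invariant forms of the system -/

theorem wpSystem_eqs_iff (u : Jet2) : (∀ i, MvPolynomial.eval u (wpSystem.eq i) = 0) ↔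
    3 * Real.pi ^ 2 * (2 * u (0, 0) * u (0, 2) - 3 * u (0, 1) ^ 2) * u (2, 0) =
      1 / 16 * wpPhi u + 3 * Real.pi ^ 2 * (2 * u (0, 0) * u (1, 1) ^ 2
      - 6 * u (1, 0) * u (0, 1) * u (1, 1) + 3 * u (1, 0) ^ 2 * u (0, 2)) ∧
    3 * Real.pi * (2 * u (0, 0) * u (0, 2) - 3 * u (0, 1) ^ 2) * u (1, 2) =
      Complex.I / 4 * wpPhi u + Real.pi * (36 * u (0, 0) * u (0, 1)
        * (2 * u (0, 0) * u (1, 1) - 3 * u (1, 0) * u (0, 1))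
      - 12 * u (0, 2) * (u (0, 1) * u (1, 1) - u (1, 0) * u (0, 2))) ∧
    u (0, 3) = 12 * u (0, 0) * u (0, 1) := by
  change (∀ i : Fin 3, _) ↔ _
  rw [Fin.forall_fin_succ, Fin.forall_fin_two]
  simp only [wpSystem, wpDPoly, wpPhiPoly, wpPhi, Matrix.cons_val, map_sub, map_add,
    map_mul, map_pow, map_ofNat, MvPolynomial.eval_X, MvPolynomial.eval_C, sub_eq_zero, Fin.succ_zero_eq_one,
    Fin.succ_one_eq_two]

theorem wpSystem_nondeg_eval (u : Jet2) : MvPolynomial.eval u wpSystem.nondeg =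
    2 * u (0, 0) * u (0, 2) - 3 * u (0, 1) ^ 2 := by
  simp [wpSystem, wpDPoly]

theorem wpSystem_holdsAt_iff (u : Jet2) : wpSystem.HoldsAt u ↔
    2 * u (0, 0) * u (0, 2) - 3 * u (0, 1) ^ 2 ≠ 0 ∧
    3 * Real.pi ^ 2 * (2 * u (0, 0) * u (0, 2) - 3 * u (0, 1) ^ 2) * u (2, 0) =
      1 / 16 * wpPhi u + 3 * Real.pi ^ 2 * (2 * u (0, 0) * u (1, 1) ^ 2
      - 6 * u (1, 0) * u (0, 1) * u (1, 1) + 3 * u (1, 0) ^ 2 * u (0, 2)) ∧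
    3 * Real.pi * (2 * u (0, 0) * u (0, 2) - 3 * u (0, 1) ^ 2) * u (1, 2) =
      Complex.I / 4 * wpPhi u + Real.pi * (36 * u (0, 0) * u (0, 1)
        * (2 * u (0, 0) * u (1, 1) - 3 * u (1, 0) * u (0, 1))
      - 12 * u (0, 2) * (u (0, 1) * u (1, 1) - u (1, 0) * u (0, 2))) ∧
    u (0, 3) = 12 * u (0, 0) * u (0, 1) := by
  rw [PDESystem.HoldsAt, wpSystem_nondeg_eval, wpSystem_eqs_iff]

theorem wpSystem_holdsAt_iff_solved (u : Jet2) : wpSystem.HoldsAt u ↔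
    2 * u (0, 0) * u (0, 2) - 3 * u (0, 1) ^ 2 ≠ 0 ∧ WpSolvedForm u := by
  have hpi : (Real.pi : ℂ) ≠ 0 := by exact_mod_cast Real.pi_ne_zero
  rw [wpSystem_holdsAt_iff]
  refine and_congr_right fun hD => ?_
  rw [WpSolvedForm, eq_div_iff (mul_ne_zero (by simp [hpi]) hD),
    eq_div_iff (mul_ne_zero (by simp [hpi]) hD), mul_comm (u (2, 0)), mul_comm (u (1, 2))]

/-- Let `A` denote the numerator of `scrI 2`. The first equation is `48π² A = φ`; the last invariant
equation is the same identity divided by `2 s ^ 12`. Given `f_zzz = 12 f f_z`, the second equation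
says that the numerator of `scrJ 2` is `iφ/(12π)`, which is `4πi A`. -/
theorem wpSystem_holdsAt_iff_invariant (u : Jet2) (s : ℂ) (hf : u (0, 0) ≠ 0)
    (hs : s ^ 2 = u (0, 0)) (hD : 2 * u (0, 0) * u (0, 2) - 3 * u (0, 1) ^ 2 ≠ 0) :
    wpSystem.HoldsAt u ↔ WpInvariantForm s u := by
  have hpi : (Real.pi : ℂ) ≠ 0 := by exact_mod_cast Real.pi_ne_zero
  have hs0 : s ≠ 0 := by rintro rfl; exact hf (by rw [← hs]; simp)
  have hI := Complex.I_sq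
  have hDs : scrD 2 u = 2 * u (0, 0) * u (0, 2) - 3 * u (0, 1) ^ 2 := by
    simp only [scrD]; push_cast; ring
  have hN : scrN s u = 12 * scrL s u ↔ u (0, 3) = 12 * u (0, 0) * u (0, 1) := by
    rw [scrN, scrL, ← hs]
    field_simp
  set A : ℂ := (2 * u (0, 0) * u (0, 2) - 3 * u (0, 1) ^ 2) * u (2, 0)
    - (2 * u (0, 0) * u (1, 1) ^ 2 - 6 * u (1, 0) * u (0, 1) * u (1, 1)
      + 3 * u (1, 0) ^ 2 * u (0, 2)) with hA
  have hscrI : scrI 2 s u = A / (u (0, 0) * s ^ 4 * scrD 2 u) := by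
    rw [scrI, hDs, hA]; push_cast; ring
  have hJ : scrJ 2 s u = 4 * Real.pi * Complex.I * scrI 2 s u ↔
      (2 * u (0, 0) * u (0, 2) - 3 * u (0, 1) ^ 2) * u (1, 2)
      - (2 * u (0, 0) * u (1, 1) - 3 * u (1, 0) * u (0, 1)) * u (0, 3)
      + 4 * u (0, 2) * (u (0, 1) * u (1, 1) - u (1, 0) * u (0, 2)) =
        4 * Real.pi * Complex.I * A := by
    rw [hscrI, scrJ, ← mul_div_assoc, div_left_inj']
    · rw [hDs]
      push_cast
      ring_nf
    · rw [hDs]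
      exact mul_ne_zero (mul_ne_zero hf (pow_ne_zero _ hs0)) hD
  have hM : 24 * Real.pi ^ 2 * (2 * scrM s u - 3 * scrL s u ^ 2) * scrI 2 s u =
      8 * scrM s u ^ 3 - 36 * scrM s u ^ 2 - 108 * scrL s u ^ 2 * scrM s u
        + 27 * scrL s u ^ 2 * (scrL s u ^ 2 + 16) ↔ 48 * Real.pi ^ 2 * A = wpPhi u := by
    have h1 : 24 * Real.pi ^ 2 * (2 * scrM s u - 3 * scrL s u ^ 2) * scrI 2 s u =
        24 * Real.pi ^ 2 * A / s ^ 12 := by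
      -- Substituting `f = s²` turns every invariant into a quotient by a power of `s`; both sides
      -- of the equation end up over `s ^ 12`.
      have : 2 * scrM s u - 3 * scrL s u ^ 2 = scrD 2 u / s ^ 6 := by
        rw [hDs, scrM, scrL, ← hs]
        field_simp
      rw [this, hscrI, ← hs]
      have hDs0 : scrD 2 u ≠ 0 := hDs ▸ hD
      field_simp
    have h2 : 8 * scrM s u ^ 3 - 36 * scrM s u ^ 2 - 108 * scrL s u ^ 2 * scrM s u
        + 27 * scrL s u ^ 2 * (scrL s u ^ 2 + 16) = (wpPhi u / 2) / s ^ 12 := by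
      rw [scrM, scrL, wpPhi, ← hs]
      field_simp
      ring
    rw [h1, h2, div_left_inj' (pow_ne_zero _ hs0)]
    constructor <;> intro h
    · linear_combination 2 * h
    · linear_combination h / 2
  rw [wpSystem_holdsAt_iff, WpInvariantForm, hN, hJ, hM]
  clear hN hJ hM hscrI
  refine ⟨fun ⟨_, h0, h1, h2⟩ => ?_, fun ⟨h2, h1, h0⟩ => ?_⟩
  · have hA1 : 48 * Real.pi ^ 2 * A = wpPhi u := by
      linear_combination 16 * h0
    refine ⟨h2, ?_, hA1⟩
    have h3 : (3 * Real.pi : ℂ) ≠ 0 := by simp [hpi]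
    refine mul_left_cancel₀ h3 ?_
    linear_combination h1 - 3 * Real.pi * (2 * u (0, 0) * u (1, 1) - 3 * u (1, 0) * u (0, 1)) * h2
      - Complex.I / 4 * hA1
  · refine ⟨hD, ?_, ?_, h2⟩
    · linear_combination 1 / 16 * h0
    · linear_combination 3 * Real.pi * h1
        + 3 * Real.pi * (2 * u (0, 0) * u (1, 1) - 3 * u (1, 0) * u (0, 1)) * h2
        + Complex.I / 4 * h0

/-! ### Partial derivatives of functions of `(τ, z)` -/

/-- The partial derivative with respect to the first variable. -/
def partialτ (f : ℂ × ℂ → ℂ) (x : ℂ × ℂ) : ℂ := deriv (fun t => f (t, x.2)) x.1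

/-- The partial derivative with respect to the second variable. -/
def partialz (f : ℂ × ℂ → ℂ) (x : ℂ × ℂ) : ℂ := deriv (fun w => f (x.1, w)) x.2

theorem iteratedDeriv_snd_eq (f : ℂ × ℂ → ℂ) (n : ℕ) (t w : ℂ) :
    iteratedDeriv n (fun w => f (t, w)) w = (partialz^[n] f) (t, w) := by
  induction n generalizing w with
  | zero => rfl
  | succ n ih =>
    rw [iteratedDeriv_succ, Function.iterate_succ_apply', partialz]
    exact congrArg (fun h => deriv h w) (funext ih)

theorem iteratedDeriv_fst_eq (f : ℂ × ℂ → ℂ) (n : ℕ) (t w : ℂ) :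
    iteratedDeriv n (fun t => f (t, w)) t = (partialτ^[n] f) (t, w) := by
  induction n generalizing t with
  | zero => rfl
  | succ n ih =>
    rw [iteratedDeriv_succ, Function.iterate_succ_apply', partialτ]
    exact congrArg (fun h => deriv h t) (funext ih)

theorem jetAt_eq (f : ℂ × ℂ → ℂ) (x : ℂ × ℂ) (i j : ℕ) :
    jetAt f x (i, j) = (partialτ^[i] (partialz^[j] f)) x := by
  simp only [jetAt, iteratedDeriv_snd_eq]
  exact iteratedDeriv_fst_eq _ i x.1 x.2

theorem partialτ_congr {f g : ℂ × ℂ → ℂ} {x : ℂ × ℂ} (h : f =ᶠ[𝓝 x] g) :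
    partialτ f =ᶠ[𝓝 x] partialτ g := by
  filter_upwards [h.eventuallyEq_nhds] with y hy
  have hc : Filter.Tendsto (fun t : ℂ => (t, y.2)) (𝓝 y.1) (𝓝 y) :=
    Continuous.tendsto' (by fun_prop) _ _ rfl
  exact Filter.EventuallyEq.deriv_eq (hc.eventually hy)

theorem partialz_congr {f g : ℂ × ℂ → ℂ} {x : ℂ × ℂ} (h : f =ᶠ[𝓝 x] g) :
    partialz f =ᶠ[𝓝 x] partialz g := by
  filter_upwards [h.eventuallyEq_nhds] with y hy
  have hc : Filter.Tendsto (fun w : ℂ => (y.1, w)) (𝓝 y.2) (𝓝 y) :=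
    Continuous.tendsto' (by fun_prop) _ _ rfl
  exact Filter.EventuallyEq.deriv_eq (hc.eventually hy)

section Differentiable

variable {f : ℂ × ℂ → ℂ} {x : ℂ × ℂ}

theorem DifferentiableAt.hasDerivAt_partialτ (h : DifferentiableAt ℂ f x) :
    HasDerivAt (fun t => f (t, x.2)) (partialτ f x) x.1 := by
  refine DifferentiableAt.hasDerivAt ?_
  exact DifferentiableAt.comp (g := f) x.1 h (by fun_prop)

theorem DifferentiableAt.hasDerivAt_partialz (h : DifferentiableAt ℂ f x) :
    HasDerivAt (fun w => f (x.1, w)) (partialz f x) x.2 := by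
  refine DifferentiableAt.hasDerivAt ?_
  exact DifferentiableAt.comp (g := f) x.2 h (by fun_prop)

theorem DifferentiableAt.fderiv_apply_eq (h : DifferentiableAt ℂ f x) (a b : ℂ) :
    fderiv ℂ f x (a, b) = a * partialτ f x + b * partialz f x := by
  have h1 : HasDerivAt (fun t => f (t, x.2)) (fderiv ℂ f x (1, 0)) x.1 :=
    h.hasFDerivAt.comp_hasDerivAt (f := fun t => (t, x.2)) x.1
      ((hasDerivAt_id x.1).prodMk (hasDerivAt_const x.1 x.2))
  have h2 : HasDerivAt (fun w => f (x.1, w)) (fderiv ℂ f x (0, 1)) x.2 :=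
    h.hasFDerivAt.comp_hasDerivAt (f := fun w => (x.1, w)) x.2
      ((hasDerivAt_const x.2 x.1).prodMk (hasDerivAt_id x.2))
  rw [h.hasDerivAt_partialτ.unique h1, h.hasDerivAt_partialz.unique h2, ← smul_eq_mul,
    ← smul_eq_mul, ← map_smul, ← map_smul, ← map_add]
  simp

theorem DifferentiableAt.hasDerivAt_comp_curve {γ : ℂ → ℂ × ℂ} {t a b : ℂ}
    (h : DifferentiableAt ℂ f (γ t)) (hγ : HasDerivAt γ (a, b) t) :
    HasDerivAt (fun s => f (γ s)) (a * partialτ f (γ t) + b * partialz f (γ t)) t := by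
  rw [← h.fderiv_apply_eq]
  exact h.hasFDerivAt.comp_hasDerivAt t hγ

theorem AnalyticAt.partialτ_eventuallyEq (h : AnalyticAt ℂ f x) :
    partialτ f =ᶠ[𝓝 x] fun y => fderiv ℂ f y (1, 0) := by
  filter_upwards [h.eventually_analyticAt] with y hy
  rw [hy.differentiableAt.fderiv_apply_eq]
  ring

theorem AnalyticAt.partialz_eventuallyEq (h : AnalyticAt ℂ f x) :
    partialz f =ᶠ[𝓝 x] fun y => fderiv ℂ f y (0, 1) := by
  filter_upwards [h.eventually_analyticAt] with y hy
  rw [hy.differentiableAt.fderiv_apply_eq]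
  ring

theorem AnalyticAt.partialτ (h : AnalyticAt ℂ f x) : AnalyticAt ℂ (partialτ f) x :=
  (((ContinuousLinearMap.apply ℂ ℂ ((1 : ℂ), (0 : ℂ))).analyticAt _).comp h.fderiv).congr
    h.partialτ_eventuallyEq.symm

theorem AnalyticAt.partialz (h : AnalyticAt ℂ f x) : AnalyticAt ℂ (partialz f) x :=
  (((ContinuousLinearMap.apply ℂ ℂ ((0 : ℂ), (1 : ℂ))).analyticAt _).comp h.fderiv).congr
    h.partialz_eventuallyEq.symm

/-- Symmetry of the second derivative. Jets are formed with the `z`-derivatives taken first, so this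
is what permits differentiating a formula for `f_τ` in `z`. -/
theorem AnalyticAt.partialz_partialτ (h : AnalyticAt ℂ f x) :
    _root_.partialz (_root_.partialτ f) x = _root_.partialτ (_root_.partialz f) x := by
  have hs : IsSymmSndFDerivAt ℂ f x :=
    (h.contDiffAt (n := 2)).isSymmSndFDerivAt (by simp)
  have hd := h.fderiv.differentiableAt
  rw [(partialz_congr h.partialτ_eventuallyEq).eq_of_nhds,
    (partialτ_congr h.partialz_eventuallyEq).eq_of_nhds]
  have h1 : DifferentiableAt ℂ (fun y => _root_.fderiv ℂ f y ((1 : ℂ), (0 : ℂ))) x := by fun_prop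
  have h2 : DifferentiableAt ℂ (fun y => _root_.fderiv ℂ f y ((0 : ℂ), (1 : ℂ))) x := by fun_prop
  have e1 := h1.fderiv_apply_eq 0 1
  have e2 := h2.fderiv_apply_eq 1 0
  rw [zero_mul, one_mul, zero_add] at e1
  rw [zero_mul, one_mul, add_zero] at e2
  rw [← e1, ← e2, fderiv_clm_apply hd (by fun_prop), fderiv_clm_apply hd (by fun_prop)]
  simpa using hs _ _

end Differentiable

/-! ### The action of the Jacobi group on jets -/

section Jacobi

variable {a b c d l m : ℂ}

/-- In the second component `l (cτ + d) - c (z + lτ + m)` loses its `τ`-terms. The resulting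
coefficient `ρ = ld - cz - cm` is thus independent of `τ`. -/
theorem hasDerivAt_jacobiMap_fst (hdet : a * d - b * c = 1) {x : ℂ × ℂ} (hj : c * x.1 + d ≠ 0) :
    HasDerivAt (fun t => jacobiMap a b c d l m (t, x.2))
      ((c * x.1 + d)⁻¹ ^ 2, (c * x.1 + d)⁻¹ ^ 2 * (l * d - c * x.2 - c * m)) x.1 := by
  have hj' : HasDerivAt (fun t : ℂ => c * t + d) c x.1 := by
    simpa using ((hasDerivAt_id x.1).const_mul c).add_const d
  have h1 : HasDerivAt (fun t : ℂ => a * t + b) a x.1 := by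
    simpa using ((hasDerivAt_id x.1).const_mul a).add_const b
  have h2 : HasDerivAt (fun t : ℂ => x.2 + l * t + m) l x.1 := by
    simpa using (((hasDerivAt_id x.1).const_mul l).const_add x.2).add_const m
  refine ((h1.div hj' hj).prodMk (h2.div hj' hj)).congr_deriv ?_
  ext
  · simp only
    field_simp
    linear_combination hdet
  · simp only
    field_simp
    ring

theorem hasDerivAt_jacobiMap_snd {x : ℂ × ℂ} :
    HasDerivAt (fun w => jacobiMap a b c d l m (x.1, w)) (0, (c * x.1 + d)⁻¹) x.2 := by
  have h2 : HasDerivAt (fun w : ℂ => w + l * x.1 + m) 1 x.2 := by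
    simpa using ((hasDerivAt_id x.2).add_const (l * x.1)).add_const m
  refine ((hasDerivAt_const x.2 ((a * x.1 + b) / (c * x.1 + d))).prodMk (h2.div_const (c * x.1 + d))).congr_deriv ?_
  simp

/-- The factor `(cτ+d)^(-n)` times the pull-back of `H` along the Jacobi map. -/
def jacobiPull (a b c d l m : ℂ) (n : ℕ) (H : ℂ × ℂ → ℂ) (x : ℂ × ℂ) : ℂ :=
  (c * x.1 + d)⁻¹ ^ n * H (jacobiMap a b c d l m x)

/-- Functions of the form `(cτ+d)^(-n)` times a pull-back are carried by the partial derivatives to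
combinations of such functions. The jets of a transform are therefore computed by iterating this
rule and the one for `z`. -/
theorem hasDerivAt_jacobiPull_fst (hdet : a * d - b * c = 1) {x : ℂ × ℂ} (hj : c * x.1 + d ≠ 0)
    {H : ℂ × ℂ → ℂ} (hH : DifferentiableAt ℂ H (jacobiMap a b c d l m x)) (n : ℕ) :
    HasDerivAt (fun t => jacobiPull a b c d l m n H (t, x.2))
      (-(n * c) * jacobiPull a b c d l m (n + 1) H x
        + jacobiPull a b c d l m (n + 2) (partialτ H) x
        + (l * d - c * x.2 - c * m) * jacobiPull a b c d l m (n + 2) (partialz H) x) x.1 := by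
  have h1 := DifferentiableAt.hasDerivAt_comp_curve
    (γ := fun t => jacobiMap a b c d l m (t, x.2)) hH (hasDerivAt_jacobiMap_fst hdet hj)
  have hj' : HasDerivAt (fun t : ℂ => c * t + d) c x.1 := by
    simpa using ((hasDerivAt_id x.1).const_mul c).add_const d
  have h2 : HasDerivAt (fun t : ℂ => (c * t + d)⁻¹ ^ n)
      (-(n * c) * (c * x.1 + d)⁻¹ ^ (n + 1)) x.1 := by
    refine ((hj'.fun_inv hj).fun_pow n).congr_deriv ?_
    -- The exponent `n - 1` of the power rule is truncated at `n = 0`, where the derivative vanishes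
    -- anyway.
    rcases n with _ | n
    · simp
    · rw [Nat.add_sub_cancel, div_eq_mul_inv, ← inv_pow]
      ring
  refine (h2.mul h1).congr_deriv ?_
  simp only [jacobiPull]
  ring

theorem hasDerivAt_jacobiPull_snd {x : ℂ × ℂ}
    {H : ℂ × ℂ → ℂ} (hH : DifferentiableAt ℂ H (jacobiMap a b c d l m x)) (n : ℕ) :
    HasDerivAt (fun w => jacobiPull a b c d l m n H (x.1, w))
      (jacobiPull a b c d l m (n + 1) (partialz H) x) x.2 := by
  have h1 := DifferentiableAt.hasDerivAt_comp_curve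
    (γ := fun w => jacobiMap a b c d l m (x.1, w)) hH hasDerivAt_jacobiMap_snd
  refine (h1.const_mul ((c * x.1 + d)⁻¹ ^ n)).congr_deriv ?_
  simp only [jacobiPull]
  ring

theorem continuousAt_jacobiMap {x : ℂ × ℂ} (hj : c * x.1 + d ≠ 0) :
    ContinuousAt (jacobiMap a b c d l m) x := by
  unfold jacobiMap
  fun_prop (disch := assumption)

theorem partialτ_jacobiPull (hdet : a * d - b * c = 1) {x : ℂ × ℂ} (hj : c * x.1 + d ≠ 0)
    {H : ℂ × ℂ → ℂ} (hH : AnalyticAt ℂ H (jacobiMap a b c d l m x)) (n : ℕ) :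
    partialτ (jacobiPull a b c d l m n H) =ᶠ[𝓝 x] fun y =>
      -(n * c) * jacobiPull a b c d l m (n + 1) H y
        + jacobiPull a b c d l m (n + 2) (partialτ H) y
        + (l * d - c * y.2 - c * m) * jacobiPull a b c d l m (n + 2) (partialz H) y := by
  have hj' : ∀ᶠ y : ℂ × ℂ in 𝓝 x, c * y.1 + d ≠ 0 :=
    ContinuousAt.eventually_ne (by fun_prop) hj
  filter_upwards [hj', (continuousAt_jacobiMap (l := l) (m := m) (a := a) (b := b)
    hj).eventually hH.eventually_analyticAt] with y h1 h2
  exact (hasDerivAt_jacobiPull_fst hdet h1 h2.differentiableAt n).deriv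

theorem partialz_jacobiPull {x : ℂ × ℂ} (hj : c * x.1 + d ≠ 0)
    {H : ℂ × ℂ → ℂ} (hH : AnalyticAt ℂ H (jacobiMap a b c d l m x)) (n : ℕ) :
    partialz (jacobiPull a b c d l m n H) =ᶠ[𝓝 x] jacobiPull a b c d l m (n + 1) (partialz H) := by
  filter_upwards [(continuousAt_jacobiMap (l := l) (m := m) (a := a) (b := b)
    hj).eventually hH.eventually_analyticAt] with y h2
  exact (hasDerivAt_jacobiPull_snd h2.differentiableAt n).deriv

/-- The jets of a function and of its transform by the Jacobi group (weight two). -/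
theorem IsJacobiTransform.jets {g : SL(2, ℝ)} {l m : ℝ} {f F : ℂ × ℂ → ℂ} {x : ℂ × ℂ}
    (h : IsJacobiTransform 2 g l m f F x) : ∃ J c ρ : ℂ, J = ((g 1 0 : ℂ) * x.1 + (g 1 1 : ℂ))⁻¹ ∧
    ∀ u U : Jet2, u = jetAt f x →
      U = jetAt F (jacobiMap (g 0 0) (g 0 1) (g 1 0) (g 1 1) l m x) →
    u (0, 0) = J ^ 2 * U (0, 0) ∧ u (0, 1) = J ^ 3 * U (0, 1) ∧ u (0, 2) = J ^ 4 * U (0, 2) ∧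
    u (0, 3) = J ^ 5 * U (0, 3) ∧
    u (1, 0) = -2 * c * J ^ 3 * U (0, 0) + J ^ 4 * (U (1, 0) + ρ * U (0, 1)) ∧
    u (1, 1) = -3 * c * J ^ 4 * U (0, 1) + J ^ 5 * (U (1, 1) + ρ * U (0, 2)) ∧
    u (1, 2) = -4 * c * J ^ 5 * U (0, 2) + J ^ 6 * (U (1, 2) + ρ * U (0, 3)) ∧
    u (2, 0) = 6 * c ^ 2 * J ^ 4 * U (0, 0) - 6 * c * J ^ 5 * (U (1, 0) + ρ * U (0, 1))
      + J ^ 6 * (U (2, 0) + 2 * ρ * U (1, 1) + ρ ^ 2 * U (0, 2)) := by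
  obtain ⟨hj, hf, hF, hT⟩ := h
  have hdet : (g 0 0 : ℂ) * (g 1 1 : ℂ) - (g 0 1 : ℂ) * (g 1 0 : ℂ) = 1 := by
    have := g.2
    rw [Matrix.det_fin_two] at this
    exact_mod_cast this
  generalize (g 0 0 : ℂ) = a at *
  generalize (g 0 1 : ℂ) = b at *
  generalize (g 1 0 : ℂ) = c at *
  generalize (g 1 1 : ℂ) = d at *
  generalize (l : ℂ) = l at *
  generalize (m : ℂ) = m at *
  have hjn : ∀ᶠ y : ℂ × ℂ in 𝓝 x, c * y.1 + d ≠ 0 :=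
    ContinuousAt.eventually_ne (by fun_prop) hj
  have e00 : f =ᶠ[𝓝 x] jacobiPull a b c d l m 2 F := by
    filter_upwards [hT, hjn] with y h1 h2
    rw [jacobiPull, h1]
    field_simp
  have e01 := (partialz_congr e00).trans (partialz_jacobiPull hj hF 2)
  have e02 := (partialz_congr e01).trans (partialz_jacobiPull hj hF.partialz 3)
  have e03 := (partialz_congr e02).trans (partialz_jacobiPull hj hF.partialz.partialz 4)
  have e10 := (partialτ_congr e00).trans (partialτ_jacobiPull hdet hj hF 2)
  have e11 := (partialτ_congr e01).trans (partialτ_jacobiPull hdet hj hF.partialz 3)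
  have e12 := (partialτ_congr e02).trans (partialτ_jacobiPull hdet hj hF.partialz.partialz 4)
  -- The `τ`-derivative of the three terms of the formula for `f_τ`. The factor `ρ` of the last one
  -- depends on `z` only and counts as a constant.
  have e20 := (((hasDerivAt_jacobiPull_fst hdet hj hF.differentiableAt 3).const_mul
      (-(((2 : ℕ) : ℂ) * c))).fun_add
      (hasDerivAt_jacobiPull_fst hdet hj hF.partialτ.differentiableAt 4) |>.fun_add
      ((hasDerivAt_jacobiPull_fst hdet hj hF.partialz.differentiableAt 4).const_mul
      (l * d - c * x.2 - c * m))).deriv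
  replace e20 := ((partialτ_congr e10).eq_of_nhds).trans e20
  refine ⟨(c * x.1 + d)⁻¹, c, l * d - c * x.2 - c * m, rfl, ?_⟩
  rintro u U rfl rfl
  simp only [jetAt_eq, Function.iterate_zero, id, Function.iterate_succ, Function.comp_apply]
  rw [e00.eq_of_nhds, e01.eq_of_nhds, e02.eq_of_nhds, e03.eq_of_nhds, e10.eq_of_nhds,
    e11.eq_of_nhds, e12.eq_of_nhds, e20]
  simp only [jacobiPull, hF.partialz_partialτ]
  refine ⟨trivial, trivial, trivial, trivial, ?_, ?_, ?_, ?_⟩ <;> push_cast <;> ring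

end Jacobi

/-! ### Invariance of the system and of the five differential invariants -/

theorem wpSystem_isJacobiInvariant : wpSystem.IsJacobiInvariant 2 := by
  intro g l m f F x h
  have hj := h.defined
  obtain ⟨J, c, ρ, hJ, hjet⟩ := h.jets
  have hJ0 : J ≠ 0 := hJ ▸ inv_ne_zero hj
  have hjet' := hjet _ _ rfl rfl
  generalize jetAt f x = u at *
  generalize jetAt F _ = U at *
  obtain ⟨h00, h01, h02, h03, h10, h11, h12, h20⟩ := hjet'
  have hD : 2 * u (0, 0) * u (0, 2) - 3 * u (0, 1) ^ 2 =
      J ^ 6 * (2 * U (0, 0) * U (0, 2) - 3 * U (0, 1) ^ 2) := by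
    rw [h00, h01, h02]; ring
  have hphi : wpPhi u = J ^ 12 * wpPhi U := by
    rw [wpPhi, wpPhi, h00, h01, h02]; ring
  rw [wpSystem_holdsAt_iff, wpSystem_holdsAt_iff, hD, hphi, h00, h01, h02, h03, h10, h11, h12, h20]
  have h12' : J ^ 12 ≠ 0 := pow_ne_zero _ hJ0
  constructor
  · rintro ⟨k0, k1, k2, k3⟩
    refine ⟨mul_ne_zero (pow_ne_zero _ hJ0) k0, ?_, ?_, ?_⟩
    -- Both equations with a left-hand factor `D` have weight `12`. In the first all terms with `c`
    -- and `ρ` cancel; in the second the remaining `ρ`-term is a multiple of the third equation.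
    · linear_combination J ^ 12 * k1
    · linear_combination J ^ 12 * k2 + 3 * Real.pi * J ^ 12 *
        (2 * U (0, 0) * U (0, 2) - 3 * U (0, 1) ^ 2) * ρ * k3
    · linear_combination J ^ 5 * k3
  · rintro ⟨k0, k1, k2, k3⟩
    have k3' : U (0, 3) = 12 * U (0, 0) * U (0, 1) := by
      refine mul_left_cancel₀ (pow_ne_zero 5 hJ0) ?_
      linear_combination k3
    refine ⟨right_ne_zero_of_mul k0, ?_, ?_, k3'⟩
    · refine mul_left_cancel₀ h12' ?_
      linear_combination k1
    · refine mul_left_cancel₀ h12' ?_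
      linear_combination k2 - 3 * Real.pi * J ^ 12 *
        (2 * U (0, 0) * U (0, 2) - 3 * U (0, 1) ^ 2) * ρ * k3'

/-- Substituting the transformation of jets, `D` acquires `J ^ 6` and the numerators of `scrI 2` and
`scrJ 2` acquire `J ^ 12`, all terms with `c` and `ρ` cancelling. The denominators `f s ^ 4 D`
acquire the same power because `s = J s'`. In the other three only the pure `z`-derivatives occur,
which scale by powers of `J`. -/
theorem jacobi_diffInvariants : IsJacobiDiffInvariant 2 (scrI 2) ∧ IsJacobiDiffInvariant 2 (scrJ 2) ∧
    IsJacobiDiffInvariant 2 scrL ∧ IsJacobiDiffInvariant 2 scrM ∧ IsJacobiDiffInvariant 2 scrN := by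
  suffices ∀ (g : SL(2, ℝ)) (l m : ℝ) (f F : ℂ × ℂ → ℂ) (x : ℂ × ℂ), IsJacobiTransform 2 g l m f F x →
      f x ≠ 0 → scrD 2 (jetAt f x) ≠ 0 → ∀ s : ℂ, s ^ 2 = f x → ∀ s' u U,
      s' = ((g 1 0 : ℂ) * x.1 + (g 1 1 : ℂ)) * s → u = jetAt f x →
      U = jetAt F (jacobiMap (g 0 0) (g 0 1) (g 1 0) (g 1 1) l m x) →
      scrI 2 s' U = scrI 2 s u ∧ scrJ 2 s' U = scrJ 2 s u ∧ scrL s' U = scrL s u ∧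
      scrM s' U = scrM s u ∧ scrN s' U = scrN s u by
    refine ⟨?_, ?_, ?_, ?_, ?_⟩ <;> intro g l m f F x h hf hD s hs
    exacts [(this g l m f F x h hf hD s hs _ _ _ rfl rfl rfl).1,
      (this g l m f F x h hf hD s hs _ _ _ rfl rfl rfl).2.1,
      (this g l m f F x h hf hD s hs _ _ _ rfl rfl rfl).2.2.1,
      (this g l m f F x h hf hD s hs _ _ _ rfl rfl rfl).2.2.2.1,
      (this g l m f F x h hf hD s hs _ _ _ rfl rfl rfl).2.2.2.2]
  intro g l m f F x h hf hD s hs s' u U hs' hu hU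
  have hj := h.defined
  obtain ⟨J, c, ρ, hJ, hjet⟩ := h.jets
  have hJ0 : J ≠ 0 := hJ ▸ inv_ne_zero hj
  obtain ⟨h00, h01, h02, h03, h10, h11, h12, h20⟩ := hjet u U hu hU
  have hfu : f x = u (0, 0) := by rw [hu]; rfl
  rw [← hu] at hD
  rw [hfu] at hf hs
  have hss : s = J * s' := by rw [hs', hJ, inv_mul_cancel_left₀ hj]
  have hDD : scrD 2 u = J ^ 6 * scrD 2 U := by
    rw [scrD, scrD, h00, h01, h02]; ring
  have hD0 : scrD 2 U ≠ 0 := right_ne_zero_of_mul (hDD ▸ hD)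
  have hU0 : U (0, 0) ≠ 0 := right_ne_zero_of_mul (h00 ▸ hf)
  have hs0 : s' ≠ 0 := by
    rintro rfl
    rw [hss] at hs
    exact hf (by rw [← hs]; simp)
  have hDU : scrD 2 U = 2 * U (0, 0) * U (0, 2) - 3 * U (0, 1) ^ 2 := by
    simp only [scrD]; push_cast; ring
  refine ⟨?_, ?_, ?_, ?_, ?_⟩
  · rw [scrI, scrI, hDD, h00, h01, h02, h10, h11, h20, hss,
      div_eq_div_iff (by simp [hD0, hU0, hs0]) (by simp [hJ0, hD0, hU0, hs0]),
      hDU]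
    push_cast
    ring
  · rw [scrJ, scrJ, hDD, h00, h01, h02, h03, h10, h11, h12, hss,
      div_eq_div_iff (by simp [hD0, hU0, hs0]) (by simp [hJ0, hD0, hU0, hs0]), hDU]
    push_cast
    ring
  · rw [scrL, scrL, h00, h01, hss]
    field_simp
  · rw [scrM, scrM, h00, h02, hss]
    field_simp
  · rw [scrN, scrN, h00, h03, hss]
    field_simp

/-! ### Separately holomorphic continuous functions are analytic -/

/-- The integral over a circle, as a functional on the continuous functions on the circle. -/
def circleFunctional (b : ℂ) (R : ℝ) (hR : 0 ≤ R) : C(Metric.sphere b R, ℂ) →L[ℂ] ℂ :=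
  LinearMap.mkContinuous
    { toFun := fun h => ∫ θ in (0 : ℝ)..2 * Real.pi,
        deriv (circleMap b R) θ * h ⟨circleMap b R θ, circleMap_mem_sphere b hR θ⟩
      map_add' := fun h₁ h₂ => by
        simp only [ContinuousMap.add_apply, mul_add]
        exact intervalIntegral.integral_add (Continuous.intervalIntegrable (by simp; fun_prop) _ _)
          (Continuous.intervalIntegrable (by simp; fun_prop) _ _)
      map_smul' := fun c h => by
        simp only [ContinuousMap.smul_apply, smul_eq_mul, RingHom.id_apply]
        rw [← intervalIntegral.integral_const_mul]
        exact intervalIntegral.integral_congr fun θ _ => by ring }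
    (R * |2 * Real.pi - 0|) fun h => by
      refine (intervalIntegral.norm_integral_le_of_norm_le_const (C := R * ‖h‖) fun θ _ => ?_).trans
        (le_of_eq (by ring))
      rw [norm_mul]
      refine mul_le_mul (by simp [abs_of_nonneg hR]) (h.norm_coe_le_norm _) (norm_nonneg _) hR

/-- Osgood's lemma in two variables. -/
theorem analyticOnNhd_of_separately {U : Set (ℂ × ℂ)} (hU : IsOpen U) {f : ℂ × ℂ → ℂ}
    (hf : ContinuousOn f U) (h₁ : ∀ x ∈ U, DifferentiableAt ℂ (fun t => f (t, x.2)) x.1)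
    (h₂ : ∀ x ∈ U, DifferentiableAt ℂ (fun w => f (x.1, w)) x.2) : AnalyticOnNhd ℂ f U := by
  rintro ⟨a, b⟩ hab
  obtain ⟨R', hR', hsub'⟩ := Metric.isOpen_iff.1 hU (a, b) hab
  obtain ⟨R, hR, hRR'⟩ : ∃ R : ℝ, 0 < R ∧ R < R' := ⟨R' / 2, by linarith, by linarith⟩
  have hsub : ∀ x y, x ∈ Metric.closedBall a R → y ∈ Metric.closedBall b R → (x, y) ∈ U := by
    intro x y hx hy
    apply hsub'
    rw [Metric.mem_ball, Prod.dist_eq, max_lt_iff]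
    exact ⟨(Metric.mem_closedBall.1 hx).trans_lt hRR', (Metric.mem_closedBall.1 hy).trans_lt hRR'⟩
  let K := Metric.sphere b R
  let F : C(Metric.closedBall a R × K, ℂ) := ⟨fun p => f (p.1, p.2), by
    refine hf.comp_continuous (by fun_prop) fun p => hsub _ _ p.1.2 (Metric.sphere_subset_closedBall p.2.2)⟩
  classical
  -- The slice `ξ ↦ f(ξ, ·)` regarded as a map into the Banach algebra of continuous functions on
  -- the circle `K`. Continuity of `f` on the product makes it continuous; the value off the disc is
  -- irrelevant.
  let G : ℂ → C(K, ℂ) := fun ξ => if h : ξ ∈ Metric.closedBall a R then F.curry ⟨ξ, h⟩ else 0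
  have hG : ContinuousOn G (Metric.closedBall a R) := by
    rw [continuousOn_iff_continuous_domRestrict]
    convert F.curry.continuous using 1
    funext ξ
    exact dif_pos ξ.2
  have hGapp : ∀ ξ ∈ Metric.closedBall a R, ∀ η : K, G ξ η = f (ξ, η) := by
    intro ξ hξ η
    simp only [G, dif_pos hξ]
    rfl
  -- Cauchy's integral of a continuous function with values in `C(K, ℂ)` is analytic. By the
  -- one-variable Cauchy formula at each `η ∈ K` it reproduces `f(x, η)`.
  let H : ℂ → C(K, ℂ) := fun x => (2 * Real.pi * Complex.I : ℂ)⁻¹ • ∮ ξ in C(a, R), (ξ - x)⁻¹ • G ξ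
  have hint : CircleIntegrable G a R :=
    (hG.mono Metric.sphere_subset_closedBall).circleIntegrable hR.le
  have hH : AnalyticAt ℂ H a := by
    have := hasFPowerSeriesOn_cauchy_integral (f := G) (c := a) (R := ⟨R, hR.le⟩) hint hR
    exact this.analyticAt
  have hHapp : ∀ x ∈ Metric.ball a R, ∀ η : K, H x η = f (x, η) := by
    intro x hx η
    have hη : (η : ℂ) ∈ Metric.closedBall b R := Metric.sphere_subset_closedBall η.2
    have h1 : (∮ ξ in C(a, R), (ξ - x)⁻¹ • G ξ) η = ∮ ξ in C(a, R), (ξ - x)⁻¹ • G ξ η := by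
      have hci : CircleIntegrable (fun ξ => (ξ - x)⁻¹ • G ξ) a R := by
        refine ContinuousOn.circleIntegrable hR.le ?_
        refine ContinuousOn.smul (ContinuousOn.inv₀ (f := fun ξ => ξ - x) (by fun_prop) fun ξ hξ => ?_)
          (hG.mono Metric.sphere_subset_closedBall)
        rintro h0
        rw [sub_eq_zero] at h0
        rw [Metric.mem_sphere, h0] at hξ
        rw [Metric.mem_ball] at hx
        linarith
      have := (ContinuousMap.evalCLM ℂ η : C(K, ℂ) →L[ℂ] ℂ).intervalIntegral_comp_comm hci.out
      exact this.symm
    change (2 * Real.pi * Complex.I : ℂ)⁻¹ • (∮ ξ in C(a, R), (ξ - x)⁻¹ • G ξ) η = _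
    rw [h1, circleIntegral.integral_congr hR.le (g := fun ξ => (ξ - x)⁻¹ • f (ξ, η))
      fun ξ hξ => by simp only; rw [hGapp ξ (Metric.sphere_subset_closedBall hξ)]]
    refine DiffContOnCl.two_pi_i_inv_smul_circleIntegral_sub_inv_smul
      (f := fun ξ => f (ξ, (η : ℂ))) ?_ hx
    refine DifferentiableOn.diffContOnCl fun ξ hξ => ?_
    rw [closure_ball a hR.ne'] at hξ
    exact (h₁ (ξ, η) (hsub _ _ hξ hη)).differentiableWithinAt
  let ι : C(K, ℂ) := ⟨fun η => η, continuous_subtype_val⟩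
  -- The Cauchy kernel `η ↦ 1/(η - y)` as an element of `C(K, ℂ)`. It is analytic in `y` because
  -- inversion in a Banach algebra is analytic at units.
  let k : ℂ → C(K, ℂ) := fun y => Ring.inverse (ι - algebraMap ℂ C(K, ℂ) y)
  have hunit : ∀ y ∈ Metric.ball b R, IsUnit (ι - algebraMap ℂ C(K, ℂ) y) := by
    intro y hy
    rw [ContinuousMap.isUnit_iff_forall_ne_zero]
    intro η h0
    have h0' : (η : ℂ) - y = 0 := by simpa [ι] using h0
    rw [sub_eq_zero] at h0'
    have := η.2
    rw [Metric.mem_sphere, h0'] at this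
    rw [Metric.mem_ball] at hy
    linarith
  have hk : AnalyticAt ℂ k b := by
    obtain ⟨v, hv⟩ := hunit b (Metric.mem_ball_self hR)
    have h1 : AnalyticAt ℂ Ring.inverse (ι - algebraMap ℂ C(K, ℂ) b) := hv ▸ analyticAt_inverse v
    refine AnalyticAt.comp (f := fun y => ι - algebraMap ℂ C(K, ℂ) y) h1 ?_
    exact analyticAt_const.sub ((Algebra.linearMap ℂ C(K, ℂ)).toContinuousLinearMap.analyticAt b)
  have hkapp : ∀ y ∈ Metric.ball b R, ∀ η : K, k y η = ((η : ℂ) - y)⁻¹ := by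
    intro y hy η
    have := congrArg (fun h : C(K, ℂ) => h η) (Ring.inverse_mul_cancel _ (hunit y hy))
    refine eq_inv_of_mul_eq_one_left ?_
    simpa [ι] using this
  -- Cauchy's formula in the second variable writes `f(x, y)` as a continuous linear functional of
  -- the product of `k y` and `H x`; joint analyticity follows from that of the two factors.
  have key : f =ᶠ[𝓝 (a, b)] fun p => (2 * Real.pi * Complex.I : ℂ)⁻¹ *
      circleFunctional b R hR.le (k p.2 * H p.1) := by
    filter_upwards [prod_mem_nhds (Metric.ball_mem_nhds a hR) (Metric.ball_mem_nhds b hR)]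
    rintro ⟨x, y⟩ ⟨hx, hy⟩
    have h3 := DiffContOnCl.two_pi_i_inv_smul_circleIntegral_sub_inv_smul
      (f := fun η => f (x, η)) (c := b) (R := R) (w := y) ?_ hy
    · rw [← h3, smul_eq_mul]
      congr 1
      rw [circleIntegral, circleFunctional]
      refine intervalIntegral.integral_congr fun θ _ => ?_
      simp only [smul_eq_mul, ContinuousMap.mul_apply]
      rw [hkapp y hy, hHapp x hx]
    · refine DifferentiableOn.diffContOnCl fun η hη => ?_
      rw [closure_ball b hR.ne'] at hη
      exact (h₂ (x, η) (hsub _ _ (Metric.ball_subset_closedBall hx) hη)).differentiableWithinAt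
  refine AnalyticAt.congr ?_ key.symm
  have hH' : AnalyticAt ℂ (fun p : ℂ × ℂ => H p.1) (a, b) := hH.comp_of_eq analyticAt_fst rfl
  have hk' : AnalyticAt ℂ (fun p : ℂ × ℂ => k p.2) (a, b) := hk.comp_of_eq analyticAt_snd rfl
  exact analyticAt_const.mul (((circleFunctional b R hR.le).analyticAt _).comp (hk'.mul hH'))

/-- A normally convergent series of functions of two variables, analytic on an open set, is analytic
there. -/
theorem analyticOnNhd_tsum {ι : Type*} {U : Set (ℂ × ℂ)} (hU : IsOpen U) {f : ι → ℂ × ℂ → ℂ}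
    (hf : ∀ i, DifferentiableOn ℂ (f i) U)
    {u : ι → ℝ} (hu : Summable u) (hfu : ∀ i, ∀ x ∈ U, ‖f i x‖ ≤ u i) :
    AnalyticOnNhd ℂ (fun x => ∑' i, f i x) U := by
  refine analyticOnNhd_of_separately hU
    (continuousOn_tsum (fun i => (hf i).continuousOn) hu fun i x hx => hfu i x hx) ?_ ?_
  · intro x hx
    have hV : IsOpen {t : ℂ | (t, x.2) ∈ U} := hU.preimage (by fun_prop)
    refine (Complex.differentiableOn_tsum_of_summable_norm hu (F := fun i t => f i (t, x.2))
      (U := {t : ℂ | (t, x.2) ∈ U}) (fun i => ?_) hV fun i t ht => hfu i _ ht).differentiableAt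
      (hV.mem_nhds hx)
    exact (hf i).comp (f := fun t => (t, x.2)) (by fun_prop) fun t ht => ht
  · intro x hx
    have hV : IsOpen {w : ℂ | (x.1, w) ∈ U} := hU.preimage (by fun_prop)
    refine (Complex.differentiableOn_tsum_of_summable_norm hu (F := fun i w => f i (x.1, w))
      (U := {w : ℂ | (x.1, w) ∈ U}) (fun i => ?_) hV fun i w hw => hfu i _ hw).differentiableAt
      (hV.mem_nhds hx)
    exact (hf i).comp (f := fun w => (x.1, w)) (by fun_prop) fun t ht => ht

/-! ### The quasi-periodic function `ζ(z) - G₂ z` as a Lambert series -/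

/-- `e^(2πiw)`. -/
def expI (w : ℂ) : ℂ := Complex.exp (2 * Real.pi * Complex.I * w)

theorem expI_add (v w : ℂ) : expI (v + w) = expI v * expI w := by
  rw [expI, mul_add, Complex.exp_add]; rfl

theorem expI_neg (w : ℂ) : expI (-w) = (expI w)⁻¹ := by
  rw [expI, mul_neg, Complex.exp_neg]; rfl

theorem expI_ne_zero (w : ℂ) : expI w ≠ 0 := Complex.exp_ne_zero _

theorem norm_expI (w : ℂ) : ‖expI w‖ = Real.exp (-(2 * Real.pi * w.im)) := by
  rw [expI, Complex.norm_exp]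
  simp

theorem expI_eq_one_iff {w : ℂ} : expI w = 1 ↔ ∃ n : ℤ, w = n := by
  rw [expI, Complex.exp_eq_one_iff]
  refine exists_congr fun n => ?_
  rw [mul_comm (n : ℂ)]
  exact mul_right_inj' Complex.two_pi_I_ne_zero

theorem differentiable_expI : Differentiable ℂ expI := by
  unfold expI; fun_prop

theorem expI_add_one (w : ℂ) : expI (w + 1) = expI w := by
  rw [expI_add, (expI_eq_one_iff (w := 1)).2 ⟨1, by simp⟩, mul_one]

/-- The function `u / (1 - u)`. -/
def geomFrac (u : ℂ) : ℂ := u / (1 - u)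

theorem geomFrac_inv {u : ℂ} (hu : u ≠ 0) (hu1 : u ≠ 1) : geomFrac u⁻¹ = -(1 + geomFrac u) := by
  have h1 : 1 - u ≠ 0 := sub_ne_zero.2 hu1.symm
  have h2 : 1 - u⁻¹ ≠ 0 := by
    rw [sub_ne_zero]
    exact fun h => hu1 (inv_eq_one.1 h.symm)
  have h3 : u - 1 ≠ 0 := sub_ne_zero.2 hu1
  rw [geomFrac, geomFrac]
  field_simp
  ring

theorem norm_geomFrac_le {u : ℂ} {κ : ℝ} (hκ : κ < 1) (hu : ‖u‖ ≤ κ) :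
    ‖geomFrac u‖ ≤ ‖u‖ / (1 - κ) := by
  rw [geomFrac, norm_div]
  refine div_le_div_of_nonneg_left (norm_nonneg _) (by linarith) ?_
  have := norm_sub_norm_le 1 u
  rw [norm_one] at this
  linarith

/-- The terms of the Lambert series of `lambertSum`. -/
def lambertTerm (n : ℕ) (x : ℂ × ℂ) : ℂ :=
  geomFrac (expI ((n + 1) * x.1 + x.2)) - geomFrac (expI ((n + 1) * x.1 - x.2))

/-- The Lambert series `∑ (q^n ζ / (1 - q^n ζ) - q^n ζ⁻¹ / (1 - q^n ζ⁻¹))` over `n ≥ 1`. -/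
def lambertSum (x : ℂ × ℂ) : ℂ := ∑' n : ℕ, lambertTerm n x

/-- The function with simple poles at the points of `ℤ + ℤτ`, of period `1` in `z` and with
`f(z + τ) = f(z) - 2πi`. -/
def jacobiZeta (x : ℂ × ℂ) : ℂ :=
  -(Real.pi * Complex.I) * (1 + 2 * geomFrac (expI x.2)) - 2 * Real.pi * Complex.I * lambertSum x

/-- No condition on `w` is needed: `q^n e(w)` tends to zero geometrically, so only finitely many
terms can have modulus above `1/2`, and a term at a pole has the value `0`. -/
theorem summable_geomFrac {τ : ℂ} (hτ : 0 < τ.im) (w : ℂ) :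
    Summable fun n : ℕ => geomFrac (expI (n * τ + w)) := by
  have hr : ‖expI τ‖ < 1 := by
    rw [norm_expI, Real.exp_lt_one_iff]
    have := mul_pos Real.two_pi_pos hτ
    linarith
  have hn : ∀ n : ℕ, ‖expI (n * τ + w)‖ = ‖expI w‖ * ‖expI τ‖ ^ n := by
    intro n
    rw [norm_expI, norm_expI, norm_expI, ← Real.exp_nat_mul, ← Real.exp_add]
    congr 1
    simp
    ring
  have ht : Filter.Tendsto (fun n : ℕ => ‖expI (n * τ + w)‖) Filter.atTop (𝓝 0) := by
    simp only [hn]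
    simpa using (tendsto_pow_atTop_nhds_zero_of_lt_one (norm_nonneg _) hr).const_mul ‖expI w‖
  refine Summable.of_norm_bounded_eventually_nat (g := fun n => 2 * ‖expI w‖ * ‖expI τ‖ ^ n)
    ((summable_geometric_of_lt_one (norm_nonneg _) hr).mul_left _) ?_
  filter_upwards [ht.eventually (ge_mem_nhds (by norm_num : (0 : ℝ) < 1 / 2))] with n h
  refine (norm_geomFrac_le (by norm_num) h).trans (le_of_eq ?_)
  rw [hn]
  ring

theorem summable_geomFrac_succ {τ : ℂ} (hτ : 0 < τ.im) (w : ℂ) :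
    Summable fun n : ℕ => geomFrac (expI ((n + 1) * τ + w)) := by
  simpa using (summable_nat_add_iff 1).2 (summable_geomFrac hτ w)

theorem lambertSum_eq {x : ℂ × ℂ} (hx : 0 < x.1.im) : lambertSum x =
    ∑' n : ℕ, geomFrac (expI ((n + 1) * x.1 + x.2))
      - ∑' n : ℕ, geomFrac (expI ((n + 1) * x.1 + -x.2)) := by
  simp only [lambertSum, lambertTerm, sub_eq_add_neg _ x.2]
  exact (summable_geomFrac_succ hx _).tsum_sub (summable_geomFrac_succ hx _)

theorem jacobiZeta_add_one (t w : ℂ) : jacobiZeta (t, w + 1) = jacobiZeta (t, w) := by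
  have h : ∀ v, expI (v - (w + 1)) = expI (v - w) := fun v => by
    rw [← expI_add_one (v - (w + 1))]
    congr 1
    ring
  simp only [jacobiZeta, lambertSum, lambertTerm, expI_add_one, ← add_assoc, h]

theorem jacobiZeta_neg {t w : ℂ} (ht : 0 < t.im) (hw : expI w ≠ 1) :
    jacobiZeta (t, -w) = -jacobiZeta (t, w) := by
  rw [jacobiZeta, jacobiZeta, lambertSum_eq (by exact ht), lambertSum_eq (by exact ht)]
  simp only [neg_neg, expI_neg]
  rw [geomFrac_inv (expI_ne_zero _) hw]
  ring

/-- Translation by `τ` shifts both Lambert series by one index: one loses its first term, which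
cancels against the new isolated term, and the other gains the term at `e(-w)`. Inverting `e(-w)` by
`geomFrac_inv` restores the isolated term and leaves `-2πi`. -/
theorem jacobiZeta_add_tau {t w : ℂ} (ht : 0 < t.im) (hw : expI w ≠ 1) :
    jacobiZeta (t, w + t) = jacobiZeta (t, w) - 2 * Real.pi * Complex.I := by
  rw [jacobiZeta, jacobiZeta, lambertSum_eq (by exact ht), lambertSum_eq (by exact ht)]
  have h1 : ∑' n : ℕ, geomFrac (expI ((n + 1) * t + w)) =
      geomFrac (expI (w + t)) + ∑' n : ℕ, geomFrac (expI ((n + 1) * t + (w + t))) := by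
    rw [(summable_geomFrac_succ ht w).tsum_eq_zero_add]
    congr 1
    · congr 2
      push_cast
      ring
    · refine tsum_congr fun n => ?_
      congr 2
      push_cast
      ring
  have h2 : ∑' n : ℕ, geomFrac (expI ((n + 1) * t + -(w + t))) =
      geomFrac (expI (-w)) + ∑' n : ℕ, geomFrac (expI ((n + 1) * t + -w)) := by
    rw [(summable_geomFrac_succ ht (-(w + t))).tsum_eq_zero_add]
    congr 1
    · congr 2
      push_cast
      ring
    · refine tsum_congr fun n => ?_
      congr 2
      push_cast
      ring
  simp only
  rw [h1, h2, expI_neg, geomFrac_inv (expI_ne_zero _) hw]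
  ring

/-! ### Domains -/

/-- The points `(τ, z)` with `Im τ > 0` and `z` off the lattice `ℤ + ℤτ`. -/
def latticeCompl : Set (ℂ × ℂ) := {x | 0 < x.1.im ∧ ∀ m n : ℤ, x.2 ≠ m + n * x.1}

/-- The strip `|Im z| < Im τ`. -/
def strip : Set (ℂ × ℂ) := {x | |x.2.im| < x.1.im}

theorem isOpen_strip : IsOpen strip :=
  isOpen_lt (by fun_prop) (by fun_prop)

/-- The real coordinates of `z` in the basis `1, τ` depend continuously on `(τ, z)`, and the lattice
points are the preimage of the closed set `ℤ × ℤ`. -/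
theorem isOpen_latticeCompl : IsOpen latticeCompl := by
  have hH : IsOpen {x : ℂ × ℂ | 0 < x.1.im} := isOpen_lt (by fun_prop) (by fun_prop)
  let c : ℂ × ℂ → ℝ × ℝ := fun x => (x.2.im / x.1.im, x.2.re - x.2.im / x.1.im * x.1.re)
  have hc : ContinuousOn c {x : ℂ × ℂ | 0 < x.1.im} := by
    have h0 : ∀ x ∈ {x : ℂ × ℂ | 0 < x.1.im}, x.1.im ≠ 0 := fun x hx => ne_of_gt hx
    fun_prop (disch := assumption)
  have hZ : IsClosed (Set.range ((↑) : ℤ → ℝ) ×ˢ Set.range ((↑) : ℤ → ℝ)) :=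
    Int.isClosedEmbedding_coe_real.isClosed_range.prod Int.isClosedEmbedding_coe_real.isClosed_range
  convert hc.isOpen_inter_preimage hH hZ.isOpen_compl using 1
  ext x
  simp only [latticeCompl, Set.mem_ofPred_eq, Set.mem_inter_iff, Set.mem_preimage, Set.mem_compl_iff,
    Set.mem_prod, Set.mem_range]
  refine and_congr_right fun hx => ?_
  constructor
  · rintro h ⟨⟨n, hn⟩, ⟨m, hm⟩⟩
    refine h m n ?_
    simp only [c] at hn hm
    rw [← hn] at hm
    rw [eq_div_iff hx.ne'] at hn
    apply Complex.ext
    · simp; linarith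
    · simp; linarith
  · rintro h m n hmn
    refine h ⟨⟨n, ?_⟩, ⟨m, ?_⟩⟩
    · simp [c, hmn, hx.ne']
    · simp [c, hmn, hx.ne']

theorem latticeCompl_expI_ne_one {x : ℂ × ℂ} (hx : x ∈ latticeCompl) : expI x.2 ≠ 1 := by
  intro h
  obtain ⟨n, hn⟩ := expI_eq_one_iff.1 h
  exact hx.2 n 0 (by simpa using hn)

theorem latticeCompl_add {t w : ℂ} (h : (t, w) ∈ latticeCompl) (m n : ℤ) :
    (t, w + m + n * t) ∈ latticeCompl := by
  refine ⟨h.1, fun m' n' hmn => h.2 (m' - m) (n' - n) ?_⟩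
  simp only at hmn ⊢
  push_cast
  linear_combination hmn

theorem latticeCompl_neg {t w : ℂ} (h : (t, w) ∈ latticeCompl) : (t, -w) ∈ latticeCompl := by
  refine ⟨h.1, fun m' n' hmn => h.2 (-m') (-n') ?_⟩
  simp only at hmn ⊢
  push_cast
  linear_combination -hmn

theorem jacobiZeta_add_lattice {t w : ℂ} (h : (t, w) ∈ latticeCompl) (n : ℤ) :
    jacobiZeta (t, w + n * t) = jacobiZeta (t, w) - n * (2 * Real.pi * Complex.I) := by
  induction n using Int.induction_on with
  | zero => simp
  | succ n ih =>
    have hm := latticeCompl_add h 0 n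
    have := jacobiZeta_add_tau h.1 (latticeCompl_expI_ne_one hm)
    push_cast at this ih ⊢
    rw [add_zero] at this
    rw [show w + ((n : ℂ) + 1) * t = w + n * t + t by ring, this, ih]
    ring
  | pred n ih =>
    have hm := latticeCompl_add h 0 (-n - 1)
    have := jacobiZeta_add_tau h.1 (latticeCompl_expI_ne_one hm)
    push_cast at this ih ⊢
    rw [add_zero, show w + (-(n : ℂ) - 1) * t + t = w + -n * t by ring, ih] at this
    linear_combination -this

/-- Choose `|Im z| < s < t < Im τ`. On the neighbourhood so described `Im ((n+1)τ ± z) ≥ (t - s) + n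
t`, hence the exponentials are bounded by `κ r^n` with `κ, r < 1`. The series converges normally and
no denominator vanishes. -/
theorem analyticOnNhd_lambertSum : AnalyticOnNhd ℂ lambertSum strip := by
  intro x hx
  obtain ⟨s, hs1, hs2⟩ := exists_between (show |x.2.im| < x.1.im from hx)
  obtain ⟨t, ht1, ht2⟩ := exists_between hs2
  let U : Set (ℂ × ℂ) := {y | |y.2.im| < s} ∩ {y | t < y.1.im}
  have hU : IsOpen U := (isOpen_lt (by fun_prop) (by fun_prop)).inter
    (isOpen_lt (by fun_prop) (by fun_prop))
  have hs0 : 0 < s := (abs_nonneg _).trans_lt hs1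
  have h2pi := Real.two_pi_pos
  set κ := Real.exp (-(2 * Real.pi * (t - s))) with hκ
  set r := Real.exp (-(2 * Real.pi * t)) with hr
  have hκ1 : κ < 1 := by
    rw [hκ, Real.exp_lt_one_iff]
    have := mul_pos h2pi (sub_pos.2 ht1)
    linarith
  have hr1 : r < 1 := by
    rw [hr, Real.exp_lt_one_iff]
    have := mul_pos h2pi (hs0.trans ht1)
    linarith
  have hbound : ∀ (n : ℕ) (v : ℂ), (n + 1) * t - s ≤ v.im → ‖expI v‖ ≤ κ * r ^ n := by
    intro n v hv
    rw [norm_expI, hκ, hr, ← Real.exp_nat_mul, ← Real.exp_add, Real.exp_le_exp]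
    have := mul_le_mul_of_nonneg_left hv h2pi.le
    linarith
  have him : ∀ (n : ℕ) (y : ℂ × ℂ), y ∈ U → (n + 1) * t - s ≤ ((n + 1) * y.1 + y.2).im ∧
      (n + 1) * t - s ≤ ((n + 1) * y.1 - y.2).im := by
    rintro n y ⟨h1, h2⟩
    rw [Set.mem_ofPred_eq, abs_lt] at h1
    rw [Set.mem_ofPred_eq] at h2
    have h3 : ((n : ℝ) + 1) * t ≤ (n + 1) * y.1.im :=
      mul_le_mul_of_nonneg_left h2.le (by positivity)
    constructor <;> simp <;> linarith
  have hκr : ∀ n : ℕ, κ * r ^ n ≤ κ := fun n =>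
    mul_le_of_le_one_right (Real.exp_pos _).le (pow_le_one₀ (Real.exp_pos _).le hr1.le)
  have hterm : ∀ (n : ℕ) (v : ℂ), (n + 1) * t - s ≤ v.im →
      ‖geomFrac (expI v)‖ ≤ κ * r ^ n / (1 - κ) := by
    intro n v hv
    have h1 := hbound n v hv
    refine (norm_geomFrac_le hκ1 (h1.trans (hκr n))).trans ?_
    exact div_le_div_of_nonneg_right h1 (by linarith)
  have hne : ∀ (n : ℕ) (v : ℂ), (n + 1) * t - s ≤ v.im → 1 - expI v ≠ 0 := by
    intro n v hv h0
    have h1 := (hbound n v hv).trans (hκr n)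
    rw [← sub_eq_zero.1 h0, norm_one] at h1
    linarith
  refine analyticOnNhd_tsum hU (f := lambertTerm) (fun n => ?_)
    (u := fun n => κ * r ^ n / (1 - κ) + κ * r ^ n / (1 - κ)) ?_ (fun n y hy => ?_) x ⟨hs1, ht2⟩
  · intro y hy
    have h1 := hne n _ (him n y hy).1
    have h2 := hne n _ (him n y hy).2
    have hd := differentiable_expI
    refine DifferentiableAt.differentiableWithinAt ?_
    unfold lambertTerm geomFrac
    fun_prop (disch := assumption)
  · have := ((summable_geometric_of_lt_one (Real.exp_pos _).le hr1).mul_left κ).div_const (1 - κ)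
    exact this.add this
  · exact (norm_sub_le _ _).trans (add_le_add (hterm n _ (him n y hy).1) (hterm n _ (him n y hy).2))

theorem analyticAt_expI (w : ℂ) : AnalyticAt ℂ expI w :=
  differentiable_expI.analyticAt w

theorem analyticAt_jacobiZeta_strip {x : ℂ × ℂ} (hx : x ∈ strip) (h1 : expI x.2 ≠ 1) :
    AnalyticAt ℂ jacobiZeta x := by
  have hN := analyticOnNhd_lambertSum x hx
  have hE : AnalyticAt ℂ (fun y : ℂ × ℂ => expI y.2) x := (analyticAt_expI _).comp analyticAt_snd
  have h2 : 1 - expI x.2 ≠ 0 := sub_ne_zero.2 h1.symm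
  unfold jacobiZeta geomFrac
  fun_prop (disch := assumption)

theorem exists_add_mem_strip {x : ℂ × ℂ} (hx : 0 < x.1.im) : ∃ n : ℤ, (x.1, x.2 + n * x.1) ∈ strip := by
  refine ⟨-round (x.2.im / x.1.im), ?_⟩
  have h := abs_sub_round (x.2.im / x.1.im)
  have h2 : |x.2.im - round (x.2.im / x.1.im) * x.1.im| ≤ 1 / 2 * x.1.im := by
    have := mul_le_mul_of_nonneg_right h hx.le
    rwa [← abs_of_pos hx, ← abs_mul, abs_of_pos hx, sub_mul, div_mul_cancel₀ _ hx.ne'] at this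
  simp only [strip, Set.mem_ofPred_eq]
  refine lt_of_le_of_lt (le_trans (le_of_eq ?_) h2) (by linarith)
  congr 1
  simp
  ring

/-- The Lambert series is controlled only in the strip. Quasi-periodicity carries analyticity from
there to all points off the lattice, with the translate `n` fixed near the given point. -/
theorem analyticOnNhd_jacobiZeta : AnalyticOnNhd ℂ jacobiZeta latticeCompl := by
  intro x hx
  obtain ⟨n, hn⟩ := exists_add_mem_strip hx.1
  have hx' : (x.1, x.2 + n * x.1) ∈ latticeCompl := by
    simpa using latticeCompl_add hx 0 n
  have h := analyticAt_jacobiZeta_strip hn (latticeCompl_expI_ne_one hx')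
  have h2 : AnalyticAt ℂ (fun y : ℂ × ℂ => jacobiZeta (y.1, y.2 + n * y.1)
      + n * (2 * Real.pi * Complex.I)) x := by
    refine AnalyticAt.add (AnalyticAt.comp (g := jacobiZeta) (f := fun y : ℂ × ℂ =>
      (y.1, y.2 + n * y.1)) h
      (analyticAt_fst.prod (analyticAt_snd.add (analyticAt_const.mul analyticAt_fst)))) analyticAt_const
  refine h2.congr ?_
  filter_upwards [isOpen_latticeCompl.mem_nhds hx] with y hy
  rw [jacobiZeta_add_lattice hy]
  ring

/-! ### Liouville's theorem for elliptic functions -/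

/-- Filling in the value `r 0` at all lattice points gives an entire function: near `0` it is `r`,
and near other lattice points it is a translate. Being periodic it is bounded, hence constant by
Liouville's theorem. -/
theorem PeriodPair.eq_of_periodic_of_regular (L : PeriodPair) {h r : ℂ → ℂ}
    (hd : DifferentiableOn ℂ h (L.lattice : Set ℂ)ᶜ)
    (hp : ∀ z ∉ L.lattice, ∀ l ∈ L.lattice, h (z + l) = h z)
    (hr : DifferentiableAt ℂ r 0) (hr0 : h =ᶠ[𝓝[≠] 0] r) {z : ℂ} (hz : z ∉ L.lattice) :
    h z = r 0 := by
  classical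
  let H : ℂ → ℂ := fun z => if z ∈ L.lattice then r 0 else h z
  have hper : ∀ z, ∀ l ∈ L.lattice, H (z + l) = H z := by
    intro z l hl
    have : z + l ∈ L.lattice ↔ z ∈ L.lattice := L.lattice.toAddSubgroup.add_mem_cancel_right hl
    simp only [H, this]
    split_ifs with h1
    · rfl
    · exact hp z h1 l hl
  have h0 : H =ᶠ[𝓝 0] r := by
    filter_upwards [L.compl_lattice_sdiff_singleton_mem_nhds 0,
      eventually_nhdsWithin_iff.1 hr0] with y hy hy'
    by_cases hy0 : y = 0
    · subst hy0
      simp [H, L.lattice.zero_mem]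
    · have : y ∉ L.lattice := fun hm => hy ⟨hm, hy0⟩
      simp only [H, this, if_false]
      exact hy' hy0
  have hH : Differentiable ℂ H := by
    intro y
    by_cases hy : y ∈ L.lattice
    · have h1 : H = fun w => H (w - y) := by
        funext w
        rw [sub_eq_add_neg, hper w _ (neg_mem hy)]
      rw [h1]
      refine DifferentiableAt.comp (g := H) y ?_ (by fun_prop)
      rw [sub_self]
      exact hr.congr_of_eventuallyEq h0
    · have ho := L.isClosed_lattice.isOpen_compl.mem_nhds hy
      refine (hd.differentiableAt ho).congr_of_eventuallyEq ?_
      filter_upwards [ho] with w hw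
      exact if_neg hw
  have := hH.apply_eq_apply_of_bounded (IsZLattice.isCompact_range_of_periodic L.lattice _
    hH.continuous fun z w hw => hper z w hw).isBounded z 0
  simpa only [H, hz, if_false, L.lattice.zero_mem, if_true] using this

theorem mem_tauPair_lattice {τ : ℍ} {z : ℂ} :
    z ∈ (tauPair τ).lattice ↔ ∃ m n : ℤ, z = m + n * τ := by
  rw [PeriodPair.mem_lattice]
  simp [tauPair, eq_comm]

theorem mem_latticeCompl_iff {τ : ℍ} {z : ℂ} :
    ((τ : ℂ), z) ∈ latticeCompl ↔ z ∉ (tauPair τ).lattice := by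
  rw [mem_tauPair_lattice]
  simp [latticeCompl, τ.im_pos]

theorem wpFun_coe (τ : ℍ) (z : ℂ) : wpFun (τ, z) = (tauPair τ).weierstrassP z :=
  dif_pos τ.2

/-! ### The Laurent expansion of `jacobiZeta` at `z = 0` -/

/-- `z π cot(πz)`. -/
def mulCot (z : ℂ) : ℂ := Real.pi * Complex.I * (1 + expI z) / dslope expI 0 z

/-- `π cot(πz) - 1/z`. -/
def cotReg : ℂ → ℂ := dslope mulCot 0

theorem expI_zero : expI 0 = 1 := by simp [expI]

theorem dslope_expI_zero : dslope expI 0 0 = 2 * Real.pi * Complex.I := by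
  rw [dslope_same]
  have : HasDerivAt expI (expI 0 * (2 * Real.pi * Complex.I * 1)) 0 :=
    ((hasDerivAt_id (0 : ℂ)).const_mul (2 * Real.pi * Complex.I)).cexp
  rw [this.deriv, expI_zero]
  ring

theorem mulCot_zero : mulCot 0 = 1 := by
  rw [mulCot, dslope_expI_zero, expI_zero]
  have := Complex.two_pi_I_ne_zero
  field_simp
  norm_num

theorem AnalyticAt.dslope_self {f : ℂ → ℂ} {c : ℂ} (hf : AnalyticAt ℂ f c) :
    AnalyticAt ℂ (dslope f c) c := by
  obtain ⟨p, hp⟩ := hf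
  exact ⟨_, hp.has_fpower_series_dslope_fslope⟩

theorem analyticAt_mulCot : AnalyticAt ℂ mulCot 0 := by
  have h1 := (analyticAt_expI 0).dslope_self
  have h2 : dslope expI 0 0 ≠ 0 := by
    rw [dslope_expI_zero]
    exact Complex.two_pi_I_ne_zero
  have h3 := analyticAt_expI 0
  unfold mulCot
  fun_prop (disch := assumption)

/-- Evenness of `zπ cot(πz)` is what makes its first derivative at `0` vanish, so that `π cot(πz) -
1/z` has no constant term. -/
theorem mulCot_neg (z : ℂ) : mulCot (-z) = mulCot z := by
  rcases eq_or_ne z 0 with rfl | hz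
  · rw [neg_zero]
  rw [mulCot, mulCot, dslope_of_ne _ hz, dslope_of_ne _ (neg_ne_zero.2 hz), slope_def_field,
    slope_def_field, expI_neg, expI_zero]
  have h1 := expI_ne_zero z
  -- At a nonzero integer the slope in the denominator is `0`, and both sides are `0` by the
  -- convention for division by zero.
  rcases eq_or_ne (expI z) 1 with h | h
  · simp [h]
  have h2 : expI z - 1 ≠ 0 := sub_ne_zero.2 h
  have h3 : (expI z)⁻¹ - 1 ≠ 0 := by
    rw [sub_ne_zero]
    exact fun h' => h (inv_eq_one.1 h')
  have h4 : 1 - expI z ≠ 0 := sub_ne_zero.2 h.symm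
  field_simp
  ring

theorem analyticAt_cotReg : AnalyticAt ℂ cotReg 0 := analyticAt_mulCot.dslope_self

theorem cotReg_zero : cotReg 0 = 0 := by
  rw [cotReg, dslope_same]
  have h : deriv (fun z => mulCot (-z)) 0 = -deriv mulCot (-0) := deriv_comp_neg mulCot 0
  simp only [mulCot_neg, neg_zero] at h
  exact CharZero.eq_neg_self_iff.1 h

/-- The left side is `π cot(πz)`: it supplies the pole `1/z` of `jacobiZeta`, while the Lambert
series is regular at `z = 0`. -/
theorem mul_geomFrac_eq {z : ℂ} (hz : z ≠ 0) (h : expI z ≠ 1) :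
    -(Real.pi * Complex.I) * (1 + 2 * geomFrac (expI z)) = z⁻¹ + cotReg z := by
  have h2 : expI z - 1 ≠ 0 := sub_ne_zero.2 h
  have h4 : 1 - expI z ≠ 0 := sub_ne_zero.2 h.symm
  rw [cotReg, dslope_of_ne _ hz, slope_def_field, mulCot_zero, mulCot, dslope_of_ne _ hz,
    slope_def_field, expI_zero, geomFrac]
  field_simp
  ring

/-- The function `jacobiZeta (t, z) - 1/z`, for `z` near `0`. -/
def zetaReg (t z : ℂ) : ℂ := cotReg z - 2 * Real.pi * Complex.I * lambertSum (t, z)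

theorem analyticAt_slice {f : ℂ × ℂ → ℂ} {x : ℂ × ℂ} (h : AnalyticAt ℂ f x) :
    AnalyticAt ℂ (fun w => f (x.1, w)) x.2 :=
  AnalyticAt.comp (g := f) (f := fun w => (x.1, w)) h (analyticAt_const.prod analyticAt_id)

theorem zero_mem_strip {t : ℂ} (ht : 0 < t.im) : (t, (0 : ℂ)) ∈ strip := by
  simpa [strip] using ht

theorem analyticAt_zetaReg {t : ℂ} (ht : 0 < t.im) : AnalyticAt ℂ (zetaReg t) 0 :=
  analyticAt_cotReg.sub (analyticAt_const.mul
    (analyticAt_slice (analyticOnNhd_lambertSum _ (zero_mem_strip ht))))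

theorem zetaReg_zero (t : ℂ) : zetaReg t 0 = 0 := by
  simp [zetaReg, cotReg_zero, lambertSum, lambertTerm]

theorem eventually_mem_latticeCompl {t : ℂ} (ht : 0 < t.im) :
    ∀ᶠ z in 𝓝[≠] (0 : ℂ), (t, z) ∈ latticeCompl := by
  rw [eventually_nhdsWithin_iff]
  filter_upwards [(tauPair ⟨t, ht⟩).compl_lattice_sdiff_singleton_mem_nhds 0] with z hz hz0
  exact (mem_latticeCompl_iff (τ := ⟨t, ht⟩)).2 fun h => hz ⟨h, hz0⟩

theorem jacobiZeta_eventuallyEq {t : ℂ} (ht : 0 < t.im) :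
    (fun z => jacobiZeta (t, z)) =ᶠ[𝓝[≠] 0] fun z => z⁻¹ + zetaReg t z := by
  filter_upwards [eventually_mem_latticeCompl ht, self_mem_nhdsWithin] with z hz hz0
  rw [jacobiZeta, mul_geomFrac_eq hz0 (latticeCompl_expI_ne_one hz), zetaReg]
  ring

theorem partialz_jacobiZeta_eventuallyEq {t : ℂ} (ht : 0 < t.im) :
    (fun z => partialz jacobiZeta (t, z)) =ᶠ[𝓝[≠] 0] fun z => -(z ^ 2)⁻¹ + deriv (zetaReg t) z := by
  filter_upwards [(jacobiZeta_eventuallyEq ht).nhdsNE_deriv, self_mem_nhdsWithin,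
    nhdsWithin_le_nhds (analyticAt_zetaReg ht).eventually_analyticAt] with z hz hz0 ha
  refine hz.trans ?_
  exact ((hasDerivAt_inv hz0).add ha.differentiableAt.hasDerivAt).deriv

theorem wpFun_eventuallyEq {t : ℂ} (ht : 0 < t.im) (z : ℂ) :
    wpFun (t, z) = (z ^ 2)⁻¹ + (tauPair ⟨t, ht⟩).weierstrassPExcept 0 z := by
  have h := (tauPair ⟨t, ht⟩).weierstrassPExcept_add 0 z
  rw [← wpFun_coe] at h
  refine h.symm.trans ?_
  simp
  ring

/-! ### `℘` in terms of `jacobiZeta` -/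

/-- The difference of `-∂jacobiZeta/∂z` and `℘`. -/
def wpConst (t : ℂ) : ℂ := -deriv (zetaReg t) 0

theorem jacobiZeta_add_int_add_lattice {t w : ℂ} (h : (t, w) ∈ latticeCompl) (m n : ℤ) :
    jacobiZeta (t, w + m + n * t) = jacobiZeta (t, w) - n * (2 * Real.pi * Complex.I) := by
  rw [jacobiZeta_add_lattice (by simpa using latticeCompl_add h m 0)]
  congr 1
  clear h
  induction m using Int.induction_on generalizing w with
  | zero => simp
  | succ m ih =>
    rw [show w + ((m + 1 : ℤ) : ℂ) = w + (m : ℤ) + 1 by push_cast; ring, jacobiZeta_add_one, ih]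
  | pred m ih =>
    rw [← jacobiZeta_add_one, show w + ((-m - 1 : ℤ) : ℂ) + 1 = w + (-m : ℤ) by push_cast; ring, ih]

theorem eventually_slice_snd {s : Set (ℂ × ℂ)} (hs : IsOpen s) {t w : ℂ} (h : (t, w) ∈ s) :
    ∀ᶠ v in 𝓝 w, (t, v) ∈ s :=
  (Continuous.tendsto' (f := fun v : ℂ => (t, v)) (by fun_prop) w (t, w) rfl).eventually
    (hs.mem_nhds h)

theorem eventually_slice_fst {s : Set (ℂ × ℂ)} (hs : IsOpen s) {t w : ℂ} (h : (t, w) ∈ s) :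
    ∀ᶠ v in 𝓝 t, (v, w) ∈ s :=
  (Continuous.tendsto' (f := fun v : ℂ => (v, w)) (by fun_prop) t (t, w) rfl).eventually
    (hs.mem_nhds h)

theorem partialz_jacobiZeta_add_lattice {t w : ℂ} (h : (t, w) ∈ latticeCompl) (m n : ℤ) :
    partialz jacobiZeta (t, w + m + n * t) = partialz jacobiZeta (t, w) := by
  simp only [partialz]
  rw [add_assoc, ← deriv_comp_add_const]
  have : (fun v => jacobiZeta (t, v + (m + n * t))) =ᶠ[𝓝 w]
      fun v => jacobiZeta (t, v) - n * (2 * Real.pi * Complex.I) := by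
    filter_upwards [eventually_slice_snd isOpen_latticeCompl h] with v hv
    rw [← add_assoc, jacobiZeta_add_int_add_lattice hv]
  rw [this.deriv_eq, deriv_sub_const]

/-- Since `Z` changes by constants under periods, `Z_z + ℘` is elliptic, and the double poles
`∓1/z²` cancel at `0`. By Liouville's theorem it is constant in `z`; as `℘ - 1/z²` vanishes at `0`,
the constant is the derivative of `zetaReg` there. -/
theorem partialz_jacobiZeta {x : ℂ × ℂ} (hx : x ∈ latticeCompl) :
    partialz jacobiZeta x = -(wpFun x + wpConst x.1) := by
  obtain ⟨t, w⟩ := x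
  have ht : 0 < t.im := hx.1
  let τ : ℍ := ⟨t, ht⟩
  have hV : ∀ {z}, z ∉ (tauPair τ).lattice ↔ (t, z) ∈ latticeCompl :=
    (mem_latticeCompl_iff (τ := τ)).symm
  have hwp : ∀ z, wpFun (t, z) = (tauPair τ).weierstrassP z := wpFun_coe τ
  have key := (tauPair τ).eq_of_periodic_of_regular
    (h := fun z => partialz jacobiZeta (t, z) + wpFun (t, z))
    (r := fun z => deriv (zetaReg t) z + (tauPair τ).weierstrassPExcept 0 z) ?_ ?_ ?_ ?_ (hV.2 hx)
  · simp only [PeriodPair.weierstrassPExcept_zero] at key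
    simp only [wpConst]
    linear_combination key
  · simp only [hwp]
    refine DifferentiableOn.add (fun z hz => ?_) (tauPair τ).differentiableOn_weierstrassP
    have h2 := analyticOnNhd_jacobiZeta _ (hV.1 hz)
    exact (analyticAt_slice h2.partialz).differentiableAt.differentiableWithinAt
  · intro z hz l hl
    simp only [hwp]
    rw [(tauPair τ).weierstrassP_add_coe z ⟨l, hl⟩]
    obtain ⟨m, n, rfl⟩ := mem_tauPair_lattice.1 hl
    rw [← add_assoc, partialz_jacobiZeta_add_lattice (hV.1 hz)]
  · exact (analyticAt_zetaReg ht).deriv.differentiableAt.add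
      ((tauPair τ).analyticAt_weierstrassPExcept 0).differentiableAt
  · filter_upwards [partialz_jacobiZeta_eventuallyEq ht] with z hz
    rw [hz, wpFun_eventuallyEq ht]
    ring

theorem wpConst_eq {t : ℂ} (ht : 0 < t.im) :
    wpConst t = 2 * Real.pi * Complex.I * partialz lambertSum (t, 0) - deriv cotReg 0 := by
  have h2 := (analyticAt_slice (analyticOnNhd_lambertSum _ (zero_mem_strip ht))).differentiableAt
  have : HasDerivAt (zetaReg t) _ 0 := analyticAt_cotReg.differentiableAt.hasDerivAt.sub
    (h2.hasDerivAt.const_mul (2 * Real.pi * Complex.I))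
  rw [wpConst, this.deriv, partialz]
  ring

theorem analyticAt_slice_fst {f : ℂ × ℂ → ℂ} {x : ℂ × ℂ} (h : AnalyticAt ℂ f x) :
    AnalyticAt ℂ (fun t => f (t, x.2)) x.1 :=
  AnalyticAt.comp (g := f) (f := fun t => (t, x.2)) h (analyticAt_id.prod analyticAt_const)

theorem analyticAt_wpConst {t : ℂ} (ht : 0 < t.im) : AnalyticAt ℂ wpConst t := by
  have h1 := analyticAt_slice_fst (analyticOnNhd_lambertSum _ (zero_mem_strip ht)).partialz
  refine ((analyticAt_const.mul h1).sub analyticAt_const).congr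
    (f := fun s => 2 * Real.pi * Complex.I * partialz lambertSum (s, 0) - deriv cotReg 0) ?_
  filter_upwards [(isOpen_lt continuous_const Complex.continuous_im).mem_nhds ht] with s hs
  exact (wpConst_eq hs).symm

/-- Joint analyticity is inherited from `jacobiZeta`, which avoids estimating a lattice sum whose
lattice varies with `τ`. -/
theorem analyticOnNhd_wpFun : AnalyticOnNhd ℂ wpFun latticeCompl := by
  intro x hx
  refine ((analyticOnNhd_jacobiZeta x hx).partialz.neg.sub
    ((analyticAt_wpConst hx.1).comp analyticAt_fst)).congr ?_
  filter_upwards [isOpen_latticeCompl.mem_nhds hx] with y hy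
  simp only [Pi.sub_apply, Pi.neg_apply, Function.comp_apply, partialz_jacobiZeta hy]
  ring

/-! ### The heat equation -/

theorem partialτ_jacobiZeta (x : ℂ × ℂ) :
    partialτ jacobiZeta x = -(2 * Real.pi * Complex.I) * partialτ lambertSum x := by
  simp only [partialτ, jacobiZeta]
  rw [deriv_const_sub, deriv_const_mul_field, neg_mul]

theorem partialz_congr_of_mem {f g : ℂ × ℂ → ℂ} {s : Set (ℂ × ℂ)} (hs : IsOpen s)
    (h : ∀ x ∈ s, f x = g x) {x : ℂ × ℂ} (hx : x ∈ s) : partialz f x = partialz g x :=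
  (partialz_congr (Filter.eventuallyEq_of_mem (hs.mem_nhds hx) h)).eq_of_nhds

theorem partialτ_congr_of_mem {f g : ℂ × ℂ → ℂ} {s : Set (ℂ × ℂ)} (hs : IsOpen s)
    (h : ∀ x ∈ s, f x = g x) {x : ℂ × ℂ} (hx : x ∈ s) : partialτ f x = partialτ g x :=
  (partialτ_congr (Filter.eventuallyEq_of_mem (hs.mem_nhds hx) h)).eq_of_nhds

theorem wpFun_add_lattice (t w : ℂ) (m n : ℤ) : wpFun (t, w + m + n * t) = wpFun (t, w) := by
  simp only [wpFun]
  split_ifs with h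
  · have := (tauPair ⟨t, h⟩).weierstrassP_add_coe w ⟨m + n * t, mem_tauPair_lattice.2 ⟨m, n, rfl⟩⟩
    rwa [← add_assoc] at this
  · rfl

theorem wpFun_neg (t w : ℂ) : wpFun (t, -w) = wpFun (t, w) := by
  simp only [wpFun]
  split_ifs with h
  · exact PeriodPair.weierstrassP_neg _ w
  · rfl

theorem partialz_wpFun_add_lattice (t w : ℂ) (m n : ℤ) :
    partialz wpFun (t, w + m + n * t) = partialz wpFun (t, w) := by
  simp only [partialz]
  rw [add_assoc, ← deriv_comp_add_const]
  simp only [← add_assoc, wpFun_add_lattice]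

theorem partialz_wpFun_neg (t w : ℂ) : partialz wpFun (t, -w) = -partialz wpFun (t, w) := by
  have := deriv_comp_neg (fun v => wpFun (t, v)) w
  simp only [wpFun_neg] at this
  simp only [partialz]
  rw [this, neg_neg]

/-- The quasi-period relation is differentiated along the curve `s ↦ (s, w + m + n s)`; the moving
lattice point contributes `n Z_z`. -/
theorem partialτ_jacobiZeta_add_lattice {t w : ℂ} (h : (t, w) ∈ latticeCompl) (m n : ℤ) :
    partialτ jacobiZeta (t, w + m + n * t) =
      partialτ jacobiZeta (t, w) - n * partialz jacobiZeta (t, w) := by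
  have h1 := (analyticOnNhd_jacobiZeta _ (latticeCompl_add h m n)).differentiableAt
  have hγ : HasDerivAt (fun s : ℂ => (s, w + m + n * s)) (1, (n : ℂ)) t := by
    refine (hasDerivAt_id t).prodMk ?_
    simpa using ((hasDerivAt_id t).const_mul (n : ℂ)).const_add (w + m)
  have h2 := DifferentiableAt.hasDerivAt_comp_curve (γ := fun s : ℂ => (s, w + m + n * s)) h1 hγ
  have h3 : HasDerivAt (fun s : ℂ => jacobiZeta (s, w + m + n * s))
      (partialτ jacobiZeta (t, w)) t := by
    refine ((analyticOnNhd_jacobiZeta _ h).differentiableAt.hasDerivAt_partialτ.sub_const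
      (n * (2 * Real.pi * Complex.I))).congr_of_eventuallyEq ?_
    filter_upwards [eventually_slice_fst isOpen_latticeCompl h] with s hs
    exact jacobiZeta_add_int_add_lattice hs m n
  have h4 := h2.unique h3
  simp only [partialz_jacobiZeta_add_lattice h] at h4
  linear_combination h4

theorem partialτ_jacobiZeta_neg {t w : ℂ} (h : (t, w) ∈ latticeCompl) :
    partialτ jacobiZeta (t, -w) = -partialτ jacobiZeta (t, w) := by
  simp only [partialτ]
  rw [← deriv.neg]
  refine Filter.EventuallyEq.deriv_eq ?_
  filter_upwards [eventually_slice_fst isOpen_latticeCompl h] with s hs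
  exact jacobiZeta_neg hs.1 (latticeCompl_expI_ne_one hs)

/-- In `Z_z + Z²` the terms `-1/z²` and `(1/z)²` cancel, and `2 zetaReg / z` is regular because
`zetaReg` vanishes at `0`. For a theta function with `Z = θ'/θ` this expression is `θ''/θ`. -/
theorem partialz_add_sq_eventuallyEq {t : ℂ} (ht : 0 < t.im) :
    (fun z => partialz jacobiZeta (t, z) + jacobiZeta (t, z) ^ 2) =ᶠ[𝓝[≠] 0] fun z =>
      deriv (zetaReg t) z + zetaReg t z ^ 2 + 2 * dslope (zetaReg t) 0 z := by
  filter_upwards [partialz_jacobiZeta_eventuallyEq ht, jacobiZeta_eventuallyEq ht,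
    self_mem_nhdsWithin] with z h1 h2 hz
  rw [h1, h2, dslope_of_ne _ hz, slope_def_field, zetaReg_zero]
  have : z ≠ 0 := hz
  field_simp
  ring

/-- The heat equation for `jacobiZeta`. -/
theorem jacobiZeta_heat {x : ℂ × ℂ} (hx : x ∈ latticeCompl) :
    4 * Real.pi * Complex.I * partialτ jacobiZeta x =
      -partialz wpFun x - 2 * jacobiZeta x * (wpFun x + wpConst x.1) := by
  obtain ⟨t, w⟩ := x
  have ht : 0 < t.im := hx.1
  let τ : ℍ := ⟨t, ht⟩
  have hV : ∀ {z}, z ∉ (tauPair τ).lattice ↔ (t, z) ∈ latticeCompl :=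
    (mem_latticeCompl_iff (τ := τ)).symm
  -- The difference of the two sides of the heat equation, equal to `4πi Z_τ - ∂_z (Z_z + Z²)` off
  -- the lattice. It is to be shown elliptic, regular at `0` and odd.
  let h : ℂ → ℂ := fun z => 4 * Real.pi * Complex.I * partialτ jacobiZeta (t, z) +
    partialz wpFun (t, z) + 2 * jacobiZeta (t, z) * (wpFun (t, z) + wpConst t)
  let S : ℂ → ℂ := fun z => deriv (zetaReg t) z + zetaReg t z ^ 2 + 2 * dslope (zetaReg t) 0 z
  have hS : AnalyticAt ℂ S 0 := by
    have h1 := analyticAt_zetaReg ht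
    have h2 := h1.deriv
    have h3 := h1.dslope_self
    fun_prop
  -- The cotangent part of `Z`, including its pole, does not depend on `τ`, so `Z_τ` is regular at
  -- `0` and comes from the Lambert series alone.
  let r : ℂ → ℂ := fun z => 4 * Real.pi * Complex.I *
    (-(2 * Real.pi * Complex.I) * partialτ lambertSum (t, z)) - deriv S z
  have key : ∀ z, (t, z) ∈ latticeCompl → h z = r 0 := by
    intro z hz
    refine (tauPair τ).eq_of_periodic_of_regular ?_ ?_ ?_ ?_ (hV.2 hz)
    · intro z hz
      have h1 := analyticOnNhd_jacobiZeta _ (hV.1 hz)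
      have h2 := analyticOnNhd_wpFun _ (hV.1 hz)
      have h3 := analyticAt_slice h1
      have h4 := analyticAt_slice h1.partialτ
      have h5 := analyticAt_slice h2.partialz
      have h6 := analyticAt_slice h2
      have : AnalyticAt ℂ h z := by fun_prop
      exact this.differentiableAt.differentiableWithinAt
    · intro z hz l hl
      obtain ⟨m, n, rfl⟩ := mem_tauPair_lattice.1 hl
      -- Translation by `m + nτ` adds `4πi n (℘ + e)` through `Z_τ` and `-4πi n (℘ + e)` through the
      -- factor `Z`, so `h` is elliptic.
      simp only [h]
      rw [← add_assoc, show ((τ : ℍ) : ℂ) = t from rfl, partialτ_jacobiZeta_add_lattice (hV.1 hz),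
        jacobiZeta_add_int_add_lattice (hV.1 hz), wpFun_add_lattice, partialz_wpFun_add_lattice,
        partialz_jacobiZeta (hV.1 hz)]
      ring
    · have h1 := analyticAt_slice (analyticOnNhd_lambertSum _ (zero_mem_strip ht)).partialτ
      have h2 := hS.deriv
      have : AnalyticAt ℂ r 0 := by fun_prop
      exact this.differentiableAt
    · filter_upwards [(partialz_add_sq_eventuallyEq ht).nhdsNE_deriv,
        eventually_mem_latticeCompl ht] with z h1 h2
      simp only [h, r, S, ← h1, partialτ_jacobiZeta]
      have hZ := (analyticOnNhd_jacobiZeta _ h2).differentiableAt.hasDerivAt_partialz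
      have hW := (analyticOnNhd_wpFun _ h2).differentiableAt.hasDerivAt_partialz
      have h3 : HasDerivAt (fun v => partialz jacobiZeta (t, v) + jacobiZeta (t, v) ^ 2)
          (-partialz wpFun (t, z) + 2 * jacobiZeta (t, z) * partialz jacobiZeta (t, z)) z := by
        refine HasDerivAt.congr_of_eventuallyEq (f := fun v =>
          -(wpFun (t, v) + wpConst t) + jacobiZeta (t, v) ^ 2) ?_ ?_
        · refine ((hW.add_const _).neg.add (hZ.pow 2)).congr_deriv ?_
          simp
        · filter_upwards [eventually_slice_snd isOpen_latticeCompl h2] with v hv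
          rw [partialz_jacobiZeta hv]
      rw [h3.deriv, partialz_jacobiZeta h2]
      ring
  have h1 := key w hx
  have h2 := key (-w) (latticeCompl_neg hx)
  -- A constant odd function is zero.
  have h3 : h (-w) = -h w := by
    simp only [h]
    rw [partialτ_jacobiZeta_neg hx, partialz_wpFun_neg, wpFun_neg,
      jacobiZeta_neg ht (latticeCompl_expI_ne_one hx)]
    ring
  have h4 : h w = 0 := CharZero.eq_neg_self_iff.1 (by rw [← h3, h1, h2])
  simp only [h] at h4
  linear_combination h4

/-! ### The differential equations of `℘` in `z` -/

/-- The invariant `g₂` of the lattice `ℤ + ℤt`. -/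
def wpG₂ (t : ℂ) : ℂ := if h : 0 < t.im then (tauPair ⟨t, h⟩).g₂ else 0

/-- The invariant `g₃` of the lattice `ℤ + ℤt`. -/
def wpG₃ (t : ℂ) : ℂ := if h : 0 < t.im then (tauPair ⟨t, h⟩).g₃ else 0

theorem partialz_wpFun_sq {x : ℂ × ℂ} (hx : x ∈ latticeCompl) :
    partialz wpFun x ^ 2 = 4 * wpFun x ^ 3 - wpG₂ x.1 * wpFun x - wpG₃ x.1 := by
  obtain ⟨t, w⟩ := x
  have ht : 0 < t.im := hx.1
  have hwp : ∀ z, wpFun (t, z) = (tauPair ⟨t, ht⟩).weierstrassP z := wpFun_coe ⟨t, ht⟩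
  have h := (tauPair ⟨t, ht⟩).derivWeierstrassP_sq w ((mem_latticeCompl_iff (τ := ⟨t, ht⟩)).1 hx)
  rw [← PeriodPair.deriv_weierstrassP] at h
  simp only [partialz, hwp, wpG₂, wpG₃, ht, dif_pos]
  exact h

/-- Near the pole `z³ ℘_z` is close to `-2`. -/
theorem eventually_partialz_wpFun_ne_zero {t : ℂ} (ht : 0 < t.im) :
    ∀ᶠ z in 𝓝[≠] (0 : ℂ), partialz wpFun (t, z) ≠ 0 := by
  set R := (tauPair ⟨t, ht⟩).weierstrassPExcept 0 with hR
  have hRa : AnalyticAt ℂ R 0 := (tauPair ⟨t, ht⟩).analyticAt_weierstrassPExcept 0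
  have h1 : ContinuousAt (fun z => -2 + z ^ 3 * deriv R z) 0 := by
    have := hRa.deriv.continuousAt
    fun_prop
  have h2 := (h1.eventually_ne (y := 0) (by simp)).filter_mono (nhdsWithin_le_nhds (s := {0}ᶜ))
  have h3 : (fun z => wpFun (t, z)) =ᶠ[𝓝[≠] 0] fun z => (z ^ 2)⁻¹ + R z :=
    .of_forall fun z => wpFun_eventuallyEq ht z
  filter_upwards [h2, h3.nhdsNE_deriv, self_mem_nhdsWithin,
    nhdsWithin_le_nhds hRa.eventually_analyticAt] with z hz hd hz0 ha h0
  have hz0' : z ≠ 0 := hz0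
  have h4 : HasDerivAt (fun z => (z ^ 2)⁻¹ + R z) _ z :=
    ((hasDerivAt_pow 2 z).fun_inv (pow_ne_zero 2 hz0)).add ha.differentiableAt.hasDerivAt
  rw [h4.deriv] at hd
  have h5 := hd.symm.trans h0
  field_simp at h5
  push_cast at h5
  refine hz (mul_left_cancel₀ hz0' ?_)
  linear_combination h5

theorem partialz_partialz_wpFun_add_lattice (t w : ℂ) (m n : ℤ) :
    partialz (partialz wpFun) (t, w + m + n * t) = partialz (partialz wpFun) (t, w) := by
  rw [partialz, partialz]
  dsimp only
  rw [add_assoc, ← deriv_comp_add_const]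
  simp only [← add_assoc, partialz_wpFun_add_lattice]

/-- Differentiating `℘_z² = 4℘³ - g₂℘ - g₃` and cancelling `℘_z` is legitimate only where `℘_z ≠ 0`,
hence in a punctured neighbourhood of `0`. There the elliptic function `℘_zz - 6℘²` is constant, and
Liouville's theorem extends this to the zeros of `℘_z`. -/
theorem partialz_partialz_wpFun {x : ℂ × ℂ} (hx : x ∈ latticeCompl) :
    partialz (partialz wpFun) x = 6 * wpFun x ^ 2 - wpG₂ x.1 / 2 := by
  obtain ⟨t, w⟩ := x
  have ht : 0 < t.im := hx.1
  let τ : ℍ := ⟨t, ht⟩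
  have hV : ∀ {z}, z ∉ (tauPair τ).lattice ↔ (t, z) ∈ latticeCompl :=
    (mem_latticeCompl_iff (τ := τ)).symm
  have key := (tauPair τ).eq_of_periodic_of_regular
    (h := fun z => partialz (partialz wpFun) (t, z) - 6 * wpFun (t, z) ^ 2)
    (r := fun _ => -wpG₂ t / 2) ?_ ?_ (differentiableAt_const _) ?_ (hV.2 hx)
  · linear_combination key
  · intro z hz
    have h2 := analyticOnNhd_wpFun _ (hV.1 hz)
    have h5 := analyticAt_slice h2.partialz.partialz
    have h6 := analyticAt_slice h2
    have : AnalyticAt ℂ (fun z => partialz (partialz wpFun) (t, z) - 6 * wpFun (t, z) ^ 2) z := by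
      fun_prop
    exact this.differentiableAt.differentiableWithinAt
  · intro z hz l hl
    obtain ⟨m, n, rfl⟩ := mem_tauPair_lattice.1 hl
    rw [← add_assoc, show ((τ : ℍ) : ℂ) = t from rfl, wpFun_add_lattice,
      partialz_partialz_wpFun_add_lattice]
  · filter_upwards [eventually_mem_latticeCompl ht, eventually_partialz_wpFun_ne_zero ht] with z hz h0
    have ha := analyticOnNhd_wpFun _ hz
    have h1 := ha.differentiableAt.hasDerivAt_partialz
    have h2 := ha.partialz.differentiableAt.hasDerivAt_partialz
    have h3 : HasDerivAt (fun w => partialz wpFun (t, w) ^ 2)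
        ((12 * wpFun (t, z) ^ 2 - wpG₂ t) * partialz wpFun (t, z)) z := by
      refine HasDerivAt.congr_of_eventuallyEq (f := fun w => 4 * wpFun (t, w) ^ 3
        - wpG₂ t * wpFun (t, w) - wpG₃ t) ?_ ?_
      · refine ((((h1.pow 3).const_mul 4).sub (h1.const_mul (wpG₂ t))).sub_const _).congr_deriv ?_
        push_cast
        ring
      · filter_upwards [eventually_slice_snd isOpen_latticeCompl hz] with v hv
        exact partialz_wpFun_sq hv
    have h4 := (h2.pow 2).unique h3
    refine mul_right_cancel₀ h0 ?_
    push_cast at h4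
    linear_combination h4 / 2

/-- At a fixed `z` off the lattice, `g₂ = 12℘² - 2℘_zz`, and the right side is analytic in `τ`. -/
theorem analyticAt_wpG₂ {t : ℂ} (ht : 0 < t.im) : AnalyticAt ℂ wpG₂ t := by
  obtain ⟨z, hz⟩ := (eventually_mem_latticeCompl ht).exists
  have ha := analyticOnNhd_wpFun _ hz
  have h1 := analyticAt_slice_fst ha
  have h2 := analyticAt_slice_fst ha.partialz.partialz
  have h3 : AnalyticAt ℂ (fun s => 12 * wpFun (s, z) ^ 2 - 2 * partialz (partialz wpFun) (s, z)) t := by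
    fun_prop
  refine h3.congr ?_
  filter_upwards [eventually_slice_fst isOpen_latticeCompl hz] with s hs
  rw [partialz_partialz_wpFun hs]
  ring

theorem partialz_partialz_partialz_wpFun {x : ℂ × ℂ} (hx : x ∈ latticeCompl) :
    partialz (partialz (partialz wpFun)) x = 12 * wpFun x * partialz wpFun x := by
  have h1 := (analyticOnNhd_wpFun _ hx).differentiableAt.hasDerivAt_partialz
  have h2 : HasDerivAt (fun w => 6 * wpFun (x.1, w) ^ 2 - wpG₂ x.1 / 2)
      (12 * wpFun x * partialz wpFun x) x.2 := by
    refine (((h1.pow 2).const_mul 6).sub_const _).congr_deriv ?_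
    push_cast
    ring
  rw [← h2.deriv, partialz_congr_of_mem isOpen_latticeCompl (fun y hy => partialz_partialz_wpFun hy) hx]
  rfl

/-! ### The differential equations of `℘` in `τ` -/

theorem const_mul_partialz_of_mem {f g : ℂ × ℂ → ℂ} {s : Set (ℂ × ℂ)} (hs : IsOpen s) {c d : ℂ}
    (h : ∀ y ∈ s, c * f y = g y) {x : ℂ × ℂ} (hx : x ∈ s)
    (hg : HasDerivAt (fun w => g (x.1, w)) d x.2) : c * partialz f x = d := by
  rw [partialz, ← deriv_const_mul_field, ← hg.deriv]
  refine Filter.EventuallyEq.deriv_eq ?_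
  filter_upwards [eventually_slice_snd hs hx] with w hw
  exact h _ hw

theorem const_mul_partialτ_of_mem {f g : ℂ × ℂ → ℂ} {s : Set (ℂ × ℂ)} (hs : IsOpen s) {c d : ℂ}
    (h : ∀ y ∈ s, c * f y = g y) {x : ℂ × ℂ} (hx : x ∈ s)
    (hg : HasDerivAt (fun t => g (t, x.2)) d x.1) : c * partialτ f x = d := by
  rw [partialτ, ← deriv_const_mul_field, ← hg.deriv]
  refine Filter.EventuallyEq.deriv_eq ?_
  filter_upwards [eventually_slice_fst hs hx] with w hw
  exact h _ hw

/-- The heat equation differentiated in `z`, with `Z_zτ = -(℘_τ + e')`. The derivative `e'` of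
`wpConst` is still unknown at this stage. -/
theorem partialτ_wpFun_aux {x : ℂ × ℂ} (hx : x ∈ latticeCompl) :
    4 * Real.pi * Complex.I * partialτ wpFun x = 2 * jacobiZeta x * partialz wpFun x + 4 * wpFun x ^ 2
      - 4 * wpConst x.1 * wpFun x
      + (-wpG₂ x.1 / 2 - 2 * wpConst x.1 ^ 2 - 4 * Real.pi * Complex.I * deriv wpConst x.1) := by
  have hZ := analyticOnNhd_jacobiZeta _ hx
  have hp := analyticOnNhd_wpFun _ hx
  have hZ1 := hZ.differentiableAt.hasDerivAt_partialz
  have hp1 := hp.differentiableAt.hasDerivAt_partialz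
  have hp2 := hp.partialz.differentiableAt.hasDerivAt_partialz
  have h1 : 4 * Real.pi * Complex.I * partialz (partialτ jacobiZeta) x =
      -partialz (partialz wpFun) x - 2 * (partialz jacobiZeta x * (wpFun x + wpConst x.1)
        + jacobiZeta x * partialz wpFun x) := by
    have h2 := hp2.neg.sub ((hZ1.mul (hp1.add_const (wpConst x.1))).const_mul 2)
    rw [← h2.deriv, partialz, ← deriv_const_mul_field]
    refine Filter.EventuallyEq.deriv_eq ?_
    filter_upwards [eventually_slice_snd isOpen_latticeCompl hx] with w hw
    rw [jacobiZeta_heat hw]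
    simp only [Pi.sub_apply, Pi.neg_apply, Pi.mul_apply]
    ring
  have h3 : partialτ (partialz jacobiZeta) x = -(partialτ wpFun x + deriv wpConst x.1) := by
    have h4 := (hp.differentiableAt.hasDerivAt_partialτ.add
      (analyticAt_wpConst hx.1).differentiableAt.hasDerivAt).neg
    rw [← h4.deriv, partialτ_congr_of_mem isOpen_latticeCompl (fun y hy => partialz_jacobiZeta hy) hx]
    rfl
  rw [hZ.partialz_partialτ, h3, partialz_jacobiZeta hx, partialz_partialz_wpFun hx] at h1
  linear_combination -h1

theorem partialz_partialτ_wpFun {x : ℂ × ℂ} (hx : x ∈ latticeCompl) :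
    4 * Real.pi * Complex.I * partialz (partialτ wpFun) x =
      2 * jacobiZeta x * (6 * wpFun x ^ 2 - wpG₂ x.1 / 2)
        + 6 * (wpFun x - wpConst x.1) * partialz wpFun x := by
  have hZ1 := (analyticOnNhd_jacobiZeta _ hx).differentiableAt.hasDerivAt_partialz
  have hp := analyticOnNhd_wpFun _ hx
  have hp1 := hp.differentiableAt.hasDerivAt_partialz
  have hp2 := hp.partialz.differentiableAt.hasDerivAt_partialz
  have h2 := ((((hZ1.const_mul 2).mul hp2).add ((hp1.pow 2).const_mul 4)).sub
    (hp1.const_mul (4 * wpConst x.1))).add_const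
    (-wpG₂ x.1 / 2 - 2 * wpConst x.1 ^ 2 - 4 * Real.pi * Complex.I * deriv wpConst x.1)
  have h1 := const_mul_partialz_of_mem isOpen_latticeCompl (fun y hy => partialτ_wpFun_aux hy) hx h2
  rw [h1, partialz_jacobiZeta hx, partialz_partialz_wpFun hx]
  push_cast
  ring

theorem partialz_partialz_partialτ_wpFun {x : ℂ × ℂ} (hx : x ∈ latticeCompl) :
    4 * Real.pi * Complex.I * partialz (partialz (partialτ wpFun)) x =
      24 * jacobiZeta x * wpFun x * partialz wpFun x
        + (4 * wpFun x - 8 * wpConst x.1) * (6 * wpFun x ^ 2 - wpG₂ x.1 / 2)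
        + 6 * partialz wpFun x ^ 2 := by
  have hZ1 := (analyticOnNhd_jacobiZeta _ hx).differentiableAt.hasDerivAt_partialz
  have hp := analyticOnNhd_wpFun _ hx
  have hp1 := hp.differentiableAt.hasDerivAt_partialz
  have hp2 := hp.partialz.differentiableAt.hasDerivAt_partialz
  have h2 := ((hZ1.const_mul 2).mul (((hp1.pow 2).const_mul 6).sub_const (wpG₂ x.1 / 2))).add
    (((hp1.sub_const (wpConst x.1)).const_mul 6).mul hp2)
  have h1 := const_mul_partialz_of_mem isOpen_latticeCompl (fun y hy => partialz_partialτ_wpFun hy) hx h2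
  rw [h1, partialz_jacobiZeta hx, partialz_partialz_wpFun hx]
  simp only [Pi.pow_apply]
  push_cast
  ring

theorem partialz_partialz_partialτ_comm {f : ℂ × ℂ → ℂ} {x : ℂ × ℂ} (h : AnalyticAt ℂ f x) :
    partialz (partialz (partialτ f)) x = partialτ (partialz (partialz f)) x := by
  rw [← h.partialz.partialz_partialτ]
  refine (partialz_congr ?_).eq_of_nhds
  filter_upwards [h.eventually_analyticAt] with y hy
  exact hy.partialz_partialτ

/-- Two computations of `℘_τzz` are compared: two `z`-derivatives of the formula for `℘_τ`, and the
`τ`-derivative of `℘_zz = 6℘² - g₂/2`. All terms with `Z` cancel and a relation of degree one in `℘`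
remains, with coefficients depending on `τ` only. -/
theorem deriv_wpG₂_aux {x : ℂ × ℂ} (hx : x ∈ latticeCompl) :
    4 * Real.pi * Complex.I * deriv wpG₂ x.1 =
      24 * (wpG₂ x.1 / 6 - 2 * wpConst x.1 ^ 2 - 4 * Real.pi * Complex.I * deriv wpConst x.1)
        * wpFun x - 8 * wpConst x.1 * wpG₂ x.1 + 12 * wpG₃ x.1 := by
  have hp := analyticOnNhd_wpFun _ hx
  have h1 : partialτ (partialz (partialz wpFun)) x =
      12 * wpFun x * partialτ wpFun x - deriv wpG₂ x.1 / 2 := by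
    have h2 := ((hp.differentiableAt.hasDerivAt_partialτ.pow 2).const_mul 6).sub
      ((analyticAt_wpG₂ hx.1).differentiableAt.hasDerivAt.div_const 2)
    rw [partialτ_congr_of_mem isOpen_latticeCompl (fun y hy => partialz_partialz_wpFun hy) hx]
    refine h2.deriv.trans ?_
    push_cast
    ring
  have h3 := partialz_partialz_partialτ_wpFun hx
  rw [partialz_partialz_partialτ_comm hp, h1] at h3
  linear_combination -2 * h3 + 24 * wpFun x * partialτ_wpFun_aux hx - 12 * partialz_wpFun_sq hx

/-- One of Ramanujan's differential equations. -/
theorem deriv_wpConst {t : ℂ} (ht : 0 < t.im) :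
    4 * Real.pi * Complex.I * deriv wpConst t = wpG₂ t / 6 - 2 * wpConst t ^ 2 := by
  obtain ⟨z, hz, h0⟩ := ((eventually_mem_latticeCompl ht).and
    (eventually_partialz_wpFun_ne_zero ht)).exists
  set A := 24 * (wpG₂ t / 6 - 2 * wpConst t ^ 2 - 4 * Real.pi * Complex.I * deriv wpConst t)
    with hA
  -- In the relation of degree one in `℘` the coefficient `A` must vanish: `A ℘` is constant in `z`,
  -- whereas `℘_z ≠ 0` at the chosen point.
  have h1 := (analyticOnNhd_wpFun _ hz).differentiableAt.hasDerivAt_partialz.const_mul A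
  have h2 : HasDerivAt (fun w => A * wpFun (t, w)) 0 z := by
    refine (hasDerivAt_const z (4 * Real.pi * Complex.I * deriv wpG₂ t
      + 8 * wpConst t * wpG₂ t - 12 * wpG₃ t)).congr_of_eventuallyEq ?_
    filter_upwards [eventually_slice_snd isOpen_latticeCompl hz] with w hw
    linear_combination -deriv_wpG₂_aux hw
  have h3 := (mul_eq_zero.1 (h1.unique h2)).resolve_right h0
  linear_combination (-1 / 24) * h3

/-- One of Ramanujan's differential equations. -/
theorem deriv_wpG₂ {t : ℂ} (ht : 0 < t.im) :
    4 * Real.pi * Complex.I * deriv wpG₂ t = 12 * wpG₃ t - 8 * wpConst t * wpG₂ t := by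
  obtain ⟨z, hz⟩ := (eventually_mem_latticeCompl ht).exists
  linear_combination deriv_wpG₂_aux hz - 24 * wpFun (t, z) * deriv_wpConst ht

theorem partialτ_wpFun {x : ℂ × ℂ} (hx : x ∈ latticeCompl) :
    4 * Real.pi * Complex.I * partialτ wpFun x = 2 * jacobiZeta x * partialz wpFun x + 4 * wpFun x ^ 2
      - 4 * wpConst x.1 * wpFun x - 2 / 3 * wpG₂ x.1 := by
  linear_combination partialτ_wpFun_aux hx - deriv_wpConst hx.1

/-- The formula for `℘_τ` contains `e` and `g₂` but not `g₃`, so only two of Ramanujan's three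
equations are needed. -/
theorem partialτ_partialτ_wpFun {x : ℂ × ℂ} (hx : x ∈ latticeCompl) :
    (4 * Real.pi * Complex.I) ^ 2 * partialτ (partialτ wpFun) x =
      2 * (4 * Real.pi * Complex.I * partialτ jacobiZeta x) * partialz wpFun x
        + 2 * jacobiZeta x * (4 * Real.pi * Complex.I * partialz (partialτ wpFun) x)
        + (8 * wpFun x - 4 * wpConst x.1) * (4 * Real.pi * Complex.I * partialτ wpFun x)
        - 4 * (4 * Real.pi * Complex.I * deriv wpConst x.1) * wpFun x
        - 2 / 3 * (4 * Real.pi * Complex.I * deriv wpG₂ x.1) := by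
  have hZ1 := (analyticOnNhd_jacobiZeta _ hx).differentiableAt.hasDerivAt_partialτ
  have hp := analyticOnNhd_wpFun _ hx
  have hp1 := hp.differentiableAt.hasDerivAt_partialτ
  have hp2 := hp.partialz.differentiableAt.hasDerivAt_partialτ
  have he := (analyticAt_wpConst hx.1).differentiableAt.hasDerivAt
  have h2 := ((((hZ1.const_mul 2).mul hp2).add ((hp1.pow 2).const_mul 4)).sub
    ((he.const_mul 4).mul hp1)).sub
    ((analyticAt_wpG₂ hx.1).differentiableAt.hasDerivAt.const_mul (2 / 3))
  have h1 := const_mul_partialτ_of_mem isOpen_latticeCompl (fun y hy => partialτ_wpFun hy) hx h2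
  rw [sq, mul_assoc, h1, hp.partialz_partialτ]
  push_cast
  ring

/-! ### The lattice invariants as Eisenstein series -/

theorem tauPair_G {k : ℕ} (hk : 3 ≤ k) (τ : ℍ) :
    (tauPair τ).G k = 2 * riemannZeta k * ModularForm.E hk τ := by
  have h1 := tsum_eisSummand_eq_riemannZeta_mul_eisensteinSeries hk τ
  have h2 : ModularForm.E hk τ = (1 / 2 : ℂ) * eisensteinSeries (N := 1) 0 k τ := rfl
  rw [h2]
  calc (tauPair τ).G k = ∑' v : Fin 2 → ℤ, EisensteinSeries.eisSummand k v τ := by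
        -- The coordinates are swapped: the basis of the lattice is `(1, τ)`, whereas the Eisenstein
        -- summand is `(v 0 · τ + v 1)^(-k)`.
        rw [PeriodPair.G, ← (tauPair τ).latticeEquivProd.symm.toEquiv.tsum_eq,
          ← ((finTwoArrowEquiv ℤ).trans (Equiv.prodComm ℤ ℤ)).tsum_eq]
        refine tsum_congr fun v => ?_
        change (((tauPair τ).latticeEquivProd.symm (v 1, v 0) : ℂ) ^ k)⁻¹ =
          ((v 0 : ℂ) * (τ : ℂ) + v 1) ^ (-(k : ℤ))
        rw [PeriodPair.latticeEquiv_symm_apply, zpow_neg, zpow_natCast]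
        change (((v 1 : ℂ) * 1 + v 0 * (τ : ℂ)) ^ k)⁻¹ = _
        rw [mul_one, add_comm]
    _ = _ := by rw [h1]; ring

theorem bernoulli_six : bernoulli 6 = 1 / 42 := by
  rw [bernoulli_eq_bernoulli'_of_ne_one (by norm_num), bernoulli'_def]
  simp only [Finset.sum_range_succ, Finset.sum_range_zero]
  have h5 : bernoulli' 5 = 0 := bernoulli'_eq_zero_of_odd (by decide) (by norm_num)
  norm_num [h5, bernoulli'_zero, bernoulli'_one, bernoulli'_two, bernoulli'_three, bernoulli'_four,
    Nat.choose]

theorem riemannZeta_six : riemannZeta 6 = Real.pi ^ 6 / 945 := by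
  have h := riemannZeta_two_mul_nat (k := 3) (by norm_num)
  norm_num [bernoulli_six, Nat.factorial] at h
  rw [h]
  ring

theorem wpG₂_coe (τ : ℍ) : wpG₂ τ = 4 / 3 * Real.pi ^ 4 * ModularForm.E₄ τ := by
  have h := tauPair_G (k := 4) (by norm_num) τ
  rw [show ((4 : ℕ) : ℂ) = 4 by norm_num, riemannZeta_four] at h
  have : wpG₂ τ = 60 * (tauPair τ).G 4 := dif_pos τ.2
  rw [this, h]
  ring

theorem wpG₃_coe (τ : ℍ) : wpG₃ τ = 8 / 27 * Real.pi ^ 6 * ModularForm.E₆ τ := by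
  have h := tauPair_G (k := 6) (by norm_num) τ
  rw [show ((6 : ℕ) : ℂ) = 6 by norm_num, riemannZeta_six] at h
  have : wpG₃ τ = 140 * (tauPair τ).G 6 := dif_pos τ.2
  rw [this, h]
  ring

/-- Both `(4/3)³` and `27 (8/27)²` equal `64/27`, and `64/27 · 1728 = 2^12`. -/
theorem wpG₂_cube_sub (τ : ℍ) :
    wpG₂ τ ^ 3 - 27 * wpG₃ τ ^ 2 = (2 * Real.pi) ^ 12 * ModularForm.discriminant τ := by
  rw [wpG₂_coe, wpG₃_coe, ModularForm.discriminant_eq_E₄_cube_sub_E₆_sq]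
  ring

/-! ### `℘` satisfies the system -/

/-- The quantities `Z` and `e` enter as the parameters of a Jacobi transformation of jets with `J =
1`, `ρ = 2Z/(4πi)` and `c = 2e/(4πi)`. This is why they must disappear from the invariant system. -/
theorem jetAt_wpFun {x : ℂ × ℂ} (hx : x ∈ latticeCompl) {u : Jet2} (hu : u = jetAt wpFun x) :
    ∃ p p' Z e g₂ g₃ : ℂ, g₂ = wpG₂ x.1 ∧ g₃ = wpG₃ x.1 ∧ p' ^ 2 = 4 * p ^ 3 - g₂ * p - g₃ ∧
      u (0, 0) = p ∧ u (0, 1) = p' ∧ u (0, 2) = 6 * p ^ 2 - g₂ / 2 ∧ u (0, 3) = 12 * p * p' ∧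
      4 * Real.pi * Complex.I * u (1, 0) = 2 * Z * p' + 4 * p ^ 2 - 4 * e * p - 2 / 3 * g₂ ∧
      4 * Real.pi * Complex.I * u (1, 1) = 2 * Z * (6 * p ^ 2 - g₂ / 2) + 6 * (p - e) * p' ∧
      4 * Real.pi * Complex.I * u (1, 2) = 24 * Z * p * p'
        + (4 * p - 8 * e) * (6 * p ^ 2 - g₂ / 2) + 6 * p' ^ 2 ∧
      (4 * Real.pi * Complex.I) ^ 2 * u (2, 0) =
        2 * (-p' - 2 * Z * (p + e)) * p' + 2 * Z * (2 * Z * (6 * p ^ 2 - g₂ / 2) + 6 * (p - e) * p')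
        + (8 * p - 4 * e) * (2 * Z * p' + 4 * p ^ 2 - 4 * e * p - 2 / 3 * g₂)
        - 4 * (g₂ / 6 - 2 * e ^ 2) * p - 2 / 3 * (12 * g₃ - 8 * e * g₂) := by
  have hp := analyticOnNhd_wpFun _ hx
  refine ⟨wpFun x, partialz wpFun x, jacobiZeta x, wpConst x.1, _, _, rfl, rfl,
    partialz_wpFun_sq hx, ?_⟩
  subst hu
  simp only [jetAt_eq, Function.iterate_succ, Function.iterate_zero, Function.comp_apply, id, true_and]
  refine ⟨partialz_partialz_wpFun hx, partialz_partialz_partialz_wpFun hx,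
    partialτ_wpFun hx, ?_, ?_, ?_⟩
  · rw [← hp.partialz_partialτ, partialz_partialτ_wpFun hx]
  · rw [← partialz_partialz_partialτ_comm hp, partialz_partialz_partialτ_wpFun hx]
  · rw [partialτ_partialτ_wpFun hx, partialτ_wpFun hx, partialz_partialτ_wpFun hx,
      deriv_wpConst hx.1, deriv_wpG₂ hx.1, jacobiZeta_heat hx]

theorem wpFun_identities {x : ℂ × ℂ} (hx : x ∈ latticeCompl) {u : Jet2} (hu : u = jetAt wpFun x) :
    u (0, 3) = 12 * u (0, 0) * u (0, 1) ∧
    u (0, 1) ^ 2 = 4 * u (0, 0) ^ 3 - wpG₂ x.1 * u (0, 0) - wpG₃ x.1 ∧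
    wpPhi u = -2 * (wpG₂ x.1 ^ 3 - 27 * wpG₃ x.1 ^ 2) ∧
    96 * Real.pi ^ 2 * u (0, 0) * (u (0, 2) * u (2, 0) - u (1, 1) ^ 2) =
      48 * Real.pi ^ 2 * (3 * u (0, 1) ^ 2 * u (2, 0) - 6 * u (1, 0) * u (0, 1) * u (1, 1)
        + 3 * u (1, 0) ^ 2 * u (0, 2)) + wpPhi u ∧
    3 * Real.pi * (2 * u (0, 0) * u (0, 2) - 3 * u (0, 1) ^ 2) * u (1, 2) =
      Complex.I / 4 * wpPhi u + Real.pi * (36 * u (0, 0) * u (0, 1)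
        * (2 * u (0, 0) * u (1, 1) - 3 * u (1, 0) * u (0, 1))
      - 12 * u (0, 2) * (u (0, 1) * u (1, 1) - u (1, 0) * u (0, 2))) := by
  obtain ⟨p, p', Z, e, g₂, g₃, hg₂, hg₃, hsq, h00, h01, h02, h03, h10, h11, h12, h20⟩ :=
    jetAt_wpFun hx hu
  rw [← hg₂, ← hg₃]
  have hpi : (Real.pi : ℂ) ≠ 0 := by exact_mod_cast Real.pi_ne_zero
  have hc0 : 4 * Real.pi * Complex.I ≠ 0 := by simp [hpi]
  have hc : (4 * Real.pi * Complex.I) ^ 2 = -16 * Real.pi ^ 2 := by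
    linear_combination 16 * (Real.pi : ℂ) ^ 2 * Complex.I_sq
  -- With `g₃` eliminated the variables `p, p', Z, e, g₂` are treated as independent, and the claims
  -- become polynomial identities.
  obtain rfl : g₃ = 4 * p ^ 3 - g₂ * p - p' ^ 2 := by linear_combination hsq
  have hφ : wpPhi u = -2 * (g₂ ^ 3 - 27 * (4 * p ^ 3 - g₂ * p - p' ^ 2) ^ 2) := by
    rw [wpPhi, h00, h01, h02]
    ring
  rw [hφ, h00, h01, h02, h03]
  refine ⟨rfl, by ring, rfl, ?_, ?_⟩
  -- The powers of `π` are written through `c = 4πi`, after which `c` is an arbitrary nonzero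
  -- number.
  · rw [show 96 * (Real.pi : ℂ) ^ 2 = -6 * (4 * Real.pi * Complex.I) ^ 2 by rw [hc]; ring,
      show 48 * (Real.pi : ℂ) ^ 2 = -3 * (4 * Real.pi * Complex.I) ^ 2 by rw [hc]; ring]
    generalize 4 * Real.pi * Complex.I = c at *
    rw [eq_div_of_mul_eq hc0 ((mul_comm _ _).trans h10),
      eq_div_of_mul_eq hc0 ((mul_comm _ _).trans h11),
      eq_div_of_mul_eq (pow_ne_zero 2 hc0) ((mul_comm _ _).trans h20)]
    field_simp
    ring
  · refine mul_left_cancel₀ hc0 ?_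
    linear_combination (3 * Real.pi * (2 * p * (6 * p ^ 2 - g₂ / 2) - 3 * p' ^ 2)) * h12
      - Real.pi * (72 * p ^ 2 * p' - 12 * (6 * p ^ 2 - g₂ / 2) * p') * h11
      - Real.pi * (-108 * p * p' ^ 2 + 12 * (6 * p ^ 2 - g₂ / 2) ^ 2) * h10
      + 2 * Real.pi * (g₂ ^ 3 - 27 * (4 * p ^ 3 - g₂ * p - p' ^ 2) ^ 2) * Complex.I_sq

theorem wpFun_system (τ : ℍ) (z : ℂ) (hz : z ∉ (tauPair τ).lattice) :
    (∀ i, MvPolynomial.eval (jetAt wpFun ((τ : ℂ), z)) (wpSystem.eq i) = 0) ∧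
    (∀ u : Jet2, u = jetAt wpFun ((τ : ℂ), z) →
      (2 * u (0, 0) * u (0, 2) - 3 * u (0, 1) ^ 2 ≠ 0 → WpSolvedForm u) ∧
      (∀ s : ℂ, u (0, 0) ≠ 0 → s ^ 2 = u (0, 0) →
        2 * u (0, 0) * u (0, 2) - 3 * u (0, 1) ^ 2 ≠ 0 → WpInvariantForm s u) ∧
      u (0, 3) = 12 * u (0, 0) * u (0, 1) ∧
      (∀ g₂ g₃ : ℂ, g₂ = 4 / 3 * Real.pi ^ 4 * ModularForm.E₄ τ →
        g₃ = 8 / 27 * Real.pi ^ 6 * ModularForm.E₆ τ →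
        u (0, 1) ^ 2 = 4 * u (0, 0) ^ 3 - g₂ * u (0, 0) - g₃ ∧
        wpPhi u = -2 * (g₂ ^ 3 - 27 * g₃ ^ 2)) ∧
      wpPhi u = -2 * (2 * Real.pi) ^ 12 * ModularForm.discriminant τ ∧
      2 * u (0, 0) * (u (0, 2) * u (2, 0) - u (1, 1) ^ 2) =
        3 * u (0, 1) ^ 2 * u (2, 0) - 6 * u (1, 0) * u (0, 1) * u (1, 1)
          + 3 * u (1, 0) ^ 2 * u (0, 2)
          - (2 * Real.pi) ^ 10 / 6 * ModularForm.discriminant τ) := by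
  have hx := mem_latticeCompl_iff.2 hz
  have hpi : (Real.pi : ℂ) ≠ 0 := by exact_mod_cast Real.pi_ne_zero
  have heq : ∀ i, MvPolynomial.eval (jetAt wpFun ((τ : ℂ), z)) (wpSystem.eq i) = 0 := by
    obtain ⟨h1, -, -, h4, h5⟩ := wpFun_identities hx rfl
    rw [wpSystem_eqs_iff]
    refine ⟨?_, h5, h1⟩
    linear_combination h4 / 16
  refine ⟨heq, fun u hu => ?_⟩
  obtain ⟨h1, h2, h3, h4, -⟩ := wpFun_identities hx hu
  have hφ : wpPhi u = -2 * (2 * Real.pi) ^ 12 * ModularForm.discriminant τ := by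
    rw [h3, wpG₂_cube_sub]
    ring
  have hS (hD : 2 * u (0, 0) * u (0, 2) - 3 * u (0, 1) ^ 2 ≠ 0) : wpSystem.HoldsAt u :=
    ⟨(wpSystem_nondeg_eval u).trans_ne hD, hu ▸ heq⟩
  refine ⟨fun hD => ((wpSystem_holdsAt_iff_solved u).1 (hS hD)).2, fun s hf hs hD =>
    (wpSystem_holdsAt_iff_invariant u s hf hs hD).1 (hS hD), h1, ?_, hφ, ?_⟩
  · rintro g₂ g₃ rfl rfl
    rw [← wpG₂_coe, ← wpG₃_coe]
    exact ⟨h2, h3⟩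
  · refine mul_left_cancel₀ (mul_ne_zero (by norm_num : (48 : ℂ) ≠ 0) (pow_ne_zero 2 hpi)) ?_
    rw [hφ] at h4
    linear_combination h4

/-! ### The transformation law of `℘` -/

/-- Multiplication by `c` is a bijection of the lattices, and each summand is homogeneous of degree
`-2`. Only the lattices matter, not their bases. -/
theorem PeriodPair.weierstrassP_of_lattice_scale {L L' : PeriodPair} {c : ℂ} (hc : c ≠ 0)
    (h : ∀ w, w ∈ L'.lattice ↔ c * w ∈ L.lattice) (z : ℂ) :
    L'.weierstrassP z = c ^ 2 * L.weierstrassP (c * z) := by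
  let e : L'.lattice ≃ L.lattice :=
    { toFun := fun w => ⟨c * w, (h w).1 w.2⟩
      invFun := fun w => ⟨c⁻¹ * w, (h _).2 (by rw [mul_inv_cancel_left₀ hc]; exact w.2)⟩
      left_inv := fun w => Subtype.ext (inv_mul_cancel_left₀ hc _)
      right_inv := fun w => Subtype.ext (mul_inv_cancel_left₀ hc _) }
  rw [PeriodPair.weierstrassP, PeriodPair.weierstrassP, ← e.tsum_eq, ← tsum_mul_left]
  refine tsum_congr fun w => ?_
  have he : ((e w : L.lattice) : ℂ) = c * w := rfl
  rw [he, ← mul_sub, mul_pow, mul_pow, mul_sub, ← mul_div_assoc, ← mul_div_assoc, mul_one,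
    div_mul_eq_div_div, div_mul_eq_div_div, div_self (pow_ne_zero 2 hc)]

theorem wpFun_jacobiMap (g : SL(2, ℤ)) (l μ : ℤ) {x : ℂ × ℂ} (hx : 0 < x.1.im) :
    wpFun (jacobiMap (g 0 0) (g 0 1) (g 1 0) (g 1 1) l μ x) =
      ((g 1 0 : ℂ) * x.1 + (g 1 1 : ℂ)) ^ 2 * wpFun x := by
  obtain ⟨t, w⟩ := x
  let τ : ℍ := ⟨t, hx⟩
  have hcoe : ((g • τ : ℍ) : ℂ) = ((g 0 0 : ℂ) * t + g 0 1) / ((g 1 0 : ℂ) * t + g 1 1) :=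
    UpperHalfPlane.coe_specialLinearGroup_apply g τ
  have hJ : (g 1 0 : ℂ) * t + g 1 1 ≠ 0 := by
    have := UpperHalfPlane.denom_ne_zero g τ
    simpa [UpperHalfPlane.denom] using this
  have hdet : (g 0 0 : ℂ) * g 1 1 - g 0 1 * g 1 0 = 1 := by
    have := g.det_coe
    rw [Matrix.det_fin_two] at this
    exact_mod_cast this
  have hm : jacobiMap (g 0 0) (g 0 1) (g 1 0) (g 1 1) l μ (t, w) =
      (((g • τ : ℍ) : ℂ), (w + l * t + μ) / ((g 1 0 : ℂ) * t + g 1 1)) := by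
    rw [hcoe]; rfl
  rw [hm, wpFun_coe, PeriodPair.weierstrassP_of_lattice_scale (L := tauPair τ) hJ,
    mul_div_cancel₀ _ hJ, ← wpFun_coe, show w + l * t + μ = w + μ + l * t by ring,
    show ((τ : ℍ) : ℂ) = t from rfl, wpFun_add_lattice]
  -- It remains to see that `(cτ+d) L_{gτ} = L_τ`. One inclusion is `(cτ+d)(m + n gτ) = m(cτ+d) +
  -- n(aτ+b)`; the other uses the inverse matrix, integral because the determinant is `1`.
  intro v
  rw [mem_tauPair_lattice, mem_tauPair_lattice, hcoe, show ((τ : ℍ) : ℂ) = t from rfl]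
  constructor
  · rintro ⟨m, n, rfl⟩
    refine ⟨m * g 1 1 + n * g 0 1, m * g 1 0 + n * g 0 0, ?_⟩
    push_cast
    field_simp
    ring
  · rintro ⟨m, n, h⟩
    refine ⟨g 0 0 * m - g 0 1 * n, g 1 1 * n - g 1 0 * m, mul_left_cancel₀ hJ ?_⟩
    rw [h]
    push_cast
    have hq : ((g 1 0 : ℂ) * t + g 1 1) * (((g 0 0 : ℂ) * t + g 0 1) / ((g 1 0 : ℂ) * t + g 1 1)) =
      (g 0 0 : ℂ) * t + g 0 1 := mul_div_cancel₀ _ hJ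
    linear_combination -(m + n * t) * hdet - (g 1 1 * n - g 1 0 * m) * hq

/-! ### The poles of `℘` -/

/-- The regular part of `℘` at `z = 0`, with the opposite sign. -/
def wpReg (x : ℂ × ℂ) : ℂ :=
  deriv cotReg x.2 - 2 * Real.pi * Complex.I * partialz lambertSum x + wpConst x.1

theorem analyticAt_wpReg {t : ℂ} (ht : 0 < t.im) : AnalyticAt ℂ wpReg (t, 0) := by
  have h1 : AnalyticAt ℂ (fun x : ℂ × ℂ => deriv cotReg x.2) (t, 0) :=
    analyticAt_cotReg.deriv.comp (f := Prod.snd) (x := (t, (0 : ℂ))) analyticAt_snd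
  have h2 : AnalyticAt ℂ (fun x : ℂ × ℂ => wpConst x.1) (t, 0) :=
    (analyticAt_wpConst ht).comp (f := Prod.fst) (x := (t, (0 : ℂ))) analyticAt_fst
  have h3 := (analyticOnNhd_lambertSum _ (zero_mem_strip ht)).partialz
  unfold wpReg
  fun_prop

/-- In the strip a lattice point `m + nτ` has `|n| < 1`, hence is an integer, and the unit disc
leaves only `0`. -/
theorem mem_latticeCompl_of_mem_strip {x : ℂ × ℂ} (hx : x ∈ strip) (h0 : x.2 ≠ 0) (h1 : ‖x.2‖ < 1) :
    x ∈ latticeCompl := by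
  have hs : |x.2.im| < x.1.im := hx
  have ht : 0 < x.1.im := (abs_nonneg _).trans_lt hs
  refine ⟨ht, fun m n h => h0 ?_⟩
  have him : x.2.im = n * x.1.im := by simp [h]
  have hn : n = 0 := by
    rw [him, abs_mul, abs_of_pos ht] at hs
    have := (mul_lt_iff_lt_one_left ht).1 hs
    exact Int.abs_lt_one_iff.1 (by exact_mod_cast this)
  subst hn
  have hm : m = 0 := by
    rw [h] at h1
    simp only [Int.cast_zero, zero_mul, add_zero, Complex.norm_intCast] at h1
    exact Int.abs_lt_one_iff.1 (by exact_mod_cast h1)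
  simp [h, hm]

theorem wpFun_eq_sub_wpReg {x : ℂ × ℂ} (hx : x ∈ strip) (hV : x ∈ latticeCompl)
    (hc : AnalyticAt ℂ cotReg x.2) : wpFun x = (x.2 ^ 2)⁻¹ - wpReg x := by
  have h0 : ∀ {y : ℂ × ℂ}, y ∈ latticeCompl → y.2 ≠ 0 := fun hy => by simpa using hy.2 0 0
  have h1 : ∀ y ∈ latticeCompl, jacobiZeta y =
      y.2⁻¹ + cotReg y.2 - 2 * Real.pi * Complex.I * lambertSum y := fun y hy => by
    rw [jacobiZeta, mul_geomFrac_eq (h0 hy) (latticeCompl_expI_ne_one hy)]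
  have h2 := ((hasDerivAt_inv (h0 hV)).add hc.differentiableAt.hasDerivAt).sub
    ((analyticOnNhd_lambertSum _ hx).differentiableAt.hasDerivAt_partialz.const_mul
      (2 * Real.pi * Complex.I))
  have h3 : partialz jacobiZeta x = _ :=
    (partialz_congr_of_mem isOpen_latticeCompl h1 hV).trans h2.deriv
  rw [partialz_jacobiZeta hV] at h3
  rw [wpReg]
  linear_combination -h3

theorem wpFun_meromorphic (x : ℂ × ℂ) (hx : 0 < x.1.im) : ∃ g h : ℂ × ℂ → ℂ, AnalyticAt ℂ g x ∧
    AnalyticAt ℂ h x ∧ (¬ ∀ᶠ y in 𝓝 x, h y = 0) ∧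
    ∀ᶠ y in 𝓝 x, h y ≠ 0 → wpFun y = g y / h y := by
  by_cases hV : x ∈ latticeCompl
  · exact ⟨wpFun, fun _ => 1, analyticOnNhd_wpFun x hV, analyticAt_const,
      by simpa using (inferInstance : (𝓝 x).NeBot).ne, by simp⟩
  obtain ⟨t, w⟩ := x
  obtain ⟨m, n, rfl⟩ : ∃ m n : ℤ, w = m + n * t := by
    by_contra hcon
    push Not at hcon
    exact hV ⟨hx, hcon⟩
  let σ : ℂ × ℂ → ℂ × ℂ := fun y => (y.1, y.2 - (m + n * y.1))
  have hσ : AnalyticAt ℂ σ (t, m + n * t) :=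
    analyticAt_fst.prod (analyticAt_snd.sub (analyticAt_const.add
      (analyticAt_const.mul analyticAt_fst)))
  have hσx : σ (t, m + n * t) = (t, 0) := by simp [σ]
  have hg : AnalyticAt ℂ (fun y => wpReg (σ y)) (t, m + n * t) :=
    AnalyticAt.comp (g := wpReg) (hσx ▸ analyticAt_wpReg hx) hσ
  have hh : AnalyticAt ℂ (fun y => (σ y).2) (t, m + n * t) := analyticAt_snd.comp hσ
  -- After translating the pole to `σ(y).2 = 0` one has `℘ = 1/z² - wpReg`, so the quotient is `(1 -
  -- z² wpReg)/z²`. The translation varies with `τ`, following the pole.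
  refine ⟨fun y => 1 - (σ y).2 ^ 2 * wpReg (σ y), fun y => (σ y).2 ^ 2, by fun_prop, by fun_prop,
    fun hcon => ?_, ?_⟩
  · have h1 : ∀ᶠ v in 𝓝 (m + n * t), (σ (t, v)).2 ^ 2 = 0 :=
      (Continuous.tendsto' (f := fun v : ℂ => (t, v)) (by fun_prop) _ _ rfl).eventually hcon
    obtain ⟨v, hv, hv'⟩ := ((h1.filter_mono nhdsWithin_le_nhds).and
      (self_mem_nhdsWithin (s := {m + n * t}ᶜ))).exists
    simp only [σ] at hv
    exact hv' (sub_eq_zero.1 (pow_eq_zero_iff (two_ne_zero)|>.1 hv))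
  · have h1 : ∀ᶠ y in 𝓝 (t, (0 : ℂ)), y ∈ strip ∧ ‖y.2‖ < 1 ∧ AnalyticAt ℂ cotReg y.2 := by
      refine (isOpen_strip.eventually_mem (zero_mem_strip hx)).and (Filter.Eventually.and ?_ ?_)
      · exact (isOpen_lt (by fun_prop) continuous_const).mem_nhds (by simp)
      · exact (continuous_snd.continuousAt (x := (t, (0 : ℂ)))).eventually analyticAt_cotReg.eventually_analyticAt
    filter_upwards [(hσx ▸ hσ.continuousAt.tendsto).eventually h1] with y hy h0
    have h2 : (σ y).2 ≠ 0 := fun h => h0 (by rw [h]; simp)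
    have h3 := wpFun_eq_sub_wpReg hy.1 (mem_latticeCompl_of_mem_strip hy.1 h2 hy.2.1) hy.2.2
    have h4 := wpFun_add_lattice (σ y).1 (σ y).2 m n
    simp only [σ] at h2 h3 h4
    rw [show y.2 - (m + n * y.1) + m + n * y.1 = y.2 by ring] at h4
    rw [show wpFun y = _ from h4, h3]
    simp only [σ]
    field_simp

/-! ### The Fourier expansion of `℘` -/

theorem hasSum_succ_mul_pow_succ {v : ℂ} (hv : ‖v‖ < 1) :
    HasSum (fun k : ℕ => ((k : ℂ) + 1) * v ^ (k + 1)) (v / (1 - v) ^ 2) := by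
  have h := (hasSum_nat_add_iff' (f := fun n : ℕ => (n : ℂ) * v ^ n) 1).2
    (hasSum_coe_mul_geometric_of_norm_lt_one hv)
  simpa only [Finset.sum_range_one, Nat.cast_zero, zero_mul, sub_zero, Nat.cast_add_one] using h

/-- The series `∑ q^n v / (1 - q^n v)²` over `n ≥ 0`. -/
def lambertSq (q v : ℂ) : ℂ := ∑' n : ℕ, q ^ n * v / (1 - q ^ n * v) ^ 2

theorem norm_pow_mul_lt_one {q v : ℂ} (hq : ‖q‖ < 1) (hv : ‖v‖ < 1) (n : ℕ) : ‖q ^ n * v‖ < 1 := by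
  rw [norm_mul, norm_pow]
  exact mul_lt_one_of_nonneg_of_lt_one_right (pow_le_one₀ (norm_nonneg _) hq.le) (norm_nonneg _) hv

/-- Because the exponent `k + 1` is at least one, `|q|^(n(k+1)) ≤ |q|^n`, and the double series is
dominated by a product of two convergent series. This justifies all later rearrangements. -/
theorem summable_lambertSq {q v : ℂ} (hq : ‖q‖ < 1) (hv : ‖v‖ < 1) :
    Summable fun i : ℕ × ℕ => ((i.2 : ℂ) + 1) * (q ^ i.1 * v) ^ (i.2 + 1) := by
  have hk : ∀ k : ℕ, ‖(k : ℂ) + 1‖ = k + 1 := fun k => by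
    rw [← Nat.cast_add_one, Complex.norm_natCast, Nat.cast_add_one]
  have h1 : Summable fun k : ℕ => ((k : ℝ) + 1) * ‖v‖ ^ (k + 1) :=
    (hasSum_succ_mul_pow_succ hv).summable.norm.congr fun k => by rw [norm_mul, norm_pow, hk]
  have h2 : Summable fun i : ℕ × ℕ => ‖q‖ ^ i.1 * (((i.2 : ℝ) + 1) * ‖v‖ ^ (i.2 + 1)) :=
    (summable_geometric_of_lt_one (norm_nonneg q) hq).mul_of_nonneg h1
      (fun n => pow_nonneg (norm_nonneg q) n)
      fun k => mul_nonneg (by positivity) (pow_nonneg (norm_nonneg v) _)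
  refine Summable.of_norm_bounded h2 fun i => ?_
  have h3 : ‖q‖ ^ (i.1 * (i.2 + 1)) ≤ ‖q‖ ^ i.1 :=
    pow_le_pow_of_le_one (norm_nonneg _) hq.le (Nat.le_mul_of_pos_right _ i.2.succ_pos)
  rw [norm_mul, norm_pow, norm_mul, norm_pow, mul_pow, ← pow_mul, hk, mul_left_comm]
  exact mul_le_mul_of_nonneg_right h3 (mul_nonneg (by positivity) (pow_nonneg (norm_nonneg v) _))

theorem hasSum_lambertSq {q v : ℂ} (hq : ‖q‖ < 1) (hv : ‖v‖ < 1) :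
    HasSum (fun i : ℕ × ℕ => ((i.2 : ℂ) + 1) * (q ^ i.1 * v) ^ (i.2 + 1)) (lambertSq q v) := by
  have hs := summable_lambertSq hq hv
  have hf : ∀ n : ℕ, HasSum (fun k : ℕ => ((k : ℂ) + 1) * (q ^ n * v) ^ (k + 1))
      (q ^ n * v / (1 - q ^ n * v) ^ 2) := fun n =>
    hasSum_succ_mul_pow_succ (norm_pow_mul_lt_one hq hv n)
  have h1 : ∑' i : ℕ × ℕ, ((i.2 : ℂ) + 1) * (q ^ i.1 * v) ^ (i.2 + 1) =
      ∑' n : ℕ, q ^ n * v / (1 - q ^ n * v) ^ 2 :=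
    hs.tsum_prod.trans (tsum_congr fun n => (hf n).tsum_eq)
  rw [lambertSq, ← h1]
  exact hs.hasSum

/-- For `|v| < r < 1` the terms are bounded by `|q|^n r/(1 - r)` on the disc of radius `r`; termwise
differentiation is Weierstrass's theorem. -/
theorem hasDerivAt_tsum_geomFrac {q v : ℂ} (hq : ‖q‖ < 1) (hv : ‖v‖ < 1) :
    HasDerivAt (fun v => ∑' n : ℕ, geomFrac (q ^ n * v)) (∑' n : ℕ, q ^ n / (1 - q ^ n * v) ^ 2) v := by
  obtain ⟨r, hvr, hr⟩ := exists_between hv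
  have hr0 : 0 < r := (norm_nonneg v).trans_lt hvr
  have hmem : ∀ {w : ℂ}, w ∈ Metric.ball (0 : ℂ) r → ‖w‖ < r := fun h => mem_ball_zero_iff.1 h
  have hne : ∀ {w : ℂ} (n : ℕ), ‖w‖ < 1 → 1 - q ^ n * w ≠ 0 := fun {w} n hw h => by
    have := norm_pow_mul_lt_one hq hw n
    rw [← sub_eq_zero.1 h, norm_one] at this
    exact lt_irrefl _ this
  have hd : ∀ {w : ℂ} (n : ℕ), ‖w‖ < 1 →
      HasDerivAt (fun v => geomFrac (q ^ n * v)) (q ^ n / (1 - q ^ n * w) ^ 2) w := by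
    intro w n hw
    have h1 : HasDerivAt (fun v => q ^ n * v) (q ^ n) w := by
      simpa using (hasDerivAt_id w).const_mul (q ^ n)
    refine (h1.fun_div (h1.const_sub 1) (hne n hw)).congr_deriv ?_
    congr 1
    ring
  have hu : Summable fun n : ℕ => ‖q‖ ^ n * (r / (1 - r)) :=
    (summable_geometric_of_lt_one (norm_nonneg q) hq).mul_right _
  have hF : ∀ (n : ℕ) (w : ℂ), w ∈ Metric.ball (0 : ℂ) r →
      ‖geomFrac (q ^ n * w)‖ ≤ ‖q‖ ^ n * (r / (1 - r)) := by
    intro n w hw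
    have h1 : ‖q ^ n * w‖ ≤ ‖q‖ ^ n * r := by
      rw [norm_mul, norm_pow]
      have := (hmem hw).le
      gcongr
    refine (norm_geomFrac_le hr (h1.trans (mul_le_of_le_one_left hr0.le
      (pow_le_one₀ (norm_nonneg _) hq.le)))).trans ?_
    rw [← mul_div_assoc]
    exact div_le_div_of_nonneg_right h1 (by linarith)
  have hdiff : ∀ n : ℕ, DifferentiableOn ℂ (fun v => geomFrac (q ^ n * v)) (Metric.ball (0 : ℂ) r) :=
    fun n w hw => (hd n ((hmem hw).trans hr)).differentiableAt.differentiableWithinAt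
  have hvb : v ∈ Metric.ball (0 : ℂ) r := mem_ball_zero_iff.2 hvr
  have h1 := Complex.hasSum_deriv_of_summable_norm hu hdiff Metric.isOpen_ball hF hvb
  simp only [fun n => (hd n hv).deriv] at h1
  rw [h1.tsum_eq]
  exact ((Complex.differentiableOn_tsum_of_summable_norm hu hdiff Metric.isOpen_ball hF).differentiableAt
    (Metric.isOpen_ball.mem_nhds hvb)).hasDerivAt

theorem hasDerivAt_expI (w : ℂ) : HasDerivAt expI (2 * Real.pi * Complex.I * expI w) w := by
  have : HasDerivAt expI (expI w * (2 * Real.pi * Complex.I * 1)) w :=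
    ((hasDerivAt_id w).const_mul (2 * Real.pi * Complex.I)).cexp
  exact this.congr_deriv (by ring)

/-- The derivative of the Lambert series in the logarithmic variable. -/
theorem hasDerivAt_tsum_geomFrac_expI {q a : ℂ} {φ : ℂ → ℂ} {ε w : ℂ} (hq : ‖q‖ < 1)
    (hφ : HasDerivAt φ ε w) (hv : ‖a * expI (φ w)‖ < 1) :
    HasDerivAt (fun w => ∑' n : ℕ, geomFrac (q ^ n * (a * expI (φ w))))
      (2 * Real.pi * Complex.I * ε * lambertSq q (a * expI (φ w))) w := by
  have h1 := ((hasDerivAt_expI (φ w)).comp w hφ).const_mul a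
  refine ((hasDerivAt_tsum_geomFrac hq hv).comp w h1).congr_deriv ?_
  have h2 : lambertSq q (a * expI (φ w)) =
      (∑' n : ℕ, q ^ n / (1 - q ^ n * (a * expI (φ w))) ^ 2) * (a * expI (φ w)) := by
    rw [lambertSq, ← tsum_mul_right]
    exact tsum_congr fun n => by ring
  rw [h2]
  ring

theorem expI_nat_mul (n : ℕ) (w : ℂ) : expI (n * w) = expI w ^ n := by
  rw [expI, expI, ← Complex.exp_nat_mul]
  congr 1
  ring

theorem norm_expI_lt_one {w : ℂ} (hw : 0 < w.im) : ‖expI w‖ < 1 := by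
  rw [norm_expI, Real.exp_lt_one_iff]
  have := mul_pos Real.two_pi_pos hw
  linarith

theorem lambertSum_eq_geomFrac_pow {t w : ℂ} (ht : 0 < t.im) : lambertSum (t, w) =
    ∑' n : ℕ, geomFrac (expI t ^ n * (expI t * expI w))
      - ∑' n : ℕ, geomFrac (expI t ^ n * (expI t * expI (-w))) := by
  have h : ∀ (n : ℕ) (v : ℂ), expI ((n + 1) * t + v) = expI t ^ n * (expI t * expI v) := fun n v => by
    rw [← expI_nat_mul, ← expI_add, ← expI_add]
    congr 1
    ring
  rw [lambertSum_eq (by exact ht)]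
  simp only [h]

theorem partialz_lambertSum {t w : ℂ} (h : (t, w) ∈ strip) :
    partialz lambertSum (t, w) = 2 * Real.pi * Complex.I *
      (lambertSq (expI t) (expI (t + w)) + lambertSq (expI t) (expI (t - w))) := by
  have hs := abs_lt.1 (show |w.im| < t.im from h)
  have ht : 0 < t.im := (abs_nonneg _).trans_lt h
  have hq := norm_expI_lt_one ht
  have h1 := hasDerivAt_tsum_geomFrac_expI (a := expI t) hq (hasDerivAt_id' w)
    (by rw [← expI_add]; exact norm_expI_lt_one (by simp; linarith))
  have h2 := hasDerivAt_tsum_geomFrac_expI (a := expI t) hq (hasDerivAt_neg w)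
    (by rw [← expI_add]; exact norm_expI_lt_one (by simp; linarith))
  have h3 : (fun w => lambertSum (t, w)) = _ := funext fun w => lambertSum_eq_geomFrac_pow ht
  rw [partialz]
  dsimp only
  rw [h3, (h1.fun_sub h2).deriv, ← expI_add, ← expI_add, sub_eq_add_neg t]
  ring

/-- The formula `℘ = -Z_z - e` with all Lambert series differentiated. Positivity of `Im z` lets the
isolated cotangent term be absorbed as the `n = 0` term of the first series. The constant `deriv
cotReg 0` need not be evaluated. -/
theorem wpFun_eq_lambertSq {x : ℂ × ℂ} (h0 : 0 < x.2.im) (h1 : x.2.im < x.1.im) :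
    wpFun x = (2 * Real.pi * Complex.I) ^ 2 * (lambertSq (expI x.1) (expI x.2)
      + lambertSq (expI x.1) (expI (x.1 - x.2)) - 2 * lambertSq (expI x.1) (expI x.1))
      + deriv cotReg 0 := by
  obtain ⟨t, w⟩ := x
  simp only at h0 h1 ⊢
  have ht : 0 < t.im := h0.trans h1
  have hs : (t, w) ∈ strip := by simpa [strip, abs_of_pos h0] using h1
  have hV : (t, w) ∈ latticeCompl := by
    refine ⟨ht, fun m n hmn => ?_⟩
    have him : w.im = n * t.im := by
      simp only at hmn
      simp [hmn]
    rw [him] at h0 h1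
    have h2 : 0 < n := by exact_mod_cast pos_of_mul_pos_left h0 ht.le
    have h3 : n < 1 := by exact_mod_cast (mul_lt_iff_lt_one_left ht).1 h1
    omega
  have hq := norm_expI_lt_one ht
  have hw := norm_expI_lt_one h0
  have hw1 : 1 - expI w ≠ 0 := sub_ne_zero.2 (latticeCompl_expI_ne_one hV).symm
  have h2 : HasDerivAt (fun w => geomFrac (expI w))
      (2 * Real.pi * Complex.I * (expI w / (1 - expI w) ^ 2)) w := by
    refine ((hasDerivAt_expI w).fun_div ((hasDerivAt_expI w).const_sub 1) hw1).congr_deriv ?_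
    field_simp
    ring
  have h3 := ((h2.const_mul 2).const_add 1).const_mul (-(Real.pi * Complex.I)) |>.sub
    ((analyticOnNhd_lambertSum _ hs).differentiableAt.hasDerivAt_partialz.const_mul
      (2 * Real.pi * Complex.I))
  have h4 : partialz jacobiZeta (t, w) = _ := h3.deriv
  have h5 : lambertSq (expI t) (expI w) = expI w / (1 - expI w) ^ 2 +
      lambertSq (expI t) (expI (t + w)) := by
    have := ((hasSum_lambertSq hq hw).summable.prod).congr fun n =>
      (hasSum_succ_mul_pow_succ (norm_pow_mul_lt_one hq hw n)).tsum_eq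
    rw [lambertSq, this.tsum_eq_zero_add, lambertSq, expI_add]
    congr 1
    · simp
    · exact tsum_congr fun n => by rw [pow_succ, mul_assoc]
  rw [partialz_jacobiZeta hV, wpConst_eq ht, partialz_lambertSum hs,
    partialz_lambertSum (zero_mem_strip ht), add_zero, sub_zero] at h4
  rw [h5]
  linear_combination -h4

/-- Collecting equal monomials in a double Fourier series. -/
theorem hasSum_collect {ι : Type*} (γ : ι → ℤ × ℤ) (a : ι → ℂ) {q ζ s : ℂ}
    (h : HasSum (fun i => a i * q ^ (γ i).1 * ζ ^ (γ i).2) s) :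
    HasSum (fun p : ℤ × ℤ => (∑' i : {i // γ i = p}, a i) * q ^ p.1 * ζ ^ p.2) s := by
  have h1 := (Equiv.sigmaFiberEquiv γ).hasSum_iff.2 h
  refine h1.sigma fun p => ?_
  have h2 := h1.summable.sigma_factor p
  have h3 : ∀ c : {i // γ i = p}, a c * q ^ p.1 * ζ ^ p.2 =
      ((fun i => a i * q ^ (γ i).1 * ζ ^ (γ i).2) ∘ Equiv.sigmaFiberEquiv γ) ⟨p, c⟩ := by
    rintro ⟨c, rfl⟩
    rfl
  rw [← tsum_mul_right, ← tsum_mul_right, tsum_congr h3]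
  exact h2.hasSum

/-- The Fourier coefficients of the double series with exponents `γ` and coefficients `b (k + 1)`. -/
def fiberCoeff (γ : ℕ × ℕ → ℤ × ℤ) (b : ℂ) (p : ℤ × ℤ) : ℂ :=
  ∑' i : {i // γ i = p}, b * ((i.1.2 : ℂ) + 1)

theorem fiberCoeff_eq_zero {γ : ℕ × ℕ → ℤ × ℤ} (b : ℂ) (hγ : ∀ i, 0 ≤ (γ i).1) {p : ℤ × ℤ}
    (hp : p.1 < 0) : fiberCoeff γ b p = 0 := by
  have : IsEmpty {i // γ i = p} := ⟨fun i => by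
    have := hγ i.1
    rw [i.2] at this
    omega⟩
  exact tsum_empty

/-- Absolute convergence of the double series over `(n, k)` permits grouping the terms with the same
monomial, without determining the resulting divisor sums. -/
theorem hasSum_fiberCoeff {γ : ℕ × ℕ → ℤ × ℤ} (b : ℂ) {q v ζ : ℂ} (hq : ‖q‖ < 1) (hv : ‖v‖ < 1)
    (hγ : ∀ i : ℕ × ℕ, (q ^ i.1 * v) ^ (i.2 + 1) = q ^ (γ i).1 * ζ ^ (γ i).2) :
    HasSum (fun p : ℤ × ℤ => fiberCoeff γ b p * q ^ p.1 * ζ ^ p.2) (b * lambertSq q v) := by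
  refine hasSum_collect γ (fun i => b * ((i.2 : ℂ) + 1)) ?_
  refine ((hasSum_lambertSq hq hv).mul_left b).congr_fun fun i => ?_
  rw [hγ]
  ring

theorem wpFun_fourier : ∃ (n₀ : ℤ) (c : ℤ × ℤ → ℂ) (U : Set (ℂ × ℂ)),
    (∀ n r, n < n₀ → c (n, r) = 0) ∧
    IsOpen U ∧ U.Nonempty ∧ (∀ x ∈ U, 0 < x.1.im) ∧ ∀ x ∈ U,
      HasSum (fun p : ℤ × ℤ => c p * Complex.exp (2 * Real.pi * Complex.I * x.1) ^ p.1 *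
        Complex.exp (2 * Real.pi * Complex.I * x.2) ^ p.2) (wpFun x) := by
  -- The exponents of `(q^n v)^(k+1)` in `q` and `ζ` for `v = ζ`, `v = q ζ⁻¹` and `v = q`, the
  -- arguments of the three Lambert series.
  let γ₁ : ℕ × ℕ → ℤ × ℤ := fun i => (i.1 * (i.2 + 1), i.2 + 1)
  let γ₂ : ℕ × ℕ → ℤ × ℤ := fun i => ((i.1 + 1) * (i.2 + 1), -(i.2 + 1))
  let γ₃ : ℕ × ℕ → ℤ × ℤ := fun i => ((i.1 + 1) * (i.2 + 1), 0)
  set β : ℂ := (2 * Real.pi * Complex.I) ^ 2 with hβ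
  refine ⟨0, fun p => fiberCoeff γ₁ β p + fiberCoeff γ₂ β p + fiberCoeff γ₃ (-2 * β) p
    + if p = 0 then deriv cotReg 0 else 0, {x | 0 < x.2.im} ∩ {x | x.2.im < x.1.im}, ?_, ?_, ?_, ?_, ?_⟩
  · intro n r hn
    dsimp only
    rw [fiberCoeff_eq_zero β _ hn, fiberCoeff_eq_zero β _ hn, fiberCoeff_eq_zero (-2 * β) _ hn, if_neg]
    · simp
    · simp only [Prod.mk_eq_zero, not_and]
      omega
    all_goals exact fun i => by positivity
  · exact (isOpen_lt (by fun_prop) (by fun_prop)).inter (isOpen_lt (by fun_prop) (by fun_prop))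
  · exact ⟨(2 * Complex.I, Complex.I), by simp, by simp⟩
  · exact fun x hx => lt_trans hx.1 hx.2
  · rintro x ⟨h0, h1⟩
    rw [Set.mem_ofPred_eq] at h0 h1
    rw [wpFun_eq_lambertSq h0 h1]
    change HasSum (fun p : ℤ × ℤ => _ * expI x.1 ^ p.1 * expI x.2 ^ p.2) _
    have hq := norm_expI_lt_one (h0.trans h1)
    have hq0 := expI_ne_zero x.1
    have hz0 := expI_ne_zero x.2
    have s1 := hasSum_fiberCoeff (γ := γ₁) (ζ := expI x.2) β hq (norm_expI_lt_one h0) fun i => by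
      simp only [γ₁]
      rw [mul_pow, ← pow_mul]
      norm_cast
    have s2 := hasSum_fiberCoeff (γ := γ₂) (ζ := expI x.2) β hq
        (norm_expI_lt_one (w := x.1 - x.2) (by simpa using h1)) fun i => by
      simp only [γ₂]
      rw [sub_eq_add_neg, expI_add, expI_neg, ← mul_assoc, ← pow_succ, mul_pow, ← pow_mul, inv_pow,
        zpow_neg]
      norm_cast
    have s3 := hasSum_fiberCoeff (γ := γ₃) (ζ := expI x.2) (-2 * β) hq hq fun i => by
      simp only [γ₃]
      rw [← pow_succ, ← pow_mul, zpow_zero, mul_one]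
      norm_cast
    have s4 : HasSum (fun p : ℤ × ℤ => (if p = 0 then deriv cotReg 0 else 0) * expI x.1 ^ p.1
        * expI x.2 ^ p.2) (deriv cotReg 0) := by
      convert hasSum_single (f := fun p : ℤ × ℤ => (if p = 0 then deriv cotReg 0 else 0)
        * expI x.1 ^ p.1 * expI x.2 ^ p.2) 0 (fun p hp => by simp [hp]) using 1
      simp
    convert ((s1.add s2).add s3).add s4 using 1
    · funext p
      ring
    · ring

theorem wpFun_isWeakJacobiForm : IsWeakJacobiForm 2 0 wpFun where
  meromorphic := wpFun_meromorphic
  transform g l μ x hx _ _ := by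
    rw [wpFun_jacobiMap g l μ hx]
    simp
  fourier := wpFun_fourier

end

/-! ### The complete theorem -/

theorem mainTheorem10 :
    -- `℘` is a (weak, meromorphic) Jacobi form of weight 2 and index 0, holomorphic off the lattice
    IsWeakJacobiForm 2 0 wpFun ∧
    (∀ (τ : ℍ) (z : ℂ), z ∉ (tauPair τ).lattice → AnalyticAt ℂ wpFun ((τ : ℂ), z)) ∧
    -- the system is involutive (at order 3) and `G_{2,0}`-invariant
    wpSystem.IsInvolutive 2 ∧
    wpSystem.IsJacobiInvariant 2 ∧
    -- the system in solved form
    (∀ u : Jet2, wpSystem.HoldsAt u ↔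
      2 * u (0, 0) * u (0, 2) - 3 * u (0, 1) ^ 2 ≠ 0 ∧ WpSolvedForm u) ∧
    -- the system in invariant form, with the invariance of its ingredients
    (IsJacobiDiffInvariant 2 (scrI 2) ∧ IsJacobiDiffInvariant 2 (scrJ 2) ∧
      IsJacobiDiffInvariant 2 scrL ∧ IsJacobiDiffInvariant 2 scrM ∧
      IsJacobiDiffInvariant 2 scrN) ∧
    (∀ (u : Jet2) (s : ℂ), u (0, 0) ≠ 0 → s ^ 2 = u (0, 0) →
      2 * u (0, 0) * u (0, 2) - 3 * u (0, 1) ^ 2 ≠ 0 →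
      (wpSystem.HoldsAt u ↔ WpInvariantForm s u)) ∧
    -- `℘` satisfies the system
    (∀ (τ : ℍ) (z : ℂ), z ∉ (tauPair τ).lattice →
      (∀ i, MvPolynomial.eval (jetAt wpFun ((τ : ℂ), z)) (wpSystem.eq i) = 0) ∧
      (∀ u : Jet2, u = jetAt wpFun ((τ : ℂ), z) →
        (2 * u (0, 0) * u (0, 2) - 3 * u (0, 1) ^ 2 ≠ 0 → WpSolvedForm u) ∧
        (∀ s : ℂ, u (0, 0) ≠ 0 → s ^ 2 = u (0, 0) →
          2 * u (0, 0) * u (0, 2) - 3 * u (0, 1) ^ 2 ≠ 0 → WpInvariantForm s u) ∧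
        u (0, 3) = 12 * u (0, 0) * u (0, 1) ∧
        (∀ g₂ g₃ : ℂ, g₂ = 4 / 3 * Real.pi ^ 4 * ModularForm.E₄ τ →
          g₃ = 8 / 27 * Real.pi ^ 6 * ModularForm.E₆ τ →
          u (0, 1) ^ 2 = 4 * u (0, 0) ^ 3 - g₂ * u (0, 0) - g₃ ∧
          wpPhi u = -2 * (g₂ ^ 3 - 27 * g₃ ^ 2)) ∧
        wpPhi u = -2 * (2 * Real.pi) ^ 12 * ModularForm.discriminant τ ∧
        2 * u (0, 0) * (u (0, 2) * u (2, 0) - u (1, 1) ^ 2) =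
          3 * u (0, 1) ^ 2 * u (2, 0) - 6 * u (1, 0) * u (0, 1) * u (1, 1)
            + 3 * u (1, 0) ^ 2 * u (0, 2)
            - (2 * Real.pi) ^ 10 / 6 * ModularForm.discriminant τ)) := by
  exact ⟨wpFun_isWeakJacobiForm, fun τ z hz => analyticOnNhd_wpFun _ (mem_latticeCompl_iff.2 hz),
    wpSystem_isInvolutive, wpSystem_isJacobiInvariant, wpSystem_holdsAt_iff_solved,
    jacobi_diffInvariants, wpSystem_holdsAt_iff_invariant, wpFun_system⟩
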